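/- Let $\hat q_1,\dots,\hat q_m,\hat p_1,\dots,\hat p_m$ be the position and momentum quadratures of $m\ge 1$ bosonic modes on $L^2(\mathbb R^m)$, with $[\hat q_j,\hat p_j]=2i$. A displaced orthogonal gate is a unitary $\hat O=e^{i\varphi}\hat D\hat U_R$, where $\hat U_R$ is the passive gate $(\hat U_R\psi)(x)=\psi(R^{-1}x)$ of an orthogonal $m\times m$ matrix $R$ (so that its symplectic matrix is block-diagonal, $\mathrm{diag}(R,R)$) and $\hat D$ is a displacement; it acts by $\hat O^\dagger\hat{\mathbf q}\,\hat O=R\hat{\mathbf q}+u$ and $\hat O^\dagger\hat{\mathbf p}\,\hat O=R\hat{\mathbf p}+v$ with $u,v\in\mathbb R^m$. Let $t,d\ge 0$, let $$\hat O_{\boldsymbol\gamma}=\hat O_t\,e^{i\gamma_t\hat q_1^3}\,\hat O_{t-1}\cdots\hat O_1\,e^{i\gamma_1\hat q_1^3}\,\hat O_0$$ with displaced orthogonal gates $\hat O_0,\dots,\hat O_t$ and $\gamma_1,\dots,\gamma_t\in\mathbb R$, let $\rho$ be a density operator on $L^2(\mathbb R^m)$ all of whose moments of order at most $2d$ exist,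 i.e. for every product $W$ of at most $2d$ quadratures the range of $\rho$ lies in the domain of $W$ and $W\rho$ is trace class, and let $H(\hat{\mathbf q},\hat{\mathbf p})$ be a polynomial of degree at most $d$ in the quadratures, with complex coefficients. Then the expectation value $$\mathrm{Tr}[\hat O_{\boldsymbol\gamma}\,\rho\,\hat O_{\boldsymbol\gamma}^\dagger\,H(\hat{\mathbf q},\hat{\mathbf p})]=\mathrm{Tr}[\rho\,\hat O_{\boldsymbol\gamma}^\dagger\,H(\hat{\mathbf q},\hat{\mathbf p})\,\hat O_{\boldsymbol\gamma}]$$ exists (that is, both operators are defined and trace class, and the two traces agree), and it can be computed exactly in time $O(m^{3d}+t^2m^6)$, where the implied constant depends only on $d$. Here time is the number of steps of a single program, the same for all inputs, on a random access machine with exact complex arithmetic (each arithmetic operation, memory access or comparison of integers costs one step). The program receives $m$, $t$, $d$, the orthogonal matrices and displacement vectors of the gates, the numbers $\gamma_k$, the coefficients of $H$ with respect to the products of at most $d$ quadratures, and, as the description of $\rho$, the table of its moments $\mathrm{Tr}[\rho W]$ for all products $W$ of at most $2d$ quadratures. -/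

import Mathlib

open MeasureTheory
open scoped ContDiff InnerProductSpace

noncomputable section

namespace CV

/-! ### Hilbert space, trace and expectation values

`m` modes, convention `ħ = 2`, so that `[q̂, p̂] = 2i`. -/

/-- Configuration space of `m` modes. -/
abbrev Conf (m : ℕ) : Type := EuclideanSpace ℝ (Fin m)

/-- The Hilbert space `L²(ℝᵐ; ℂ)` of `m` modes, in the position representation. -/
abbrev Hilb (m : ℕ) : Type := Lp ℂ 2 (volume : Measure (Conf m))

/-- `T` is trace class with trace `τ`: the diagonal sum over every orthonormal basis converges
unconditionally, to `τ`. -/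
def HasTrace {m : ℕ} (T : Hilb m →L[ℂ] Hilb m) (τ : ℂ) : Prop :=
  ∀ (ι : Type) (b : HilbertBasis ι ℂ (Hilb m)), HasSum (fun i => ⟪b i, T (b i)⟫_ℂ) τ

/-- Density operators (quantum states): positive operators of trace one. -/
structure IsState {m : ℕ} (ρ : Hilb m →L[ℂ] Hilb m) : Prop where
  pos : ρ.IsPositive
  trace_one : HasTrace ρ 1

/-- Unbounded operators are given by their graph: `A f g` says that `f` is in the domain of `A`
and that `A f = g`. -/
abbrev Graph (m : ℕ) : Type := Hilb m → Hilb m → Prop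

/-- `Tr[ρ A] = v` for an unbounded operator `A`: the range of `ρ` lies in the domain of `A`, and
`A ρ` is a trace-class operator with trace `v`. -/
def HasExpectation {m : ℕ} (ρ : Hilb m →L[ℂ] Hilb m) (A : Graph m) (v : ℂ) : Prop :=
  ∃ T : Hilb m →L[ℂ] Hilb m, (∀ f, A (ρ f) (T f)) ∧ HasTrace T v

/-- The operator `U† A U`. -/
def conjGraph {m : ℕ} (U : Hilb m →L[ℂ] Hilb m) (A : Graph m) : Graph m :=
  fun f g => ∃ k, A (U f) k ∧ g = ContinuousLinearMap.adjoint U k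

/-! ### Quadratures and their polynomials -/

/-- The position quadrature `q̂_j`: multiplication by `x_j`, on its maximal domain. -/
def posGraph {m : ℕ} (j : Fin m) : Graph m :=
  fun f g => ∀ᵐ x : Conf m, g x = (x j : ℂ) * f x

/-- The momentum quadrature `p̂_j = -2i ∂_j`, with weak derivatives, on its maximal domain. -/
def momGraph {m : ℕ} (j : Fin m) : Graph m :=
  fun f g => ∀ φ : Conf m → ℂ, ContDiff ℝ ∞ φ → HasCompactSupport φ →
    ∫ x, φ x * g x =
      2 * Complex.I * ∫ x, (fderiv ℝ φ x (EuclideanSpace.single j (1 : ℝ))) * f x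

/-- Letters of words in the quadratures: the identity, the `q̂_j` and the `p̂_j`. The identity is a
letter so that the words of length exactly `n` are all the products of at most `n` quadratures. -/
inductive Letter (m : ℕ) : Type
  | one : Letter m
  | pos (j : Fin m) : Letter m
  | mom (j : Fin m) : Letter m

/-- The numbers `0, 1, …, 2m` of the letters `1, q̂_1, …, q̂_m, p̂_1, …, p̂_m`. -/
def Letter.code {m : ℕ} : Letter m → ℕ
  | .one => 0
  | .pos j => 1 + j
  | .mom j => 1 + m + j

theorem Letter.code_lt {m : ℕ} (a : Letter m) : a.code < 2 * m + 1 := by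
  cases a <;> simp only [Letter.code] <;> omega

theorem Letter.code_injective {m : ℕ} : Function.Injective (Letter.code (m := m)) := by
  intro a b h
  cases a <;> cases b <;> simp only [Letter.code] at h <;>
    first
      | rfl
      | (exfalso; omega)
      | (congr 1; apply Fin.ext; omega)

instance {m : ℕ} : Fintype (Letter m) :=
  Fintype.ofInjective (fun a : Letter m => (⟨a.code, a.code_lt⟩ : Fin (2 * m + 1)))
    (fun _ _ h => Letter.code_injective (congrArg Fin.val h))

/-- The operator of a letter. -/
def letterGraph {m : ℕ} : Letter m → Graph m
  | .one => fun f g => g = f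
  | .pos j => posGraph j
  | .mom j => momGraph j

/-- The operator product of the letters of a word (the last letter acts first). -/
def wordGraph {m : ℕ} : List (Letter m) → Graph m
  | [] => fun f g => g = f
  | a :: w => fun f g => ∃ k, wordGraph w f k ∧ letterGraph a k g

/-- The polynomial `H(q̂, p̂) = ∑_w h(w) ŵ` of degree at most `d` in the quadratures, the sum being
over the words of length `d` in `1, q̂_1, …, q̂_m, p̂_1, …, p̂_m`, on the common domain of the
words. -/
def polyGraph {m d : ℕ} (h : (Fin d → Letter m) → ℂ) : Graph m :=
  fun f g => ∃ G : (Fin d → Letter m) → Hilb m,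
    (∀ w, wordGraph (List.ofFn w) f (G w)) ∧ g = ∑ w, h w • G w

/-! ### Gates and circuits -/

/-- The unitary operator `(Uψ)(x) = e^{iθ(x)} ψ(x)`. -/
def phaseOp {m : ℕ} (θ : C(Conf m, ℝ)) : Hilb m →L[ℂ] Hilb m :=
  (ContinuousLinearMap.mul ℂ ℂ).holderL (volume : Measure (Conf m)) ⊤ 2 2
    ((memLp_top_of_bound (f := fun x : Conf m => Complex.exp (θ x * Complex.I))
      (by fun_prop) 1 (.of_forall fun x => (Complex.norm_exp_ofReal_mul_I _).le)).toLp _)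

/-- The cubic phase gate `e^{iγ q̂_1³}` on the first mode. -/
def cubicGate {m : ℕ} [NeZero m] (γ : ℝ) : Hilb m →L[ℂ] Hilb m :=
  phaseOp ⟨fun x => γ * x 0 ^ 3, by fun_prop⟩

/-- The orthogonal gate `(Uψ)(x) = ψ(R⁻¹ x)` of an orthogonal transformation `R` of `ℝᵐ`. It has
`U† q̂ U = R q̂` and `U† p̂ U = R p̂`, so its symplectic matrix is `diag(R, R)`: these are the
block-diagonal symplectic matrices with orthogonal blocks. -/
def orthogonalGate {m : ℕ} (R : Conf m ≃ₗᵢ[ℝ] Conf m) : Hilb m →L[ℂ] Hilb m :=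
  (Lp.compMeasurePreservingₗᵢ ℂ R.symm R.symm.measurePreserving).toContinuousLinearMap

/-- The displacement `D = ⊗_j D(α_j)` with `α = (u + iv) / 2`, where
`D(α) = exp(α â† - α* â) = exp(i (v q̂ - u p̂) / 2)`, that is,
`(Dψ)(x) = e^{i (v·x / 2 - u·v / 4)} ψ(x - u)`. It has `D† q̂ D = q̂ + u` and `D† p̂ D = p̂ + v`. -/
def displacementGate {m : ℕ} (u v : Conf m) : Hilb m →L[ℂ] Hilb m :=
  phaseOp ⟨fun x => ⟪v, x⟫_ℝ / 2 - ⟪u, v⟫_ℝ / 4, by fun_prop⟩ ∘L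
    (Lp.compMeasurePreservingₗᵢ ℂ (fun x : Conf m => x - u)
      (measurePreserving_sub_right volume u)).toContinuousLinearMap

/-- The data of a displaced orthogonal gate: an orthogonal transformation, a displacement vector
`(u, v)` and a global phase. -/
structure DispOrth (m : ℕ) where
  R : Conf m ≃ₗᵢ[ℝ] Conf m
  u : Conf m
  v : Conf m
  phase : ℝ

/-- The displaced orthogonal gate `e^{i phase} D(u, v) O(R)`, which acts by
`q̂ ↦ R q̂ + u` and `p̂ ↦ R p̂ + v`. -/
def DispOrth.gate {m : ℕ} (g : DispOrth m) : Hilb m →L[ℂ] Hilb m :=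
  Complex.exp (g.phase * Complex.I) • (displacementGate g.u g.v ∘L orthogonalGate g.R)

/-- The entry `R_{ij}` of the matrix of the orthogonal transformation of the gate. -/
def DispOrth.entry {m : ℕ} (g : DispOrth m) (i j : Fin m) : ℝ :=
  g.R (EuclideanSpace.single j (1 : ℝ)) i

/-- The circuit `O_t e^{iγ_t q̂_1³} O_{t-1} ⋯ O_1 e^{iγ_1 q̂_1³} O_0`; here `γ k` is `γ_{k+1}`. -/
def circuit {m : ℕ} [NeZero m] :
    (t : ℕ) → (Fin (t + 1) → DispOrth m) → (Fin t → ℝ) → (Hilb m →L[ℂ] Hilb m)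
  | 0, g, _ => (g 0).gate
  | t + 1, g, γ => (g (Fin.last (t + 1))).gate ∘L cubicGate (γ (Fin.last t)) ∘L
      circuit t (fun k => g k.castSucc) (fun k => γ k.castSucc)

/-! ### The machine model

An algebraic random access machine. It has registers and arrays of natural numbers, for counting,
addressing and control, and registers and arrays of complex numbers, on which it does exact
arithmetic. Only `+`, truncated `-` and comparison are available on the natural numbers, and only
`+`, `-`, `*` on the complex numbers, which cannot be tested. Every instruction and every test costs
one step. -/

structure State where
  ireg : ℕ → ℕ
  imem : ℕ → ℕ → ℕ
  creg : ℕ → ℂ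
  cmem : ℕ → ℕ → ℂ

/-- Instructions. Names of registers and arrays are fixed numbers of the program; the position in
an array is the content of a register. -/
inductive Instr : Type
  | iconst (x n : ℕ)
  | iadd (x y z : ℕ)
  | isub (x y z : ℕ)
  | iload (x a y : ℕ)
  | istore (a y x : ℕ)
  | cconst (x : ℕ) (n : ℤ)
  | cadd (x y z : ℕ)
  | csub (x y z : ℕ)
  | cmul (x y z : ℕ)
  | cload (x a y : ℕ)
  | cstore (a y x : ℕ)

def Instr.run (s : State) : Instr → State
  | .iconst x n => { s with ireg := Function.update s.ireg x n }
  | .iadd x y z => { s with ireg := Function.update s.ireg x (s.ireg y + s.ireg z) }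
  | .isub x y z => { s with ireg := Function.update s.ireg x (s.ireg y - s.ireg z) }
  | .iload x a y => { s with ireg := Function.update s.ireg x (s.imem a (s.ireg y)) }
  | .istore a y x =>
      { s with imem :=
          Function.update s.imem a (Function.update (s.imem a) (s.ireg y) (s.ireg x)) }
  | .cconst x n => { s with creg := Function.update s.creg x (n : ℂ) }
  | .cadd x y z => { s with creg := Function.update s.creg x (s.creg y + s.creg z) }
  | .csub x y z => { s with creg := Function.update s.creg x (s.creg y - s.creg z) }
  | .cmul x y z => { s with creg := Function.update s.creg x (s.creg y * s.creg z) }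
  | .cload x a y => { s with creg := Function.update s.creg x (s.cmem a (s.ireg y)) }
  | .cstore a y x =>
      { s with cmem :=
          Function.update s.cmem a (Function.update (s.cmem a) (s.ireg y) (s.creg x)) }

/-- Programs. The tests compare two registers of natural numbers. -/
inductive Program : Type
  | instr (i : Instr)
  | seq (P Q : Program)
  | ifLt (x y : ℕ) (P Q : Program)
  | whileLt (x y : ℕ) (P : Program)

/-- `Runs P s n s'`: started in the state `s`, the program `P` halts after exactly `n` steps, in
the state `s'`. -/
inductive Runs : Program → State → ℕ → State → Prop
  | instr (i : Instr) (s : State) : Runs (.instr i) s 1 (i.run s)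
  | seq {P Q : Program} {s s' s'' : State} {n n' : ℕ} :
      Runs P s n s' → Runs Q s' n' s'' → Runs (.seq P Q) s (n + n') s''
  | if_true {x y : ℕ} {P Q : Program} {s s' : State} {n : ℕ} :
      s.ireg x < s.ireg y → Runs P s n s' → Runs (.ifLt x y P Q) s (n + 1) s'
  | if_false {x y : ℕ} {P Q : Program} {s s' : State} {n : ℕ} :
      ¬ s.ireg x < s.ireg y → Runs Q s n s' → Runs (.ifLt x y P Q) s (n + 1) s'
  | while_true {x y : ℕ} {P : Program} {s s' s'' : State} {n n' : ℕ} :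
      s.ireg x < s.ireg y → Runs P s n s' → Runs (.whileLt x y P) s' n' s'' →
      Runs (.whileLt x y P) s (n + n' + 1) s''
  | while_false {x y : ℕ} {P : Program} {s : State} :
      ¬ s.ireg x < s.ireg y → Runs (.whileLt x y P) s 1 s

/-- The position of a word in a table indexed by words: the letters are its digits in base
`2m + 1`, the first letter being the least significant digit. -/
def wordCode {m n : ℕ} (w : Fin n → Letter m) : ℕ :=
  ∑ k, (w k).code * (2 * m + 1) ^ (k : ℕ)

/-- `s` is the initial state that holds the input: the numbers `m`, `t`, `d`; the table `M` of
moments of the input state (array `0`); the table `h` of coefficients of the polynomial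
(array `1`); the matrices and displacement vectors of the `t + 1` gates (arrays `2`, `3`, `4`); the
`t` cubicities (array `5`). All the registers and arrays that do not hold input are zero. -/
structure IsInput {m t d : ℕ} (g : Fin (t + 1) → DispOrth m) (γ : Fin t → ℝ)
    (M : (Fin (2 * d) → Letter m) → ℂ) (h : (Fin d → Letter m) → ℂ) (s : State) : Prop where
  modes : s.ireg 0 = m
  layers : s.ireg 1 = t
  degree : s.ireg 2 = d
  moments : ∀ w, s.cmem 0 (wordCode w) = M w
  coeffs : ∀ w, s.cmem 1 (wordCode w) = h w
  matrices : ∀ (k : Fin (t + 1)) (i j : Fin m),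
    s.cmem 2 ((k * m + i) * m + j) = ((g k).entry i j : ℂ)
  dispPos : ∀ (k : Fin (t + 1)) (i : Fin m), s.cmem 3 (k * m + i) = ((g k).u i : ℂ)
  dispMom : ∀ (k : Fin (t + 1)) (i : Fin m), s.cmem 4 (k * m + i) = ((g k).v i : ℂ)
  cubicities : ∀ k : Fin t, s.cmem 5 k = (γ k : ℂ)
  ireg_zero : ∀ x, 3 ≤ x → s.ireg x = 0
  imem_zero : ∀ a n, s.imem a n = 0
  creg_zero : ∀ x, s.creg x = 0
  cmem_zero : ∀ a n, 6 ≤ a → s.cmem a n = 0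

end CV

end

/-! The proof works in the Heisenberg picture. A displaced orthogonal gate sends positions to affine
combinations of positions and momenta to affine combinations of momenta. The cubic gate fixes every
quadrature except `p̂_1`, which becomes `p̂_1 + 6γ q̂_1²`. Positions never pick up momenta, so they
stay affine through any number of layers; momenta only accumulate squares of affine forms in the
positions, so their degree stays at most 2. With the identity as a letter, each evolved letter is a
combination `∑ b c, S a b c • b c` of words of length two. A polynomial of degree `d` thus becomes
one of degree at most `2d`, and the moments of order `2d` suffice for every `t`.

The operators are unbounded, so this is proved on vectors, through graphs. If all words of length
`2|w|` are defined at `f`, then `w` is defined at `U f`, with value `U` applied to the substituted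
combination of words at `f` (`letterGraph_circuit`, `wordGraph_circuit`). On the range of `ρ` this
produces one operator `T`, a combination of the operators `W ρ`, whose trace is the same combination
of moments. The Heisenberg expectation value is the trace of `T`, the Schrödinger one that of `U T
U†`; they agree because unitaries map orthonormal bases to orthonormal bases
(`exists_output_operator`, `HasTrace.conj`).

For the running time put `B = 2m + 1`. The table `S` has `B³` entries, and a layer updates it by a
`B × (B + 1)` matrix in `O(B⁴)` steps. The table of moments has `B^(2d)` entries. Instead of
expanding whole words, one letter of the polynomial is treated at a time: a pair of letters is
contracted with `S` to a single letter, in `O(B^(2d+1))` steps. After `d` contractions the `B^d`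
moments of the output remain, to be paired with the coefficients of the polynomial. For `d ≥ 1` one
has `2d + 1 ≤ 3d`, so the total is `O(B^(3d) + t B⁴)`, within the claimed bound. Updates,
contractions and the final pairing are all instances of one strided matrix product
(`exec_gemmProg`). -/

noncomputable section

namespace CV

variable {m : ℕ}

/-! ### Linear relations -/

/-- A relation between two complex vector spaces whose graph is a subspace. -/
structure IsLinearRel {E F : Type*} [AddCommGroup E] [Module ℂ E] [AddCommGroup F] [Module ℂ F]
    (A : E → F → Prop) : Prop where
  zero : A 0 0
  add : ∀ {f g f' g'}, A f g → A f' g' → A (f + f') (g + g')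
  smul : ∀ (c : ℂ) {f g}, A f g → A (c • f) (c • g)

theorem IsLinearRel.sum {E F : Type*} [AddCommGroup E] [Module ℂ E] [AddCommGroup F] [Module ℂ F]
    {A : E → F → Prop} (hA : IsLinearRel A) {ι : Type*} (s : Finset ι) {f : ι → E} {g : ι → F}
    (h : ∀ i ∈ s, A (f i) (g i)) : A (∑ i ∈ s, f i) (∑ i ∈ s, g i) := by
  classical
  induction s using Finset.induction_on with
  | empty => simpa using hA.zero
  | insert i s hi ih =>
    rw [Finset.sum_insert hi, Finset.sum_insert hi]
    exact hA.add (h i (Finset.mem_insert_self i s))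
      (ih fun j hj => h j (Finset.mem_insert_of_mem hj))

theorem isLinearRel_posGraph (j : Fin m) : IsLinearRel (posGraph j) where
  zero := by
    filter_upwards with x
    simp
  add {f g f' g'} h h' := by
    filter_upwards [h, h', Lp.coeFn_add f f', Lp.coeFn_add g g'] with x h1 h2 h3 h4
    rw [h3, h4, Pi.add_apply, Pi.add_apply, h1, h2, mul_add]
  smul c {f g} h := by
    filter_upwards [h, Lp.coeFn_smul c f, Lp.coeFn_smul c g] with x h1 h2 h3
    rw [h2, h3, Pi.smul_apply, Pi.smul_apply, h1, smul_eq_mul, smul_eq_mul]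
    ring

theorem integrable_mul_coeFn {φ : Conf m → ℂ} (hφ : Continuous φ) (hc : HasCompactSupport φ)
    (f : Hilb m) : Integrable (fun x => φ x * f x) :=
  (hφ.memLp_of_hasCompactSupport (p := 2) hc).integrable_mul (Lp.memLp f)

theorem continuous_fderiv_apply_of_smooth {φ : Conf m → ℂ} (hφ : ContDiff ℝ ∞ φ) (e : Conf m) :
    Continuous fun x => fderiv ℝ φ x e :=
  (hφ.continuous_fderiv (by simp)).clm_apply continuous_const

theorem integrable_fderiv_mul_coeFn {φ : Conf m → ℂ} (hφ : ContDiff ℝ ∞ φ)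
    (hc : HasCompactSupport φ) (e : Conf m) (f : Hilb m) :
    Integrable (fun x => fderiv ℝ φ x e * f x) :=
  integrable_mul_coeFn (continuous_fderiv_apply_of_smooth hφ e) (hc.fderiv_apply ℝ e) f

theorem isLinearRel_momGraph (j : Fin m) : IsLinearRel (momGraph j) where
  zero := by
    intro φ _ _
    simp
  add {f g f' g'} h h' := by
    intro φ hφ hc
    have e1 : ∫ x, φ x * (g + g' : Hilb m) x = ∫ x, (φ x * g x + φ x * g' x) :=
      integral_congr_ae <| by
        filter_upwards [Lp.coeFn_add g g'] with x hx
        rw [hx, Pi.add_apply, mul_add]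
    have e2 : ∫ x, fderiv ℝ φ x (EuclideanSpace.single j (1 : ℝ)) * (f + f' : Hilb m) x =
        ∫ x, (fderiv ℝ φ x (EuclideanSpace.single j (1 : ℝ)) * f x +
          fderiv ℝ φ x (EuclideanSpace.single j (1 : ℝ)) * f' x) :=
      integral_congr_ae <| by
        filter_upwards [Lp.coeFn_add f f'] with x hx
        rw [hx, Pi.add_apply, mul_add]
    rw [e1, e2, integral_add (integrable_mul_coeFn hφ.continuous hc g)
      (integrable_mul_coeFn hφ.continuous hc g'),
      integral_add (integrable_fderiv_mul_coeFn hφ hc _ f)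
      (integrable_fderiv_mul_coeFn hφ hc _ f'), h φ hφ hc, h' φ hφ hc, mul_add]
  smul c {f g} h := by
    intro φ hφ hc
    have e1 : ∫ x, φ x * (c • g : Hilb m) x = ∫ x, c * (φ x * g x) :=
      integral_congr_ae <| by
        filter_upwards [Lp.coeFn_smul c g] with x hx
        rw [hx, Pi.smul_apply, smul_eq_mul]; ring
    have e2 : ∫ x, fderiv ℝ φ x (EuclideanSpace.single j (1 : ℝ)) * (c • f : Hilb m) x =
        ∫ x, c * (fderiv ℝ φ x (EuclideanSpace.single j (1 : ℝ)) * f x) :=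
      integral_congr_ae <| by
        filter_upwards [Lp.coeFn_smul c f] with x hx
        rw [hx, Pi.smul_apply, smul_eq_mul]; ring
    rw [e1, e2, integral_const_mul, integral_const_mul, h φ hφ hc]
    ring

theorem isLinearRel_letterGraph (a : Letter m) : IsLinearRel (letterGraph a) := by
  cases a with
  | one =>
    exact ⟨rfl, fun h h' => by simp only [letterGraph] at *; rw [h, h'],
      fun c _ _ h => by simp only [letterGraph] at *; rw [h]⟩
  | pos j => exact isLinearRel_posGraph j
  | mom j => exact isLinearRel_momGraph j

theorem isLinearRel_wordGraph (w : List (Letter m)) : IsLinearRel (wordGraph w) := by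
  induction w with
  | nil =>
    exact ⟨rfl, fun h h' => by simp only [wordGraph] at *; rw [h, h'],
      fun c _ _ h => by simp only [wordGraph] at *; rw [h]⟩
  | cons a w ih =>
    have ha := isLinearRel_letterGraph a
    refine ⟨⟨0, ih.zero, ha.zero⟩, ?_, ?_⟩
    · rintro f g f' g' ⟨k, h1, h2⟩ ⟨k', h1', h2'⟩
      exact ⟨k + k', ih.add h1 h1', ha.add h2 h2'⟩
    · rintro c f g ⟨k, h1, h2⟩
      exact ⟨c • k, ih.smul c h1, ha.smul c h2⟩

/-! ### Quadratures are single-valued -/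

theorem posGraph_unique {j : Fin m} {f g g' : Hilb m} (h : posGraph j f g)
    (h' : posGraph j f g') : g = g' := by
  apply Lp.ext
  filter_upwards [h, h'] with x h1 h2
  rw [h1, h2]

/-- Fundamental lemma of the calculus of variations: `g - g'` is locally integrable and integrates
to zero against every test function. -/
theorem momGraph_unique {j : Fin m} {f g g' : Hilb m} (h : momGraph j f g)
    (h' : momGraph j f g') : g = g' := by
  rw [← sub_eq_zero]
  apply Lp.ext
  have hloc : LocallyIntegrable (g - g' : Hilb m) (volume : Measure (Conf m)) :=
    (Lp.memLp (g - g')).locallyIntegrable (by norm_num)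
  have key := ae_eq_zero_of_integral_contDiff_smul_eq_zero hloc (fun φ hφ hc => by
    have hφ' : ContDiff ℝ ∞ (fun x => (φ x : ℂ)) := Complex.ofRealCLM.contDiff.comp hφ
    have hc' : HasCompactSupport (fun x => (φ x : ℂ)) := hc.comp_left Complex.ofReal_zero
    have e : ∫ x, φ x • (g - g' : Hilb m) x = ∫ x, ((φ x : ℂ) * g x - (φ x : ℂ) * g' x) :=
      integral_congr_ae <| by
        filter_upwards [Lp.coeFn_sub g g'] with x hx
        rw [hx, Pi.sub_apply, Complex.real_smul, mul_sub]
    rw [e, integral_sub (integrable_mul_coeFn hφ'.continuous hc' g)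
      (integrable_mul_coeFn hφ'.continuous hc' g'), h _ hφ' hc', h' _ hφ' hc', sub_self])
  filter_upwards [key, Lp.coeFn_zero ℂ 2 (volume : Measure (Conf m))] with x h1 h2
  rw [h1, h2, Pi.zero_apply]

theorem letterGraph_unique {a : Letter m} {f g g' : Hilb m} (h : letterGraph a f g)
    (h' : letterGraph a f g') : g = g' := by
  cases a with
  | one => exact Eq.trans h (Eq.symm h')
  | pos j => exact posGraph_unique h h'
  | mom j => exact momGraph_unique h h'

theorem wordGraph_unique {w : List (Letter m)} {f g g' : Hilb m} (h : wordGraph w f g)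
    (h' : wordGraph w f g') : g = g' := by
  induction w generalizing g g' with
  | nil => exact Eq.trans h (Eq.symm h')
  | cons a w ih =>
    obtain ⟨k, h1, h2⟩ := h
    obtain ⟨k', h1', h2'⟩ := h'
    obtain rfl := ih h1 h1'
    exact letterGraph_unique h2 h2'

/-! ### Phases -/

theorem phaseOp_ae (θ : C(Conf m, ℝ)) (f : Hilb m) :
    ∀ᵐ x, phaseOp θ f x = Complex.exp (θ x * Complex.I) * f x := by
  have hm : MemLp (fun x : Conf m => Complex.exp (θ x * Complex.I)) ⊤ volume :=
    memLp_top_of_bound (by fun_prop) 1 (.of_forall fun x => (Complex.norm_exp_ofReal_mul_I _).le)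
  have h1 := (ContinuousLinearMap.mul ℂ ℂ).coeFn_holder (r := 2) (hm.toLp _) f
  filter_upwards [h1, hm.coeFn_toLp] with x h1 h2
  have : phaseOp θ f x = ((ContinuousLinearMap.mul ℂ ℂ).holder 2 (hm.toLp _) f : Hilb m) x := rfl
  rw [this, h1, h2]
  rfl

theorem posGraph_phaseOp {θ : C(Conf m, ℝ)} {j : Fin m} {f g : Hilb m} (h : posGraph j f g) :
    posGraph j (phaseOp θ f) (phaseOp θ g) := by
  filter_upwards [h, phaseOp_ae θ f, phaseOp_ae θ g] with x h1 h2 h3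
  rw [h2, h3, h1]; ring

/-- The phase is moved onto the test function: `φ e^{iθ}` is again smooth with compact support, and
the product rule produces the additional term `2 (∂_j θ) f`, which has to be represented by a vector
`k` of the Hilbert space. -/
theorem momGraph_phaseOp {θ : C(Conf m, ℝ)} (hθ : ContDiff ℝ ∞ θ) {j : Fin m} {f g k : Hilb m}
    (h : momGraph j f g)
    (hk : ∀ᵐ x, k x = (2 * fderiv ℝ θ x (EuclideanSpace.single j (1 : ℝ)) : ℝ) * f x) :
    momGraph j (phaseOp θ f) (phaseOp θ (g + k)) := by
  intro φ hφ hc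
  set e : Conf m := EuclideanSpace.single j (1 : ℝ)
  have hE : ContDiff ℝ ∞ (fun x : Conf m => Complex.exp (θ x * Complex.I)) :=
    ((Complex.ofRealCLM.contDiff.comp hθ).mul contDiff_const).cexp
  have hψ := hφ.mul hE
  have hcψ : HasCompactSupport (fun x => φ x * Complex.exp (θ x * Complex.I)) := hc.mul_right
  have hder : ∀ x, fderiv ℝ (fun x => φ x * Complex.exp (θ x * Complex.I)) x e =
      fderiv ℝ φ x e * Complex.exp (θ x * Complex.I) +
      φ x * (Complex.exp (θ x * Complex.I) * (fderiv ℝ θ x e * Complex.I)) := by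
    intro x
    have hθx : HasFDerivAt θ (fderiv ℝ θ x) x :=
      (hθ.differentiable (by simp) x).hasFDerivAt
    have h1 : HasFDerivAt (fun x => (θ x : ℂ)) (Complex.ofRealCLM.comp (fderiv ℝ θ x)) x :=
      Complex.ofRealCLM.hasFDerivAt.comp x hθx
    have h2 := (h1.mul_const Complex.I).cexp
    have h3 := ((hφ.differentiable (by simp) x).hasFDerivAt).mul h2
    have h4 := h3.fderiv
    simp only [Pi.mul_def] at h4
    rw [h4]
    simp
    ring
  have h0 := h _ hψ hcψ
  have i1 := integrable_mul_coeFn hψ.continuous hcψ g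
  have i2 := integrable_mul_coeFn hψ.continuous hcψ k
  have i3 := integrable_fderiv_mul_coeFn hφ hc e (phaseOp θ f)
  have e1 : ∫ x, φ x * phaseOp θ (g + k) x =
      ∫ x, (φ x * Complex.exp (θ x * Complex.I) * g x +
        φ x * Complex.exp (θ x * Complex.I) * k x) :=
    integral_congr_ae <| by
      filter_upwards [phaseOp_ae θ (g + k), Lp.coeFn_add g k] with x h1 h2
      rw [h1, h2, Pi.add_apply]; ring
  -- The factor `I / 2` is the `I` from differentiating the phase, divided by the 2 contained in
  -- `k`; times the `2i` of the momentum it becomes `-1`.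
  have e2 : ∫ x, fderiv ℝ (fun x => φ x * Complex.exp (θ x * Complex.I)) x e * f x =
      ∫ x, (fderiv ℝ φ x e * phaseOp θ f x +
        Complex.I / 2 * (φ x * Complex.exp (θ x * Complex.I) * k x)) :=
    integral_congr_ae <| by
      filter_upwards [phaseOp_ae θ f, hk] with x h1 h2
      rw [hder, h1, h2]; push_cast; ring
  have e3 : ∫ x, (φ x * Complex.exp (θ x * Complex.I)) * g x =
    2 * Complex.I * ∫ x, fderiv ℝ (fun x => φ x * Complex.exp (θ x * Complex.I)) x e * f x := h0
  rw [e1, integral_add i1 i2, e3, e2, integral_add i3 (i2.const_mul _), integral_const_mul]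
  linear_combination (∫ x, φ x * Complex.exp (θ x * Complex.I) * k x) * Complex.I_mul_I

/-! ### Translations and orthogonal transformations -/

/-- Translation by `u`, that is, `(Tψ)(x) = ψ(x - u)`. -/
def translation (u : Conf m) : Hilb m →L[ℂ] Hilb m :=
  (Lp.compMeasurePreservingₗᵢ ℂ (fun x : Conf m => x - u)
    (measurePreserving_sub_right volume u)).toContinuousLinearMap

theorem translation_ae (u : Conf m) (f : Hilb m) : ∀ᵐ x, translation u f x = f (x - u) :=
  Lp.coeFn_compMeasurePreserving f (measurePreserving_sub_right volume u)

theorem orthogonalGate_ae (R : Conf m ≃ₗᵢ[ℝ] Conf m) (f : Hilb m) :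
    ∀ᵐ x, orthogonalGate R f x = f (R.symm x) :=
  Lp.coeFn_compMeasurePreserving f R.symm.measurePreserving

theorem posGraph_translation {u : Conf m} {i : Fin m} {f g : Hilb m} (h : posGraph i f g) :
    posGraph i (translation u f) (translation u (g + (u i : ℂ) • f)) := by
  have q := (measurePreserving_sub_right (volume : Measure (Conf m)) u).quasiMeasurePreserving
  filter_upwards [translation_ae u f, translation_ae u (g + (u i : ℂ) • f), q.ae h,
    q.ae (Lp.coeFn_add g ((u i : ℂ) • f)), q.ae (Lp.coeFn_smul (u i : ℂ) f)] with x h1 h2 h3 h4 h5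
  rw [h1, h2, h4, Pi.add_apply, h5, Pi.smul_apply, h3]
  simp
  ring

theorem momGraph_translation {u : Conf m} {i : Fin m} {f g : Hilb m} (h : momGraph i f g) :
    momGraph i (translation u f) (translation u g) := by
  intro φ hφ hc
  have mp := measurePreserving_sub_right (volume : Measure (Conf m)) u
  have hψ : ContDiff ℝ ∞ (fun x => φ (x + u)) := hφ.comp (contDiff_id.add contDiff_const)
  have hcψ : HasCompactSupport (fun x => φ (x + u)) :=
    hc.comp_homeomorph (Homeomorph.addRight u)
  have h0 := h _ hψ hcψ
  have me : MeasurableEmbedding (fun x : Conf m => x - u) :=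
    (Homeomorph.subRight u).measurableEmbedding
  rw [← mp.integral_comp me (fun x => φ (x + u) * g x),
    ← mp.integral_comp me (fun x => fderiv ℝ (fun x => φ (x + u)) x _ * f x)] at h0
  have e1 : ∫ x, φ x * translation u g x = ∫ x, φ (x - u + u) * g (x - u) :=
    integral_congr_ae <| by
      filter_upwards [translation_ae u g] with x h1
      rw [h1, sub_add_cancel]
  have e2 : ∫ x, fderiv ℝ φ x (EuclideanSpace.single i (1 : ℝ)) * translation u f x =
      ∫ x, fderiv ℝ (fun x => φ (x + u)) (x - u) (EuclideanSpace.single i (1 : ℝ)) * f (x - u) :=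
    integral_congr_ae <| by
      filter_upwards [translation_ae u f] with x h1
      rw [h1, fderiv_comp_add_right, sub_add_cancel]
  rw [e1, e2, h0]

theorem apply_eq_sum_entry (R : Conf m ≃ₗᵢ[ℝ] Conf m) (y : Conf m) (i : Fin m) :
    R y i = ∑ j, R (EuclideanSpace.single j (1 : ℝ)) i * y j := by
  have : y = ∑ j, y j • EuclideanSpace.single j (1 : ℝ) := by
    ext k
    simp [Finset.sum_apply, Pi.single_apply]
  conv_lhs => rw [this]
  simp [map_sum, mul_comm]

/-- The inverse of an orthogonal matrix is its transpose. This is why momenta, whose directional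
derivatives are pulled back along `R⁻¹`, transform with the same matrix as positions. -/
theorem symm_single_apply (R : Conf m ≃ₗᵢ[ℝ] Conf m) (i j : Fin m) :
    R.symm (EuclideanSpace.single i (1 : ℝ)) j = R (EuclideanSpace.single j (1 : ℝ)) i := by
  have h := R.inner_map_map (R.symm (EuclideanSpace.single i (1 : ℝ)))
    (EuclideanSpace.single j (1 : ℝ))
  rw [R.apply_symm_apply] at h
  simpa [EuclideanSpace.inner_single_left, EuclideanSpace.inner_single_right] using h.symm

theorem sum_coeFn_ae {ι : Type*} (s : Finset ι) (f : ι → Hilb m) :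
    ∀ᵐ x, (∑ i ∈ s, f i : Hilb m) x = ∑ i ∈ s, f i x := by
  filter_upwards [Lp.coeFn_finsetSum s f] with x hx
  rw [hx, Finset.sum_apply]

theorem posGraph_orthogonalGate {R : Conf m ≃ₗᵢ[ℝ] Conf m} {i : Fin m} {f : Hilb m}
    {g : Fin m → Hilb m} (h : ∀ j, posGraph j f (g j)) :
    posGraph i (orthogonalGate R f)
      (orthogonalGate R (∑ j, (R (EuclideanSpace.single j (1 : ℝ)) i : ℂ) • g j)) := by
  have q := R.symm.measurePreserving.quasiMeasurePreserving
  have h' : ∀ᵐ x, ∀ j, g j x = (x j : ℂ) * f x := ae_all_iff.2 h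
  have hs : ∀ᵐ x, ∀ j, ((R (EuclideanSpace.single j (1 : ℝ)) i : ℂ) • g j : Hilb m) x =
      (R (EuclideanSpace.single j (1 : ℝ)) i : ℂ) * g j x := ae_all_iff.2 fun j => by
    filter_upwards [Lp.coeFn_smul (R (EuclideanSpace.single j (1 : ℝ)) i : ℂ) (g j)] with x hx
    rw [hx, Pi.smul_apply, smul_eq_mul]
  filter_upwards [orthogonalGate_ae R f, orthogonalGate_ae R _, q.ae h',
    q.ae (sum_coeFn_ae Finset.univ fun j => (R (EuclideanSpace.single j (1 : ℝ)) i : ℂ) • g j),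
    q.ae hs] with x h1 h2 h3 h4 h5
  rw [h2, h4, h1]
  have hx := apply_eq_sum_entry R (R.symm x) i
  rw [R.apply_symm_apply] at hx
  rw [hx, Complex.ofReal_sum, Finset.sum_mul]
  refine Finset.sum_congr rfl fun j _ => ?_
  rw [h5, h3]
  push_cast
  ring

theorem momGraph_orthogonalGate {R : Conf m ≃ₗᵢ[ℝ] Conf m} {i : Fin m} {f : Hilb m}
    {g : Fin m → Hilb m} (h : ∀ j, momGraph j f (g j)) :
    momGraph i (orthogonalGate R f)
      (orthogonalGate R (∑ j, (R (EuclideanSpace.single j (1 : ℝ)) i : ℂ) • g j)) := by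
  intro φ hφ hc
  have mp := R.symm.measurePreserving
  have me : MeasurableEmbedding R.symm := R.symm.toHomeomorph.measurableEmbedding
  have hψ : ContDiff ℝ ∞ (fun x => φ (R x)) := hφ.comp R.contDiff
  have hcψ : HasCompactSupport (fun x => φ (R x)) := hc.comp_homeomorph R.toHomeomorph
  set G : Hilb m := ∑ j, (R (EuclideanSpace.single j (1 : ℝ)) i : ℂ) • g j
  have e1 : ∫ x, φ x * orthogonalGate R G x = ∫ x, φ (R x) * G x := by
    rw [← mp.integral_comp me (fun x => φ (R x) * G x)]
    refine integral_congr_ae ?_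
    filter_upwards [orthogonalGate_ae R G] with x h1
    rw [h1, R.apply_symm_apply]
  -- Chain rule: differentiating `φ` along `e_i` amounts to differentiating `φ ∘ R` along `R⁻¹ e_i`,
  -- which `e3` expands in the coordinate directions.
  have e2 : ∫ x, fderiv ℝ φ x (EuclideanSpace.single i (1 : ℝ)) * orthogonalGate R f x =
      ∫ x, fderiv ℝ (fun x => φ (R x)) x (R.symm (EuclideanSpace.single i (1 : ℝ))) * f x := by
    rw [← mp.integral_comp me
      (fun x => fderiv ℝ (fun x => φ (R x)) x (R.symm (EuclideanSpace.single i (1 : ℝ))) * f x)]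
    refine integral_congr_ae ?_
    filter_upwards [orthogonalGate_ae R f] with x h1
    have hd : fderiv ℝ (fun x => φ (R x)) (R.symm x) =
        (fderiv ℝ φ x).comp (R.toContinuousLinearEquiv : Conf m →L[ℝ] Conf m) := by
      have := ((hφ.differentiable (by simp) (R (R.symm x))).hasFDerivAt).comp (R.symm x)
        R.toContinuousLinearEquiv.hasFDerivAt
      rw [R.apply_symm_apply] at this
      exact this.fderiv
    rw [h1, hd]
    simp
  have e3 : ∀ x, fderiv ℝ (fun x => φ (R x)) x (R.symm (EuclideanSpace.single i (1 : ℝ))) =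
      ∑ j, (R (EuclideanSpace.single j (1 : ℝ)) i : ℂ) *
        fderiv ℝ (fun x => φ (R x)) x (EuclideanSpace.single j (1 : ℝ)) := by
    intro x
    have : R.symm (EuclideanSpace.single i (1 : ℝ)) =
        ∑ j, R (EuclideanSpace.single j (1 : ℝ)) i • EuclideanSpace.single j (1 : ℝ) := by
      ext k
      simp [Finset.sum_apply, Pi.single_apply, symm_single_apply]
    rw [this, map_sum]
    simp
  have e4 : ∫ x, φ (R x) * G x =
      ∫ x, ∑ j, (R (EuclideanSpace.single j (1 : ℝ)) i : ℂ) * (φ (R x) * g j x) := by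
    have hs : ∀ᵐ x, ∀ j, ((R (EuclideanSpace.single j (1 : ℝ)) i : ℂ) • g j : Hilb m) x =
        (R (EuclideanSpace.single j (1 : ℝ)) i : ℂ) * g j x := ae_all_iff.2 fun j => by
      filter_upwards [Lp.coeFn_smul (R (EuclideanSpace.single j (1 : ℝ)) i : ℂ) (g j)] with x hx
      rw [hx, Pi.smul_apply, smul_eq_mul]
    refine integral_congr_ae ?_
    filter_upwards [hs,
      sum_coeFn_ae Finset.univ fun j => (R (EuclideanSpace.single j (1 : ℝ)) i : ℂ) • g j]
      with x h1 h2
    rw [h2, Finset.mul_sum]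
    refine Finset.sum_congr rfl fun j _ => ?_
    rw [h1]; ring
  rw [e1, e4, e2, integral_finsetSum _
    fun j _ => (integrable_mul_coeFn hψ.continuous hcψ (g j)).const_mul _]
  simp_rw [e3, Finset.sum_mul, mul_assoc]
  rw [integral_finsetSum _
    fun j _ => (integrable_fderiv_mul_coeFn hψ hcψ _ f).const_mul _, Finset.mul_sum, Finset.mul_sum]
  refine Finset.sum_congr rfl fun j _ => ?_
  rw [integral_const_mul, integral_const_mul, h j _ hψ hcψ]
  ring

/-! ### Sums over letters -/

/-- The letters are the identity, the positions and the momenta. -/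
def Letter.equivSum : Letter m ≃ Unit ⊕ Fin m ⊕ Fin m where
  toFun
    | .one => .inl ()
    | .pos j => .inr (.inl j)
    | .mom j => .inr (.inr j)
  invFun
    | .inl _ => .one
    | .inr (.inl j) => .pos j
    | .inr (.inr j) => .mom j
  left_inv a := by cases a <;> rfl
  right_inv a := by rcases a with _ | _ | _ <;> rfl

theorem Letter.sum_eq {E : Type*} [AddCommMonoid E] (F : Letter m → E) :
    ∑ a, F a = F .one + (∑ j, F (.pos j) + ∑ j, F (.mom j)) := by
  rw [← Letter.equivSum.symm.sum_comp]
  simp [Letter.equivSum]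

/-! ### Displaced orthogonal gates -/

/-- The Heisenberg action of a displaced orthogonal gate on the letters. -/
def affine (g : DispOrth m) : Letter m → Letter m → ℂ
  | .one, .one => 1
  | .pos i, .one => g.u i
  | .pos i, .pos j => g.entry i j
  | .mom i, .one => g.v i
  | .mom i, .mom j => g.entry i j
  | _, _ => 0

theorem gate_apply (g : DispOrth m) (f : Hilb m) :
    g.gate f = Complex.exp (g.phase * Complex.I) •
      phaseOp ⟨fun x => ⟪g.v, x⟫_ℝ / 2 - ⟪g.u, g.v⟫_ℝ / 4, by fun_prop⟩
        (translation g.u (orthogonalGate g.R f)) := rfl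

theorem posGraph_gate (g : DispOrth m) {i : Fin m} {f : Hilb m} {K : Fin m → Hilb m}
    (h : ∀ j, posGraph j f (K j)) :
    posGraph i (g.gate f) (g.gate (∑ j, (g.entry i j : ℂ) • K j + (g.u i : ℂ) • f)) := by
  rw [gate_apply, gate_apply, map_add (orthogonalGate g.R), map_smul (orthogonalGate g.R)]
  exact (isLinearRel_posGraph i).smul _
    (posGraph_phaseOp (posGraph_translation (posGraph_orthogonalGate h)))

theorem momGraph_gate (g : DispOrth m) {i : Fin m} {f : Hilb m} {K : Fin m → Hilb m}
    (h : ∀ j, momGraph j f (K j)) :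
    momGraph i (g.gate f) (g.gate (∑ j, (g.entry i j : ℂ) • K j + (g.v i : ℂ) • f)) := by
  rw [gate_apply, gate_apply, map_add (orthogonalGate g.R), map_add (translation g.u)]
  refine (isLinearRel_momGraph i).smul _
    (momGraph_phaseOp ?_ (momGraph_translation (momGraph_orthogonalGate h)) ?_)
  · exact ((contDiff_const.inner ℝ contDiff_id).div_const 2).sub contDiff_const
  · rw [map_smul (orthogonalGate g.R), map_smul (translation g.u)]
    filter_upwards [Lp.coeFn_smul (g.v i : ℂ) (translation g.u (orthogonalGate g.R f))] with x hx
    have hd : HasFDerivAt (fun x : Conf m => ⟪g.v, x⟫_ℝ / 2 - ⟪g.u, g.v⟫_ℝ / 4)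
        ((2 : ℝ)⁻¹ • innerSL ℝ g.v) x := by
      have := (((innerSL ℝ g.v).hasFDerivAt (x := x)).const_mul (2 : ℝ)⁻¹).sub_const
        (⟪g.u, g.v⟫_ℝ / 4)
      refine this.congr_of_eventuallyEq (.of_forall fun y => ?_)
      simp [div_eq_inv_mul]
    have e : fderiv ℝ (⟨fun x => ⟪g.v, x⟫_ℝ / 2 - ⟪g.u, g.v⟫_ℝ / 4, by fun_prop⟩ :
        C(Conf m, ℝ)) x = (2 : ℝ)⁻¹ • innerSL ℝ g.v := hd.fderiv
    rw [hx, e]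
    simp [EuclideanSpace.inner_single_right]

/-- Counting the identity among the letters makes the affine action linear: the displacements are
the column of `.one`. -/
theorem letterGraph_gate (g : DispOrth m) {f : Hilb m} {K : Letter m → Hilb m}
    (h : ∀ a, letterGraph a f (K a)) (a : Letter m) :
    letterGraph a (g.gate f) (g.gate (∑ b, affine g a b • K b)) := by
  have h1 : K .one = f := h .one
  cases a with
  | one =>
    simp [Letter.sum_eq, affine, letterGraph, h1]
  | pos i =>
    have e : ∑ b, affine g (.pos i) b • K b =
        ∑ j, (g.entry i j : ℂ) • K (.pos j) + (g.u i : ℂ) • f := by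
      rw [Letter.sum_eq, h1]
      simp only [affine, zero_smul, Finset.sum_const_zero, add_zero]
      exact add_comm _ _
    rw [e]
    exact posGraph_gate g fun j => h (.pos j)
  | mom i =>
    have e : ∑ b, affine g (.mom i) b • K b =
        ∑ j, (g.entry i j : ℂ) • K (.mom j) + (g.v i : ℂ) • f := by
      rw [Letter.sum_eq, h1]
      simp only [affine, zero_smul, Finset.sum_const_zero, zero_add]
      exact add_comm _ _
    rw [e]
    exact momGraph_gate g fun j => h (.mom j)

/-! ### Cubic phase gates -/

/-- The general phase formula with `θ = γ x_0³`: `2 ∂_j θ` is `6 γ x_0²` for `j = 0` and zero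
otherwise. -/
theorem momGraph_cubicGate [NeZero m] (γ : ℝ) {j : Fin m} {f g k : Hilb m} (h : momGraph j f g)
    (hk : ∀ᵐ x : Conf m, k x = (if j = 0 then 6 * γ * x 0 ^ 2 else 0 : ℝ) * f x) :
    momGraph j (cubicGate γ f) (cubicGate γ (g + k)) := by
  refine momGraph_phaseOp ?_ h ?_
  · change ContDiff ℝ ∞ fun x : Conf m => γ * x 0 ^ 3
    fun_prop
  · filter_upwards [hk] with x hx
    have hd : HasFDerivAt (fun x : Conf m => γ * x 0 ^ 3)
        (γ • ((3 * x 0 ^ 2) • (EuclideanSpace.proj 0 : Conf m →L[ℝ] ℝ))) x := by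
      have := (((EuclideanSpace.proj 0 : Conf m →L[ℝ] ℝ).hasFDerivAt (x := x)).pow 3).const_mul γ
      simpa using this
    have e : fderiv ℝ (⟨fun x => γ * x 0 ^ 3, by fun_prop⟩ : C(Conf m, ℝ)) x = _ := hd.fderiv
    rw [hx, e]
    congr 2
    by_cases hj : j = 0
    · subst hj
      simp
      ring
    · simp [hj, Ne.symm hj]

theorem momGraph_cubicGate_of_ne [NeZero m] (γ : ℝ) {j : Fin m} (hj : j ≠ 0) {f g : Hilb m}
    (h : momGraph j f g) : momGraph j (cubicGate γ f) (cubicGate γ g) := by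
  have := momGraph_cubicGate γ (k := 0) h (by
    filter_upwards [Lp.coeFn_zero ℂ 2 (volume : Measure (Conf m))] with x hx
    simp [hj])
  rwa [add_zero] at this

theorem momGraph_cubicGate_zero [NeZero m] (γ : ℝ) {f g k k' : Hilb m}
    (h : momGraph 0 f g) (h1 : posGraph 0 f k) (h2 : posGraph 0 k k') :
    momGraph 0 (cubicGate γ f) (cubicGate γ (g + (6 * γ : ℂ) • k')) :=
  momGraph_cubicGate γ h (by
    filter_upwards [h1, h2, Lp.coeFn_smul (6 * γ : ℂ) k'] with x e1 e2 e3
    rw [e3, Pi.smul_apply, e2, e1]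
    simp
    ring)

/-! ### Unitarity -/

/-- Norm-preserving surjective operators. -/
def IsUnitaryOp (U : Hilb m →L[ℂ] Hilb m) : Prop := (∀ f, ‖U f‖ = ‖f‖) ∧ Function.Surjective U

theorem IsUnitaryOp.comp {U V : Hilb m →L[ℂ] Hilb m} (hU : IsUnitaryOp U) (hV : IsUnitaryOp V) :
    IsUnitaryOp (U ∘L V) :=
  ⟨fun f => (hU.1 _).trans (hV.1 f), hU.2.comp hV.2⟩

theorem isUnitaryOp_phaseOp (θ : C(Conf m, ℝ)) : IsUnitaryOp (phaseOp θ) := by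
  constructor
  · intro f
    rw [Lp.norm_def, Lp.norm_def]
    congr 1
    refine eLpNorm_congr_norm_ae ?_
    filter_upwards [phaseOp_ae θ f] with x hx
    rw [hx, norm_mul, Complex.norm_exp_ofReal_mul_I, one_mul]
  · intro f
    refine ⟨phaseOp (-θ) f, ?_⟩
    apply Lp.ext
    filter_upwards [phaseOp_ae θ (phaseOp (-θ) f), phaseOp_ae (-θ) f] with x h1 h2
    rw [h1, h2, ← mul_assoc, ← Complex.exp_add]
    simp

theorem isUnitaryOp_translation (u : Conf m) : IsUnitaryOp (translation u) := by
  constructor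
  · intro f
    exact LinearIsometry.norm_map (Lp.compMeasurePreservingₗᵢ ℂ (fun x : Conf m => x - u)
      (measurePreserving_sub_right volume u)) f
  · intro f
    refine ⟨translation (-u) f, ?_⟩
    apply Lp.ext
    have q := (measurePreserving_sub_right (volume : Measure (Conf m)) u).quasiMeasurePreserving
    filter_upwards [translation_ae u (translation (-u) f), q.ae (translation_ae (-u) f)]
      with x h1 h2
    rw [h1, h2, sub_neg_eq_add, sub_add_cancel]

theorem isUnitaryOp_orthogonalGate (R : Conf m ≃ₗᵢ[ℝ] Conf m) :
    IsUnitaryOp (orthogonalGate R) := by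
  constructor
  · intro f
    exact LinearIsometry.norm_map
      (Lp.compMeasurePreservingₗᵢ ℂ R.symm R.symm.measurePreserving) f
  · intro f
    refine ⟨orthogonalGate R.symm f, ?_⟩
    apply Lp.ext
    have q := R.symm.measurePreserving.quasiMeasurePreserving
    filter_upwards [orthogonalGate_ae R (orthogonalGate R.symm f),
      q.ae (orthogonalGate_ae R.symm f)] with x h1 h2
    rw [h1, h2, R.symm_symm, R.apply_symm_apply]

theorem isUnitaryOp_gate (g : DispOrth m) : IsUnitaryOp g.gate := by
  have h := ((isUnitaryOp_phaseOp ⟨fun x => ⟪g.v, x⟫_ℝ / 2 - ⟪g.u, g.v⟫_ℝ / 4, by fun_prop⟩).comp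
    (isUnitaryOp_translation g.u)).comp (isUnitaryOp_orthogonalGate g.R)
  constructor
  · intro f
    rw [gate_apply, norm_smul, Complex.norm_exp_ofReal_mul_I, one_mul]
    exact h.1 f
  · intro f
    obtain ⟨k, hk⟩ := h.2 (Complex.exp (-(g.phase * Complex.I)) • f)
    refine ⟨k, ?_⟩
    rw [gate_apply]
    have hk' : phaseOp ⟨fun x => ⟪g.v, x⟫_ℝ / 2 - ⟪g.u, g.v⟫_ℝ / 4, by fun_prop⟩
        (translation g.u (orthogonalGate g.R k)) = _ := hk
    rw [hk', smul_smul, ← Complex.exp_add, add_neg_cancel, Complex.exp_zero, one_smul]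

theorem isUnitaryOp_circuit [NeZero m] :
    ∀ (t : ℕ) (g : Fin (t + 1) → DispOrth m) (γ : Fin t → ℝ), IsUnitaryOp (circuit t g γ)
  | 0, g, _ => isUnitaryOp_gate (g 0)
  | _ + 1, _, _ => (isUnitaryOp_gate _).comp
      ((isUnitaryOp_phaseOp _).comp (isUnitaryOp_circuit _ _ _))

/-- A unitary operator as an isometric equivalence. -/
def IsUnitaryOp.equiv {U : Hilb m →L[ℂ] Hilb m} (hU : IsUnitaryOp U) : Hilb m ≃ₗᵢ[ℂ] Hilb m :=
  LinearIsometryEquiv.ofSurjective ⟨U, hU.1⟩ hU.2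

theorem IsUnitaryOp.equiv_apply {U : Hilb m →L[ℂ] Hilb m} (hU : IsUnitaryOp U) (f : Hilb m) :
    hU.equiv f = U f := rfl

theorem IsUnitaryOp.adjoint_apply {U : Hilb m →L[ℂ] Hilb m} (hU : IsUnitaryOp U) (f : Hilb m) :
    ContinuousLinearMap.adjoint U f = hU.equiv.symm f := by
  refine ext_inner_left ℂ fun k => ?_
  rw [ContinuousLinearMap.adjoint_inner_right, ← hU.equiv_apply, ← hU.equiv.inner_map_map k,
    hU.equiv.apply_symm_apply]

theorem IsUnitaryOp.adjoint_apply_self {U : Hilb m →L[ℂ] Hilb m} (hU : IsUnitaryOp U)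
    (f : Hilb m) : ContinuousLinearMap.adjoint U (U f) = f := by
  rw [hU.adjoint_apply, ← hU.equiv_apply, hU.equiv.symm_apply_apply]

/-! ### Traces -/

theorem isLinearRel_hasTrace : IsLinearRel (HasTrace (m := m)) where
  zero ι b := by simp
  add h h' ι b := by simpa [inner_add_right] using (h ι b).add (h' ι b)
  smul c _ _ h ι b := by simpa [inner_smul_right] using (h ι b).mul_left c

/-- The diagonal sum of `U T U†` over a basis `b` is that of `T` over `U† b`, which is again a
Hilbert basis, and `HasTrace` covers all bases. -/
theorem HasTrace.conj {T U : Hilb m →L[ℂ] Hilb m} {τ : ℂ} (h : HasTrace T τ)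
    (hU : IsUnitaryOp U) : HasTrace (U ∘L T ∘L ContinuousLinearMap.adjoint U) τ := by
  classical
  intro ι b
  convert h ι (HilbertBasis.ofRepr (hU.equiv.trans b.repr)) using 2 with i
  have e : (HilbertBasis.ofRepr (hU.equiv.trans b.repr)) i =
      ContinuousLinearMap.adjoint U (b i) := by
    rw [hU.adjoint_apply, ← HilbertBasis.repr_symm_single, ← HilbertBasis.repr_symm_single]
    rfl
  rw [e, ContinuousLinearMap.adjoint_inner_left]
  rfl

/-! ### Heisenberg evolution of the quadratures -/

instance : DecidableEq (Letter m) := fun _ _ =>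
  decidable_of_iff _ Letter.code_injective.eq_iff

/-- The Heisenberg evolution of the letter `a` through a circuit is
`∑ b c, heisenberg t g γ a b c • b c`. -/
def heisenberg [NeZero m] : (t : ℕ) → (Fin (t + 1) → DispOrth m) → (Fin t → ℝ) →
    Letter m → Letter m → Letter m → ℂ
  | 0, g, _ => fun a b c => if c = .one then affine (g 0) a b else 0
  | t + 1, g, γ => fun a b c =>
      let S := heisenberg t (fun k => g k.castSucc) (fun k => γ k.castSucc)
      ∑ a', affine (g (Fin.last (t + 1))) a a' * S a' b c +
        affine (g (Fin.last (t + 1))) a (.mom 0) * (6 * γ (Fin.last t)) *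
          (S (.pos 0) b .one * S (.pos 0) c .one)

theorem affine_one (g : DispOrth m) (a : Letter m) :
    affine g .one a = if a = .one then 1 else 0 := by
  cases a <;> simp [affine]

theorem heisenberg_one [NeZero m] (t : ℕ) (g : Fin (t + 1) → DispOrth m) (γ : Fin t → ℝ)
    (b c : Letter m) :
    heisenberg t g γ .one b c = if c = .one then if b = .one then 1 else 0 else 0 := by
  induction t with
  | zero => simp [heisenberg, affine_one]
  | succ t ih => simp [heisenberg, affine_one, ih]

theorem wordGraph_singleton {a : Letter m} {f g : Hilb m} :
    wordGraph [a] f g ↔ letterGraph a f g := by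
  simp [wordGraph]

theorem posGraph_cubicGate [NeZero m] (γ : ℝ) {j : Fin m} {f g : Hilb m} (h : posGraph j f g) :
    posGraph j (cubicGate γ f) (cubicGate γ g) :=
  posGraph_phaseOp h

theorem circuit_succ_apply [NeZero m] {t : ℕ} (g : Fin (t + 2) → DispOrth m) (γ : Fin (t + 1) → ℝ)
    (f : Hilb m) :
    circuit (t + 1) g γ f = (g (Fin.last (t + 1))).gate (cubicGate (γ (Fin.last t))
      (circuit t (fun k => g k.castSucc) (fun k => γ k.castSucc) f)) := rfl

/-- The evolution of the positions only involves the letters. -/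
theorem posGraph_circuit [NeZero m] (t : ℕ) (g : Fin (t + 1) → DispOrth m) (γ : Fin t → ℝ)
    {f : Hilb m} {K : Letter m → Hilb m} (h : ∀ b, letterGraph b f (K b)) (i : Fin m) :
    posGraph i (circuit t g γ f)
      (circuit t g γ (∑ b, heisenberg t g γ (.pos i) b .one • K b)) := by
  induction t generalizing i with
  | zero =>
    simp only [heisenberg, if_true]
    exact letterGraph_gate (g 0) h (.pos i)
  | succ t ih =>
    have ih' := ih (fun k => g k.castSucc) (fun k => γ k.castSucc)
    set U := circuit t (fun k => g k.castSucc) (fun k => γ k.castSucc)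
    set S := heisenberg t (fun k => g k.castSucc) (fun k => γ k.castSucc) with hS
    have h1 : K .one = f := h .one
    have key := posGraph_gate (g (Fin.last (t + 1))) (i := i)
      fun j => posGraph_cubicGate (γ (Fin.last t)) (ih' j)
    simp_rw [← map_smul, ← map_sum, ← map_add] at key
    -- The quadratic term of `heisenberg` carries the coefficient of `p̂_1` in an evolved position,
    -- which is zero; the letter `.one` evolves to itself and leaves the displacement.
    have e : ∀ b, heisenberg (t + 1) g γ (.pos i) b .one =
        ∑ j, ((g (Fin.last (t + 1))).entry i j : ℂ) * S (.pos j) b .one +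
          if b = .one then ((g (Fin.last (t + 1))).u i : ℂ) else 0 := by
      intro b
      simp only [heisenberg, ← hS, Letter.sum_eq, affine]
      rw [hS, heisenberg_one]
      by_cases hb : b = .one <;> simp [hb, add_comm]
    rw [circuit_succ_apply, circuit_succ_apply]
    have e' : ∑ b, heisenberg (t + 1) g γ (.pos i) b .one • K b =
        ∑ j, ((g (Fin.last (t + 1))).entry i j : ℂ) • ∑ b, S (.pos j) b .one • K b +
          ((g (Fin.last (t + 1))).u i : ℂ) • f := by
      simp_rw [e, add_smul, Finset.sum_add_distrib, Finset.smul_sum, Finset.sum_smul, mul_smul]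
      congr 1
      · exact Finset.sum_comm
      · simp [h1]
    rw [e']
    exact key

/-- Induction on the layers. The only new contribution of a layer is `6γ q̂_1²`, and `q̂_1` has
evolved affinely, so `posGraph_circuit` applied twice expresses its square by words of length two.
Hence no longer words are ever needed in the domain. -/
theorem letterGraph_circuit [NeZero m] (t : ℕ) (g : Fin (t + 1) → DispOrth m) (γ : Fin t → ℝ)
    {f : Hilb m} {K : Letter m → Letter m → Hilb m} (h : ∀ b c, wordGraph [b, c] f (K b c))
    (a : Letter m) :
    letterGraph a (circuit t g γ f)
      (circuit t g γ (∑ b, ∑ c, heisenberg t g γ a b c • K b c)) := by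
  -- Words containing `.one` supply the first-order part: `K b c` is `b` applied to the vector `c
  -- f`.
  have h1 : ∀ c, letterGraph c f (K .one c) := fun c => by
    obtain ⟨k, hk, hk'⟩ := h .one c
    simp only [letterGraph] at hk'
    exact hk' ▸ wordGraph_singleton.1 hk
  have h2 : ∀ b c, letterGraph b (K .one c) (K b c) := fun b c => by
    obtain ⟨k, hk, hk'⟩ := h b c
    rwa [← letterGraph_unique (wordGraph_singleton.1 hk) (h1 c)]
  have h3 : ∀ b, K b .one = K .one b := fun b => by
    have := h2 b .one
    rw [show K .one .one = f from h1 .one] at this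
    exact letterGraph_unique this (h1 b)
  induction t generalizing a with
  | zero =>
    have := letterGraph_gate (g 0) h1 a
    simpa [heisenberg, circuit, h3, ite_smul] using this
  | succ t ih =>
    have ih' := ih (fun k => g k.castSucc) (fun k => γ k.castSucc)
    have hp := fun {f : Hilb m} {K : Letter m → Hilb m} (h : ∀ b, letterGraph b f (K b)) =>
      posGraph_circuit t (fun k => g k.castSucc) (fun k => γ k.castSucc) h 0
    set U := circuit t (fun k => g k.castSucc) (fun k => γ k.castSucc)
    set S := heisenberg t (fun k => g k.castSucc) (fun k => γ k.castSucc) with hS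
    set X : Letter m → Hilb m := fun a => ∑ b, ∑ c, S a b c • K b c with hX
    set Y : Hilb m := ∑ b, S (.pos 0) b .one • ∑ c, S (.pos 0) c .one • K b c with hY
    have hq1 := hp h1
    -- Second factor of `q̂_1²`: the first one has produced `U` of a combination of the vectors `c
    -- f`, and every letter is defined at this combination by linearity.
    have hq2 : posGraph 0 (U (∑ c, S (.pos 0) c .one • K .one c)) (U Y) :=
      hp fun b => (isLinearRel_letterGraph b).sum _
        fun c _ => (isLinearRel_letterGraph b).smul _ (h2 b c)
    have hC : ∀ a, letterGraph a (cubicGate (γ (Fin.last t)) (U f))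
        (cubicGate (γ (Fin.last t))
          (U (X a + if a = .mom 0 then (6 * γ (Fin.last t) : ℂ) • Y else 0))) := by
      intro a
      have ha := ih' a
      cases a with
      | one =>
        simp only [letterGraph] at ha ⊢
        simp [← ha, hX]
      | pos j =>
        simp only [reduceCtorEq, if_false, add_zero]
        exact posGraph_phaseOp ha
      | mom j =>
        by_cases hj : j = 0
        · subst hj
          simp only [if_true, map_add, map_smul]
          rw [← map_smul (cubicGate _), ← map_add (cubicGate _)]
          exact momGraph_cubicGate_zero _ ha hq1 hq2
        · simp only [Letter.mom.injEq, hj, if_false, add_zero]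
          exact momGraph_cubicGate_of_ne _ hj ha
    have key := letterGraph_gate (g (Fin.last (t + 1))) hC a
    simp_rw [← map_smul, ← map_sum] at key
    have e : Y = ∑ b, ∑ c, (S (.pos 0) b .one * S (.pos 0) c .one) • K b c := by
      simp_rw [hY, Finset.smul_sum, mul_smul]
    have e' : ∑ b, ∑ c, heisenberg (t + 1) g γ a b c • K b c =
        ∑ a', affine (g (Fin.last (t + 1))) a a' •
          (X a' + if a' = .mom 0 then (6 * γ (Fin.last t) : ℂ) • Y else 0) := by
      simp_rw [smul_add, Finset.sum_add_distrib, smul_ite, smul_zero]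
      rw [Finset.sum_ite_eq' Finset.univ (Letter.mom 0)]
      simp only [Finset.mem_univ, if_true, e, hX, heisenberg, ← hS, add_smul,
        Finset.sum_add_distrib, Finset.smul_sum, Finset.sum_smul, mul_smul]
      congr 1
      rw [Finset.sum_comm' (t' := Finset.univ) (s' := fun _ => Finset.univ) (by simp),
        Finset.sum_congr rfl fun c _ => Finset.sum_comm, Finset.sum_comm]
      exact Finset.sum_congr rfl fun a' _ => Finset.sum_comm
    rw [e', circuit_succ_apply, circuit_succ_apply]
    exact key

/-! ### Heisenberg evolution of words -/

/-- Substitution of `∑ b c, S a b c • b c` for each letter `a` of a word, the words of the result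
being evaluated by `X`. -/
def substitute {E : Type*} [AddCommGroup E] [Module ℂ E] (S : Letter m → Letter m → Letter m → ℂ) :
    List (Letter m) → (List (Letter m) → E) → E
  | [], X => X []
  | a :: w, X => ∑ b, ∑ c, S a b c • substitute S w fun w' => X (b :: c :: w')

/-- `substitute` takes values in any complex vector space, so that the same formula applies to
vectors, operators and traces. This lemma moves it along linear relations between them: the graph of
a word, evaluation at a vector, and `HasTrace`. -/
theorem IsLinearRel.substitute {E F : Type*} [AddCommGroup E] [Module ℂ E] [AddCommGroup F]
    [Module ℂ F] {A : E → F → Prop} (hA : IsLinearRel A) (S : Letter m → Letter m → Letter m → ℂ)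
    (w : List (Letter m)) {X : List (Letter m) → E} {Y : List (Letter m) → F}
    (h : ∀ w' : List (Letter m), w'.length = 2 * w.length → A (X w') (Y w')) :
    A (CV.substitute S w X) (CV.substitute S w Y) := by
  induction w generalizing X Y with
  | nil => exact h [] rfl
  | cons a w ih =>
    refine hA.sum _ fun b _ => hA.sum _ fun c _ => hA.smul _ (ih fun w' hw' => h _ ?_)
    simp only [List.length_cons, hw']
    ring

/-- Induction on the word, whose tail acts first: the tail sends `U f` to `U k` with `k` the
substituted combination, and each two-letter word is defined at `k` because it is defined at all the
summands. Then `letterGraph_circuit` treats the head. -/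
theorem wordGraph_circuit [NeZero m] (t : ℕ) (g : Fin (t + 1) → DispOrth m) (γ : Fin t → ℝ)
    {f : Hilb m} (w : List (Letter m)) {X : List (Letter m) → Hilb m}
    (h : ∀ w' : List (Letter m), w'.length = 2 * w.length → wordGraph w' f (X w')) :
    wordGraph w (circuit t g γ f)
      (circuit t g γ (substitute (heisenberg t g γ) w X)) := by
  induction w generalizing X with
  | nil =>
    simp only [wordGraph, substitute]
    rw [show X [] = f from h [] rfl]
  | cons a w ih =>
    have h1 : ∀ w' : List (Letter m), w'.length = 2 * w.length →
        wordGraph w' f (X (.one :: .one :: w')) := fun w' hw' => by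
      obtain ⟨k, ⟨k', h1, h2⟩, h3⟩ :=
        h (.one :: .one :: w') (by simp only [List.length_cons]; omega)
      simp only [letterGraph] at h2 h3
      rwa [h3, h2]
    have h2 : ∀ b c, wordGraph [b, c]
        (substitute (heisenberg t g γ) w fun w' => X (.one :: .one :: w'))
        (substitute (heisenberg t g γ) w fun w' => X (b :: c :: w')) := fun b c => by
      refine (isLinearRel_wordGraph [b, c]).substitute _ _ fun w' hw' => ?_
      obtain ⟨k, ⟨k', e1, e2⟩, e3⟩ := h (b :: c :: w') (by simp only [List.length_cons]; omega)
      -- The word `b c w'` passes through some value of `w'` at `f`; single-valuedness identifies it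
      -- with the summand `X (1 1 w')` of `k`.
      rw [wordGraph_unique e1 (h1 w' hw')] at e2
      exact ⟨k, wordGraph_singleton.2 e2, e3⟩
    exact ⟨_, ih h1, letterGraph_circuit t g γ h2 a⟩

/-! ### Expectation values at the output of a circuit -/

/-- A table of moments, as a function on all words. -/
def momentTable {n : ℕ} (M : (Fin n → Letter m) → ℂ) (l : List (Letter m)) : ℂ :=
  if hl : l.length = n then M fun i => l.get (i.cast hl.symm) else 0

theorem ofFn_get_cast {α : Type*} {n : ℕ} (l : List α) (hl : l.length = n) :
    List.ofFn (fun i : Fin n => l.get (i.cast hl.symm)) = l := by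
  apply List.ext_get <;> simp [hl]

/-- The expectation value at the output of the circuit in terms of the moments of the input. -/
def outputValue [NeZero m] {d t : ℕ} (g : Fin (t + 1) → DispOrth m) (γ : Fin t → ℝ)
    (M : (Fin (2 * d) → Letter m) → ℂ) (h : (Fin d → Letter m) → ℂ) : ℂ :=
  ∑ w, h w * substitute (heisenberg t g γ) (List.ofFn w) (momentTable M)

/-- One operator serves both pictures: `T` itself for `U† H U`, and its conjugate by the circuit for
the evolved state. It is the combination of the operators `W ρ` prescribed by the substitution, so
its trace comes from linearity. -/
theorem exists_output_operator [NeZero m] {d t : ℕ} (g : Fin (t + 1) → DispOrth m) (γ : Fin t → ℝ)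
    {ρ : Hilb m →L[ℂ] Hilb m} {M : (Fin (2 * d) → Letter m) → ℂ} (h : (Fin d → Letter m) → ℂ)
    (hM : ∀ w : Fin (2 * d) → Letter m, HasExpectation ρ (wordGraph (List.ofFn w)) (M w)) :
    ∃ T : Hilb m →L[ℂ] Hilb m,
      (∀ f, polyGraph h (circuit t g γ (ρ f)) (circuit t g γ (T f))) ∧
      HasTrace T (outputValue g γ M h) := by
  choose T hT hTr using hM
  -- The value zero on words of other lengths is never used: substitution in a word of length `d`
  -- only produces words of length `2d`.
  set T' : List (Letter m) → Hilb m →L[ℂ] Hilb m := fun l =>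
    if hl : l.length = 2 * d then T fun i => l.get (i.cast hl.symm) else 0 with hT'
  have h1 : ∀ (l : List (Letter m)), l.length = 2 * d → ∀ f, wordGraph l (ρ f) (T' l f) := by
    intro l hl f
    have := hT (fun i => l.get (i.cast hl.symm)) f
    rw [ofFn_get_cast l hl] at this
    simpa [hT', hl] using this
  refine ⟨∑ w, h w • substitute (heisenberg t g γ) (List.ofFn w) T', ?_, ?_⟩
  · intro f
    refine ⟨fun w => circuit t g γ (substitute (heisenberg t g γ) (List.ofFn w) T' f), ?_, ?_⟩
    · intro w
      have hlin : IsLinearRel fun (T : Hilb m →L[ℂ] Hilb m) k => T f = k :=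
        ⟨rfl, fun h h' => by simp [h, h'], fun c _ _ h => by simp [h]⟩
      have e := hlin.substitute (heisenberg t g γ) (List.ofFn w) (X := T') (Y := fun l => T' l f)
        fun _ _ => rfl
      simp only [e]
      exact wordGraph_circuit t g γ _ fun w' hw' => h1 w' (by simpa using hw') f
    · simp
  · refine isLinearRel_hasTrace.sum _ fun w _ => isLinearRel_hasTrace.smul _ ?_
    refine isLinearRel_hasTrace.substitute _ _ fun w' hw' => ?_
    have hw : w'.length = 2 * d := by simpa using hw'
    simp only [hT', momentTable, hw, dif_pos]
    exact hTr _

theorem hasExpectation_conjGraph [NeZero m] {d t : ℕ} (g : Fin (t + 1) → DispOrth m)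
    (γ : Fin t → ℝ) {ρ : Hilb m →L[ℂ] Hilb m} {M : (Fin (2 * d) → Letter m) → ℂ}
    (h : (Fin d → Letter m) → ℂ)
    (hM : ∀ w : Fin (2 * d) → Letter m, HasExpectation ρ (wordGraph (List.ofFn w)) (M w)) :
    HasExpectation ρ (conjGraph (circuit t g γ) (polyGraph h)) (outputValue g γ M h) := by
  obtain ⟨T, hT, hTr⟩ := exists_output_operator g γ h hM
  exact ⟨T, fun f => ⟨_, hT f, ((isUnitaryOp_circuit t g γ).adjoint_apply_self _).symm⟩, hTr⟩

theorem hasExpectation_output [NeZero m] {d t : ℕ} (g : Fin (t + 1) → DispOrth m)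
    (γ : Fin t → ℝ) {ρ : Hilb m →L[ℂ] Hilb m} {M : (Fin (2 * d) → Letter m) → ℂ}
    (h : (Fin d → Letter m) → ℂ)
    (hM : ∀ w : Fin (2 * d) → Letter m, HasExpectation ρ (wordGraph (List.ofFn w)) (M w)) :
    HasExpectation (circuit t g γ ∘L ρ ∘L ContinuousLinearMap.adjoint (circuit t g γ))
      (polyGraph h) (outputValue g γ M h) := by
  obtain ⟨T, hT, hTr⟩ := exists_output_operator g γ h hM
  exact ⟨_, fun f => hT _, hTr.conj (isUnitaryOp_circuit t g γ)⟩

/-! ### Reasoning about programs -/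

/-- Started in `s`, the program `P` halts after at most `T` steps in a state satisfying `Q`. -/
def Exec (P : Program) (s : State) (T : ℕ) (Q : State → Prop) : Prop :=
  ∃ (n : ℕ) (s' : State), Runs P s n s' ∧ n ≤ T ∧ Q s'

/-- Straight-line programs. -/
def block : Instr → List Instr → Program
  | i, [] => .instr i
  | i, j :: l => .seq (.instr i) (block j l)

theorem runs_block (i : Instr) (l : List Instr) (s : State) :
    Runs (block i l) s (l.length + 1) (l.foldl Instr.run (i.run s)) := by
  induction l generalizing i s with
  | nil => exact .instr i s
  | cons j l ih =>
    rw [List.length_cons, add_comm]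
    exact .seq (.instr i s) (ih j _)

theorem Exec.block {i : Instr} {l : List Instr} {s : State} {Q : State → Prop}
    (h : Q (l.foldl Instr.run (i.run s))) : Exec (CV.block i l) s (l.length + 1) Q :=
  ⟨_, _, runs_block i l s, le_rfl, h⟩

theorem Exec.mono {P : Program} {s : State} {T T' : ℕ} {Q Q' : State → Prop}
    (h : Exec P s T Q) (hT : T ≤ T') (hQ : ∀ s', Q s' → Q' s') : Exec P s T' Q' := by
  obtain ⟨n, s', h1, h2, h3⟩ := h
  exact ⟨n, s', h1, h2.trans hT, hQ _ h3⟩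

theorem Exec.seq {P P' : Program} {s : State} {T T' : ℕ} {Q Q' : State → Prop}
    (h : Exec P s T Q) (h' : ∀ s', Q s' → Exec P' s' T' Q') :
    Exec (.seq P P') s (T + T') Q' := by
  obtain ⟨n, s', h1, h2, h3⟩ := h
  obtain ⟨n', s'', h1', h2', h3'⟩ := h' s' h3
  exact ⟨_, _, .seq h1 h1', Nat.add_le_add h2 h2', h3'⟩

theorem Exec.ifLt {x y : ℕ} {P P' : Program} {s : State} {T : ℕ} {Q : State → Prop}
    (h : s.ireg x < s.ireg y → Exec P s T Q) (h' : ¬ s.ireg x < s.ireg y → Exec P' s T Q) :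
    Exec (.ifLt x y P P') s (T + 1) Q := by
  by_cases hxy : s.ireg x < s.ireg y
  · obtain ⟨n, s', h1, h2, h3⟩ := h hxy
    exact ⟨_, _, .if_true hxy h1, by omega, h3⟩
  · obtain ⟨n, s', h1, h2, h3⟩ := h' hxy
    exact ⟨_, _, .if_false hxy h1, by omega, h3⟩

/-- A loop that runs `N` times, with an invariant indexed by the number of iterations done. -/
theorem Exec.whileLt {x y : ℕ} {P : Program} {s : State} {T : ℕ} {Q : State → Prop} (N : ℕ)
    (I : ℕ → State → Prop) (h0 : I 0 s)
    (hstep : ∀ i s, i < N → I i s → s.ireg x < s.ireg y ∧ Exec P s T (I (i + 1)))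
    (hend : ∀ s, I N s → ¬ s.ireg x < s.ireg y ∧ Q s) :
    Exec (.whileLt x y P) s (N * (T + 1) + 1) Q := by
  suffices H : ∀ k i s, i + k = N → I i s → Exec (.whileLt x y P) s (k * (T + 1) + 1) Q from
    H N 0 s (by omega) h0
  intro k
  induction k with
  | zero =>
    intro i s hi h
    obtain rfl : i = N := by omega
    exact ⟨1, s, .while_false (hend s h).1, by omega, (hend s h).2⟩
  | succ k ih =>
    intro i s hi h
    obtain ⟨hlt, n, s', h1, h2, h3⟩ := hstep i s (by omega) h
    obtain ⟨n', s'', h1', h2', h3'⟩ := ih (i + 1) s' (by omega) h3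
    refine ⟨_, _, .while_true hlt h1 h1', ?_, h3'⟩
    rw [Nat.succ_mul]
    omega

/-- The integer registers below `20` and the complex registers from `4` on, which subroutines leave
unchanged. Of these, `3` always holds `0` and `4` always holds `1`. -/
structure Frame (s s' : State) : Prop where
  ireg : ∀ x, x < 20 → s'.ireg x = s.ireg x
  creg : ∀ x, 4 ≤ x → s'.creg x = s.creg x

/-! ### Multiplication of natural numbers -/

/-- Register `21` receives the product of the registers `x` and `y`. -/
def mulProg (x y : ℕ) : Program :=
  .seq (block (.iconst 20 0) [.iconst 21 0])
    (.whileLt 20 y (block (.iadd 21 21 x) [.iadd 20 20 4]))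

/-- The machine cannot multiply natural numbers, hence repeated addition. Linear time in the second
factor is harmless, since only sizes of tables are computed in this way, with the number of letters
as second factor. -/
theorem exec_mulProg {x y : ℕ} (hx : x < 20) (hy : y < 20) (s : State) (h4 : s.ireg 4 = 1) :
    Exec (mulProg x y) s (3 * s.ireg y + 3) fun s' =>
      Frame s s' ∧ s'.ireg 21 = s.ireg x * s.ireg y ∧ s'.cmem = s.cmem := by
  refine ((Exec.block (Q := fun s' => Frame s s' ∧ s'.ireg 21 = 0 ∧ s'.ireg 20 = 0 ∧
    s'.cmem = s.cmem) ?_).seq (fun s1 h1 => Exec.whileLt (T := 2) (s.ireg y)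
      (fun i s' => Frame s s' ∧ s'.ireg 21 = s.ireg x * i ∧ s'.ireg 20 = i ∧ s'.cmem = s.cmem)
      ?_ ?_ ?_)).mono ?_ (fun _ => id)
  · refine ⟨⟨?_, ?_⟩, ?_, ?_, ?_⟩ <;>
      simp only [List.foldl, Instr.run, Function.update_apply] <;> grind
  · simpa using h1
  · rintro i s' hi ⟨hf, e1, e2, e3⟩
    have := hf.ireg
    refine ⟨by grind, Exec.block ?_⟩
    have := hf.creg
    refine ⟨⟨?_, ?_⟩, ?_, ?_, ?_⟩ <;>
      simp only [List.foldl, Instr.run, Function.update_apply] <;> grind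
  · rintro s' ⟨hf, e1, e2, e3⟩
    have := hf.ireg
    exact ⟨by grind, hf, e1, e3⟩
  · simp; omega

/-! ### Strided matrix products -/

/-- The scalar product of length `K` of a contiguous vector with a strided one. -/
def dot (s : State) (A X ab xb stride K : ℕ) : ℂ :=
  ∑ c ∈ Finset.range K, s.cmem A (ab + c) * s.cmem X (xb + c * stride)

/-- Accumulates in the complex register `1` the scalar product of the array `A` between the
positions in the registers `31` and `32` and the array `X` from the position in register `30`
on. -/
def dotProg (A X : ℕ) : Program :=
  .whileLt 31 32 (block (.cload 2 A 31) [.cload 3 X 30, .cmul 2 2 3, .cadd 1 1 2, .iadd 31 31 4,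
    .iadd 30 30 26])

theorem exec_dotProg (A X K : ℕ) (s : State) (h4 : s.ireg 4 = 1)
    (h32 : s.ireg 32 = s.ireg 31 + K) :
    Exec (dotProg A X) s (K * 7 + 1) fun s' => s'.cmem = s.cmem ∧
      s'.creg 1 = s.creg 1 + dot s A X (s.ireg 31) (s.ireg 30) (s.ireg 26) K ∧
      (∀ x, x ≠ 30 → x ≠ 31 → s'.ireg x = s.ireg x) ∧ ∀ x, 4 ≤ x → s'.creg x = s.creg x := by
  refine Exec.whileLt K (fun i s' => s'.cmem = s.cmem ∧
      s'.creg 1 = s.creg 1 + dot s A X (s.ireg 31) (s.ireg 30) (s.ireg 26) i ∧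
      (s'.ireg 31 = s.ireg 31 + i ∧ s'.ireg 30 = s.ireg 30 + i * s.ireg 26) ∧
      (∀ x, x ≠ 30 → x ≠ 31 → s'.ireg x = s.ireg x) ∧ ∀ x, 4 ≤ x → s'.creg x = s.creg x) ?_ ?_ ?_
  · simp [dot]
  · rintro i s' hi ⟨h1, h2, ⟨h3, h3'⟩, h5, h6⟩
    have e4 := h5 4 (by decide) (by decide)
    have e26 := h5 26 (by decide) (by decide)
    have e32 := h5 32 (by decide) (by decide)
    refine ⟨by omega, Exec.block ?_⟩
    have hd : dot s A X (s.ireg 31) (s.ireg 30) (s.ireg 26) (i + 1) =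
      dot s A X (s.ireg 31) (s.ireg 30) (s.ireg 26) i + _ := Finset.sum_range_succ _ _
    have hm : (i + 1) * s.ireg 26 = i * s.ireg 26 + s.ireg 26 := by ring
    refine ⟨?_, ?_, ⟨?_, ?_⟩, ?_, ?_⟩ <;>
      simp only [List.foldl, Instr.run, Function.update_apply]
    · exact h1
    · rw [hd]
      simp [h1, h2, h3, h3', add_assoc]
    · simp [h3, e4, h4, add_assoc]
    · simp [h3', e26, hm, add_assoc]
    · intro x hx hx'
      simp [hx, hx', h5]
    · intro x hx
      grind
  · rintro s' ⟨h1, h2, ⟨h3, h3'⟩, h5, h6⟩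
    have e32 := h5 32 (by decide) (by decide)
    exact ⟨by omega, h1, h2, h5, h6⟩

/-- One row of a strided matrix product. -/
def rowProg (A X : ℕ) : Program :=
  .whileLt 29 24 (.seq (block (.iadd 31 21 3) [.iadd 30 29 3, .cconst 1 0])
    (.seq (dotProg A X) (block (.cstore X 27 1) [.iadd 27 27 4, .iadd 29 29 25])))

/-- Writing starts at the position in register `27` and moves up, while everything read from the
array `X` lies below it (`hA`, `hX`). So the original contents enter the product even if factors and
product share an array. -/
theorem exec_rowProg (A X K W : ℕ) (s : State) (h3 : s.ireg 3 = 0) (h4 : s.ireg 4 = 1)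
    (h32 : s.ireg 32 = s.ireg 21 + K) (h25 : 0 < s.ireg 25)
    (h24 : s.ireg 24 = s.ireg 29 + W * s.ireg 25)
    (hA : A = X → s.ireg 21 + K ≤ s.ireg 27)
    (hX : ∀ y c, y < W → c < K → s.ireg 29 + y * s.ireg 25 + c * s.ireg 26 < s.ireg 27) :
    Exec (rowProg A X) s (W * (K * 7 + 8) + 1) fun s' =>
      (∀ y, y < W → s'.cmem X (s.ireg 27 + y) =
        dot s A X (s.ireg 21) (s.ireg 29 + y * s.ireg 25) (s.ireg 26) K) ∧
      (∀ n, n < s.ireg 27 → s'.cmem X n = s.cmem X n) ∧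
      (∀ a, a ≠ X → s'.cmem a = s.cmem a) ∧
      s'.ireg 27 = s.ireg 27 + W ∧
      (∀ x, x ≠ 27 → x ≠ 29 → x ≠ 30 → x ≠ 31 → s'.ireg x = s.ireg x) ∧
      ∀ x, 4 ≤ x → s'.creg x = s.creg x := by
  refine (Exec.whileLt (T := K * 7 + 7) W (fun i s' =>
      (∀ y, y < i → s'.cmem X (s.ireg 27 + y) =
        dot s A X (s.ireg 21) (s.ireg 29 + y * s.ireg 25) (s.ireg 26) K) ∧
      (∀ n, n < s.ireg 27 → s'.cmem X n = s.cmem X n) ∧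
      (∀ a, a ≠ X → s'.cmem a = s.cmem a) ∧
      (s'.ireg 27 = s.ireg 27 + i ∧ s'.ireg 29 = s.ireg 29 + i * s.ireg 25) ∧
      (∀ x, x ≠ 27 → x ≠ 29 → x ≠ 30 → x ≠ 31 → s'.ireg x = s.ireg x) ∧
      ∀ x, 4 ≤ x → s'.creg x = s.creg x) ?_ ?_ ?_)
  · simp
  · rintro i s1 hi ⟨g1, g2, g3, ⟨g4, g4'⟩, g5, g6⟩
    have e3 := g5 3 (by decide) (by decide) (by decide) (by decide)
    have e4 := g5 4 (by decide) (by decide) (by decide) (by decide)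
    have e21 := g5 21 (by decide) (by decide) (by decide) (by decide)
    have e24 := g5 24 (by decide) (by decide) (by decide) (by decide)
    have e25 := g5 25 (by decide) (by decide) (by decide) (by decide)
    have e26 := g5 26 (by decide) (by decide) (by decide) (by decide)
    have e32 := g5 32 (by decide) (by decide) (by decide) (by decide)
    -- As the stride is positive, the pointer in register `29` is below the limit for `i < W` and
    -- meets it after exactly `W` columns.
    have hlt : (i + 1) * s.ireg 25 ≤ W * s.ireg 25 := Nat.mul_le_mul_right _ hi
    have hm : (i + 1) * s.ireg 25 = i * s.ireg 25 + s.ireg 25 := by ring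
    refine ⟨by omega, ?_⟩
    have hA' : ∀ c, c < K → s1.cmem A (s.ireg 21 + c) = s.cmem A (s.ireg 21 + c) := by
      intro c hc
      by_cases h : A = X
      · have := hA h
        subst h
        exact g2 _ (by omega)
      · rw [g3 _ h]
    have hX' : ∀ c, c < K → s1.cmem X (s.ireg 29 + i * s.ireg 25 + c * s.ireg 26) =
        s.cmem X (s.ireg 29 + i * s.ireg 25 + c * s.ireg 26) := fun c hc => g2 _ (hX i c hi hc)
    have hdot : dot s1 A X (s.ireg 21) (s.ireg 29 + i * s.ireg 25) (s.ireg 26) K =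
        dot s A X (s.ireg 21) (s.ireg 29 + i * s.ireg 25) (s.ireg 26) K :=
      Finset.sum_congr rfl fun c hc => by
        rw [hA' c (Finset.mem_range.1 hc), hX' c (Finset.mem_range.1 hc)]
    refine ((Exec.block (Q := fun s' => s'.cmem = s1.cmem ∧ s'.creg 1 = 0 ∧
      (s'.ireg 31 = s.ireg 21 ∧ s'.ireg 30 = s.ireg 29 + i * s.ireg 25) ∧
      (∀ x, x ≠ 30 → x ≠ 31 → s'.ireg x = s1.ireg x) ∧ ∀ x, 4 ≤ x → s'.creg x = s1.creg x) ?_).seq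
      fun s2 h2 => (exec_dotProg A X K s2 ?_ ?_).seq fun s3 h3 => Exec.block ?_).mono ?_
      fun _ => id
    · refine ⟨?_, ?_, ⟨?_, ?_⟩, ?_, ?_⟩ <;>
        simp only [List.foldl, Instr.run, Function.update_apply] <;> grind
    · rw [h2.2.2.2.1 4 (by decide) (by decide), e4, h4]
    · rw [h2.2.2.2.1 32 (by decide) (by decide), h2.2.2.1.1, e32, h32]
    · obtain ⟨k1, k2, ⟨k3, k3'⟩, k5, k6⟩ := h2
      obtain ⟨l1, l2, l5, l6⟩ := h3
      have hdot' : dot s2 A X (s2.ireg 31) (s2.ireg 30) (s2.ireg 26) K =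
          dot s A X (s.ireg 21) (s.ireg 29 + i * s.ireg 25) (s.ireg 26) K := by
        rw [← hdot, k3, k3', k5 26 (by decide) (by decide), e26]
        simp only [dot, k1]
      rw [hdot', k2, zero_add] at l2
      have f27 : s3.ireg 27 = s.ireg 27 + i := by
        rw [l5 27 (by decide) (by decide), k5 27 (by decide) (by decide), g4]
      have f29 : s3.ireg 29 = s.ireg 29 + i * s.ireg 25 := by
        rw [l5 29 (by decide) (by decide), k5 29 (by decide) (by decide), g4']
      have f4 : s3.ireg 4 = 1 := by
        rw [l5 4 (by decide) (by decide), k5 4 (by decide) (by decide), e4, h4]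
      have f25 : s3.ireg 25 = s.ireg 25 := by
        rw [l5 25 (by decide) (by decide), k5 25 (by decide) (by decide), e25]
      refine ⟨?_, ?_, ?_, ⟨?_, ?_⟩, ?_, ?_⟩ <;>
        simp only [List.foldl, Instr.run, Function.update_apply, if_true]
      · intro y hy
        by_cases hyi : y = i
        · subst hyi
          simp [f27, l2]
        · rw [if_neg (by omega), l1, k1, g1 y (by omega)]
      · intro n hn
        rw [if_neg (by omega), l1, k1, g2 n hn]
      · intro a ha
        rw [if_neg ha, l1, k1, g3 a ha]
      · simp [f27, f4, add_assoc]
      · simp [f29, f25, hm, add_assoc]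
      · intro x h1 h2 h3 h4
        simp [h1, h2, l5 x h3 h4, k5 x h3 h4, g5 x h1 h2 h3 h4]
      · intro x hx
        rw [l6 x hx, k6 x hx, g6 x hx]
    · simp only [List.length]; omega
  · rintro s' ⟨g1, g2, g3, ⟨g4, g4'⟩, g5, g6⟩
    have e24 := g5 24 (by decide) (by decide) (by decide) (by decide)
    exact ⟨by omega, g1, g2, g3, g4, g5, g6⟩

/-- Appends to the array `X`, from the position in register `27` on, the product of a matrix in the
array `A` and a strided matrix in the array `X`. -/
def gemmProg (A X : ℕ) : Program :=
  .seq (block (.iconst 28 0) [])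
    (.whileLt 28 20 (.seq (block (.iadd 29 23 3) [.iadd 32 21 22])
      (.seq (rowProg A X) (block (.iadd 21 32 3) [.iadd 28 28 4]))))

/-- The arguments of `gemmProg`: the numbers `R` of rows and `W` of columns of the product, the
length `K` of the scalar products, the positions `ab`, `xb`, `out` of the two factors and of the
product, and the strides `so`, `si` between and inside the columns of the second factor. -/
structure GemmArgs (s : State) (R W K ab xb so si out : ℕ) : Prop where
  zero : s.ireg 3 = 0
  one : s.ireg 4 = 1
  rows : s.ireg 20 = R
  left : s.ireg 21 = ab
  length : s.ireg 22 = K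
  right : s.ireg 23 = xb
  limit : s.ireg 24 = xb + W * so
  outer : s.ireg 25 = so
  inner : s.ireg 26 = si
  out : s.ireg 27 = out

/-- The effect of `gemmProg`. -/
structure GemmResult (s s' : State) (A X R W K ab xb so si out : ℕ) : Prop where
  frame : Frame s s'
  product : ∀ a y, a < R → y < W →
    s'.cmem X (out + a * W + y) = dot s A X (ab + a * K) (xb + y * so) si K
  below : ∀ n, n < out → s'.cmem X n = s.cmem X n
  other : ∀ a, a ≠ X → s'.cmem a = s.cmem a
  out : s'.ireg 27 = out + R * W

/-- This routine carries all the table arithmetic: the square of `q̂_1` (an outer product, inner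
length 1), the action of a gate, the contraction of a letter, and the final scalar product. Results
are appended, so the earlier tables survive. -/
theorem exec_gemmProg (A X R W K ab xb so si out : ℕ) (s : State)
    (hs : GemmArgs s R W K ab xb so si out) (hso : 0 < so)
    (hA : A = X → ab + R * K ≤ out)
    (hX : ∀ y c, y < W → c < K → xb + y * so + c * si < out) :
    Exec (gemmProg A X) s (R * (W * (K * 7 + 8) + 6) + 2) fun s' =>
      GemmResult s s' A X R W K ab xb so si out := by
  obtain ⟨z3, z4, z20, z21, z22, z23, z24, z25, z26, z27⟩ := hs
  refine ((Exec.block (Q := fun s' => s'.cmem = s.cmem ∧ s'.ireg 28 = 0 ∧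
    (∀ x, x ≠ 28 → s'.ireg x = s.ireg x) ∧ s'.creg = s.creg) ?_).seq fun s1 h1 =>
    Exec.whileLt (T := W * (K * 7 + 8) + 5) R (fun i s' =>
      (∀ a y, a < i → y < W →
        s'.cmem X (out + a * W + y) = dot s A X (ab + a * K) (xb + y * so) si K) ∧
      (∀ n, n < out → s'.cmem X n = s.cmem X n) ∧
      (∀ a, a ≠ X → s'.cmem a = s.cmem a) ∧
      (s'.ireg 27 = out + i * W ∧ s'.ireg 28 = i ∧ s'.ireg 21 = ab + i * K) ∧
      (∀ x, x ≠ 21 → x ≠ 27 → x ≠ 28 → x ≠ 29 → x ≠ 30 → x ≠ 31 → x ≠ 32 →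
        s'.ireg x = s.ireg x) ∧
      ∀ x, 4 ≤ x → s'.creg x = s.creg x) ?_ ?_ ?_).mono ?_ fun _ => id
  · refine ⟨?_, ?_, ?_, ?_⟩ <;>
      simp only [List.foldl, Instr.run, Function.update_apply] <;> grind
  · obtain ⟨h1, h2, h3, h4⟩ := h1
    refine ⟨by simp, by simp [h1], by simp [h1], ⟨?_, h2, ?_⟩, ?_, by simp [h4]⟩
    · simp [h3, z27]
    · simp [h3, z21]
    · intro x _ _ hx _ _ _ _
      exact h3 x hx
  · rintro i s2 hi ⟨g1, g2, g3, ⟨g4, g4', g4''⟩, g5, g6⟩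
    have e : ∀ x, x < 27 → x ≠ 21 → s2.ireg x = s.ireg x := fun x hx hx' =>
      g5 x hx' (by omega) (by omega) (by omega) (by omega) (by omega) (by omega)
    have e20 := e 20 (by decide) (by decide)
    refine ⟨by omega, ?_⟩
    have hiR : (i + 1) * K ≤ R * K := Nat.mul_le_mul_right _ hi
    have hm : (i + 1) * K = i * K + K := by ring
    have hm' : (i + 1) * W = i * W + W := by ring
    refine ((Exec.block (Q := fun s' => s'.cmem = s2.cmem ∧ s'.ireg 29 = xb ∧
      s'.ireg 32 = ab + i * K + K ∧ (∀ x, x ≠ 29 → x ≠ 32 → s'.ireg x = s2.ireg x) ∧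
      s'.creg = s2.creg) ?_).seq fun s3 h3 =>
      (exec_rowProg A X K W s3 ?_ ?_ ?_ ?_ ?_ ?_ ?_).seq fun s4 h4 => Exec.block ?_).mono ?_
      fun _ => id
    · have e3 := e 3 (by decide) (by decide)
      have e23 := e 23 (by decide) (by decide)
      have e22 := e 22 (by decide) (by decide)
      refine ⟨?_, ?_, ?_, ?_, ?_⟩ <;>
        simp only [List.foldl, Instr.run, Function.update_apply] <;> grind
    · rw [h3.2.2.2.1 3 (by decide) (by decide), e 3 (by decide) (by decide), z3]
    · rw [h3.2.2.2.1 4 (by decide) (by decide), e 4 (by decide) (by decide), z4]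
    · rw [h3.2.2.2.1 21 (by decide) (by decide), h3.2.2.1, g4'']
    · rwa [h3.2.2.2.1 25 (by decide) (by decide), e 25 (by decide) (by decide), z25]
    · rw [h3.2.2.2.1 25 (by decide) (by decide), e 25 (by decide) (by decide), z25,
        h3.2.2.2.1 24 (by decide) (by decide), e 24 (by decide) (by decide), z24, h3.2.1]
    · intro h
      have := hA h
      rw [h3.2.2.2.1 21 (by decide) (by decide), h3.2.2.2.1 27 (by decide) (by decide), g4'', g4]
      omega
    · intro y c hy hc
      have := hX y c hy hc
      rw [h3.2.2.2.1 25 (by decide) (by decide), e 25 (by decide) (by decide), z25,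
        h3.2.2.2.1 26 (by decide) (by decide), e 26 (by decide) (by decide), z26, h3.2.1,
        h3.2.2.2.1 27 (by decide) (by decide), g4]
      omega
    · obtain ⟨k1, k2, k3, k5, k6⟩ := h3
      obtain ⟨l1, l2, l3, l4, l5, l6⟩ := h4
      have f27 : s3.ireg 27 = out + i * W := by rw [k5 27 (by decide) (by decide), g4]
      have f21 : s3.ireg 21 = ab + i * K := by rw [k5 21 (by decide) (by decide), g4'']
      have f25 : s3.ireg 25 = so := by
        rw [k5 25 (by decide) (by decide), e 25 (by decide) (by decide), z25]
      have f26 : s3.ireg 26 = si := by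
        rw [k5 26 (by decide) (by decide), e 26 (by decide) (by decide), z26]
      rw [f27, f21, f25, f26, k2] at l1
      rw [f27] at l2 l4
      have r3 : s4.ireg 3 = 0 := by
        rw [l5 3 (by decide) (by decide) (by decide) (by decide), k5 3 (by decide) (by decide),
          e 3 (by decide) (by decide), z3]
      have r4 : s4.ireg 4 = 1 := by
        rw [l5 4 (by decide) (by decide) (by decide) (by decide), k5 4 (by decide) (by decide),
          e 4 (by decide) (by decide), z4]
      have r32 : s4.ireg 32 = ab + i * K + K := by
        rw [l5 32 (by decide) (by decide) (by decide) (by decide), k3]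
      have r28 : s4.ireg 28 = i := by
        rw [l5 28 (by decide) (by decide) (by decide) (by decide), k5 28 (by decide) (by decide),
          g4']
      have hread : ∀ y, y < W → dot s3 A X (ab + i * K) (xb + y * so) si K =
          dot s A X (ab + i * K) (xb + y * so) si K := by
        intro y hy
        refine Finset.sum_congr rfl fun c hc => ?_
        have hc' := Finset.mem_range.1 hc
        rw [k1, g2 _ (hX y c hy hc')]
        congr 1
        by_cases h : A = X
        · have := hA h
          subst h
          exact g2 _ (by omega)
        · rw [g3 _ h]
      refine ⟨?_, ?_, ?_, ⟨?_, ?_, ?_⟩, ?_, ?_⟩ <;>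
        simp only [List.foldl, Instr.run, Function.update_apply]
      · intro a y ha hy
        by_cases hai : a = i
        · subst hai
          rw [l1 y hy, hread y hy]
        · have : (a + 1) * W ≤ i * W := Nat.mul_le_mul_right _ (by omega)
          have hm'' : (a + 1) * W = a * W + W := by ring
          rw [l2 _ (by omega), k1, g1 a y (by omega) hy]
      · intro n hn
        rw [l2 n (by omega), k1, g2 n hn]
      · intro a ha
        rw [l3 a ha, k1, g3 a ha]
      · simp [l4, hm', add_assoc]
      · simp [r28, r4]
      · simp [r3, r32, hm, add_assoc]
      · intro x h1 h2 h3 h4 h5 h6 h7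
        simp [h1, h3, l5 x h2 h4 h5 h6, k5 x h4 h7, g5 x h1 h2 h3 h4 h5 h6 h7]
      · intro x hx
        rw [l6 x hx, k6, g6 x hx]
    · simp only [List.length]; omega
  · rintro s' ⟨g1, g2, g3, ⟨g4, g4', g4''⟩, g5, g6⟩
    have e20 := g5 20 (by decide) (by decide) (by decide) (by decide) (by decide) (by decide)
      (by decide)
    exact ⟨by omega, ⟨fun x hx => g5 x (by omega) (by omega) (by omega) (by omega) (by omega)
      (by omega) (by omega), g6⟩, g1, g2, g3, g4⟩
  · simp only [List.length]; exact le_of_eq (by ring)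

/-! ### Loading gates -/

/-- Uniqueness of quotient and remainder; it decides when two table cells coincide. -/
theorem cell_inj {r r' x x' l : ℕ} (hx : x < l) (hx' : x' < l) :
    r * l + x = r' * l + x' ↔ r = r' ∧ x = x' := by
  constructor
  · intro h
    have h1 : (r * l + x) / l = r := by
      rw [mul_comm, Nat.mul_add_div (by omega), Nat.div_eq_of_lt hx, add_zero]
    have h2 : (r' * l + x') / l = r' := by
      rw [mul_comm, Nat.mul_add_div (by omega), Nat.div_eq_of_lt hx', add_zero]
    have : r = r' := by rw [← h1, h, h2]
    subst this
    omega
  · rintro ⟨rfl, rfl⟩; rfl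

/-- Copies `m` entries of the array `2` to the array `A`, once from the position in register `25`
and once from the position in register `26` on. -/
def copyProg (A : ℕ) : Program :=
  .whileLt 24 0 (block (.cload 1 2 12) [.cstore A 25 1, .cstore A 26 1, .iadd 12 12 4,
    .iadd 25 25 4, .iadd 26 26 4, .iadd 24 24 4])

/-- Each matrix row is needed twice, once for a position and once for a momentum, as the symplectic
matrix is `diag(R, R)`. The hypothesis `h26` keeps the two targets disjoint. -/
theorem exec_copyProg {A : ℕ} (hA : 2 < A) (s : State) (h4 : s.ireg 4 = 1) (h24 : s.ireg 24 = 0)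
    (h26 : s.ireg 25 + s.ireg 0 ≤ s.ireg 26) :
    Exec (copyProg A) s (s.ireg 0 * 8 + 1) fun s' =>
      (∀ n, s'.cmem A n =
        if s.ireg 25 ≤ n ∧ n < s.ireg 25 + s.ireg 0 then
          s.cmem 2 (s.ireg 12 + (n - s.ireg 25))
        else if s.ireg 26 ≤ n ∧ n < s.ireg 26 + s.ireg 0 then
          s.cmem 2 (s.ireg 12 + (n - s.ireg 26))
        else s.cmem A n) ∧
      (∀ a, a ≠ A → s'.cmem a = s.cmem a) ∧
      s'.ireg 12 = s.ireg 12 + s.ireg 0 ∧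
      (∀ x, x ≠ 12 → x ≠ 24 → x ≠ 25 → x ≠ 26 → s'.ireg x = s.ireg x) ∧
      ∀ x, 4 ≤ x → s'.creg x = s.creg x := by
  refine Exec.whileLt (s.ireg 0) (fun i s' =>
      (∀ n, s'.cmem A n =
        if s.ireg 25 ≤ n ∧ n < s.ireg 25 + i then s.cmem 2 (s.ireg 12 + (n - s.ireg 25))
        else if s.ireg 26 ≤ n ∧ n < s.ireg 26 + i then s.cmem 2 (s.ireg 12 + (n - s.ireg 26))
        else s.cmem A n) ∧
      (∀ a, a ≠ A → s'.cmem a = s.cmem a) ∧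
      (s'.ireg 12 = s.ireg 12 + i ∧ s'.ireg 24 = i ∧ s'.ireg 25 = s.ireg 25 + i ∧
        s'.ireg 26 = s.ireg 26 + i) ∧
      (∀ x, x ≠ 12 → x ≠ 24 → x ≠ 25 → x ≠ 26 → s'.ireg x = s.ireg x) ∧
      ∀ x, 4 ≤ x → s'.creg x = s.creg x) ?_ ?_ ?_
  · refine ⟨fun n => ?_, by simp, by simp [h24], by simp, by simp⟩
    rw [if_neg (by omega), if_neg (by omega)]
  · rintro i s' hi ⟨g1, g2, ⟨g3, g4, g5, g6⟩, g7, g8⟩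
    have e0 := g7 0 (by decide) (by decide) (by decide) (by decide)
    have e4 := g7 4 (by decide) (by decide) (by decide) (by decide)
    refine ⟨by omega, Exec.block ?_⟩
    refine ⟨?_, ?_, ⟨?_, ?_, ?_, ?_⟩, ?_, ?_⟩ <;>
      simp only [List.foldl, Instr.run, Function.update_apply, if_true]
    · intro n
      have hv : s'.cmem 2 = s.cmem 2 := g2 2 (by omega)
      simp only [g5, g6, g3, g1, hv]
      by_cases h1 : n = s.ireg 26 + i
      · subst h1
        rw [if_pos rfl, if_neg (by omega), if_pos (by omega)]
        congr 1; omega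
      · rw [if_neg h1]
        by_cases h2 : n = s.ireg 25 + i
        · subst h2
          rw [if_pos rfl, if_pos (by omega)]
          congr 1; omega
        · rw [if_neg h2]
          have c1 : (s.ireg 25 ≤ n ∧ n < s.ireg 25 + (i + 1)) ↔
            (s.ireg 25 ≤ n ∧ n < s.ireg 25 + i) := by omega
          have c2 : (s.ireg 26 ≤ n ∧ n < s.ireg 26 + (i + 1)) ↔
            (s.ireg 26 ≤ n ∧ n < s.ireg 26 + i) := by omega
          simp only [c1, c2]
    · intro a ha
      simp [ha, g2]
    · simp [g3, e4, h4, add_assoc]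
    · simp [g4, e4, h4]
    · simp [g5, e4, h4, add_assoc]
    · simp [g6, e4, h4, add_assoc]
    · intro x h1 h2 h3 h4
      simp [h1, h2, h3, h4, g7]
    · intro x hx
      grind
  · rintro s' ⟨g1, g2, ⟨g3, g4, g5, g6⟩, g7, g8⟩
    have e0 := g7 0 (by decide) (by decide) (by decide) (by decide)
    exact ⟨by omega, g1, g2, g3, g7, g8⟩

/-- Loads the next gate into the array `A`: the matrix of its Heisenberg action on the letters, with
rows of length given by register `20`, and one more column, the multiple of the column of the letter
`p̂_1` by the complex register `4`. -/
def loadProg (A : ℕ) : Program :=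
  .seq (block (.cconst 1 1) [.cstore A 3 1, .iadd 21 20 3, .iadd 22 20 3, .iconst 23 0])
    (.seq (.whileLt 23 0 (block (.iadd 22 22 20) [.iadd 23 23 4]))
      (.seq (block (.iconst 23 0) [])
        (.whileLt 23 0
          (.seq (block (.cload 1 3 13) [.cstore A 21 1, .cload 1 4 13, .cstore A 22 1,
              .iadd 13 13 4, .cload 1 2 12, .cmul 1 1 4, .iadd 25 22 5, .cstore A 25 1,
              .iadd 25 21 4, .iadd 26 22 4, .iadd 26 26 0, .iconst 24 0])
            (.seq (copyProg A) (block (.iadd 21 21 20) [.iadd 22 22 20, .iadd 23 23 4]))))))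

/-- The entries written by `loadProg` for the gate whose data start at the positions `p` (matrix)
and `q` (displacements) of the input arrays. -/
def loadEntry (s : State) (m p q r x : ℕ) : ℂ :=
  if r = 0 then 1
  else if r ≤ m then
    if x = 0 then s.cmem 3 (q + (r - 1)) else s.cmem 2 (p + (r - 1) * m + (x - 1))
  else if x = 0 then s.cmem 4 (q + (r - 1 - m))
  else if x = 2 * m + 1 then s.cmem 2 (p + (r - 1 - m) * m) * s.creg 4
  else s.cmem 2 (p + (r - 1 - m) * m + (x - 1 - m))

/-- The entries that have been written by `loadProg` after `i` passes of its main loop. -/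
def loadDone (m i r x : ℕ) : Prop :=
  r = 0 ∧ x = 0 ∨ 1 ≤ r ∧ r ≤ i ∧ x ≤ m ∨
    m < r ∧ r ≤ m + i ∧ (x = 0 ∨ m < x ∧ x ≤ 2 * m + 1)

instance (m i r x : ℕ) : Decidable (loadDone m i r x) := by
  unfold loadDone; infer_instance

/-- The effect of `loadProg`. -/
structure LoadResult (s s' : State) (A m l : ℕ) : Prop where
  matrix : s'.ireg 12 = s.ireg 12 + m * m
  disp : s'.ireg 13 = s.ireg 13 + m
  ireg : ∀ x, x < 20 → x ≠ 12 → x ≠ 13 → s'.ireg x = s.ireg x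
  creg : ∀ x, 4 ≤ x → s'.creg x = s.creg x
  other : ∀ a, a ≠ A → s'.cmem a = s.cmem a
  cell : ∀ r x, x < l → s'.cmem A (r * l + x) =
    if loadDone m m r x then loadEntry s m (s.ireg 12) (s.ireg 13) r x else s.cmem A (r * l + x)

theorem interval_cell {r r' x l a b : ℕ} (hx : x < l) (hb : b ≤ l) :
    (r' * l + a ≤ r * l + x ∧ r * l + x < r' * l + b) ↔ r = r' ∧ a ≤ x ∧ x < b := by
  rcases lt_trichotomy r r' with h | rfl | h
  · have : (r + 1) * l ≤ r' * l := Nat.mul_le_mul_right _ h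
    rw [add_mul] at this
    omega
  · omega
  · have : (r' + 1) * l ≤ r * l := Nat.mul_le_mul_right _ h
    rw [add_mul] at this
    omega

-- The zeros of the matrix are never written; they come from arrays that are blank at the start, and
-- every load into an array writes the same cells. The row length `l` is a parameter because the
-- first gate is loaded with rows of length `B²`, directly as a table of coefficients, and the later
-- ones with rows of length `B + 1`.
set_option maxHeartbeats 1000000 in
theorem exec_loadProg {A m l : ℕ} (hA : 4 < A) (hm : 0 < m) (s : State) (h0 : s.ireg 0 = m)
    (h3 : s.ireg 3 = 0) (h4 : s.ireg 4 = 1) (h5 : s.ireg 5 = 2 * m + 1) (h20 : s.ireg 20 = l)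
    (hl : 2 * m + 1 < l) :
    Exec (loadProg A) s (m * (m * 8 + 18) + m * 3 + 8) fun s' => LoadResult s s' A m l := by
  refine ((Exec.block (Q := fun s' =>
      (∀ n, s'.cmem A n = if n = 0 then 1 else s.cmem A n) ∧ (∀ a, a ≠ A → s'.cmem a = s.cmem a) ∧
      (s'.ireg 21 = l ∧ s'.ireg 22 = l ∧ s'.ireg 23 = 0) ∧
      (∀ x, x ≤ 20 → s'.ireg x = s.ireg x) ∧ ∀ x, 4 ≤ x → s'.creg x = s.creg x) ?_).seq
    fun s1 h1 => (Exec.whileLt (T := 2) m (Q := fun s' =>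
      (∀ n, s'.cmem A n = if n = 0 then 1 else s.cmem A n) ∧ (∀ a, a ≠ A → s'.cmem a = s.cmem a) ∧
      (s'.ireg 21 = l ∧ s'.ireg 22 = (1 + m) * l) ∧
      (∀ x, x ≤ 20 → s'.ireg x = s.ireg x) ∧ ∀ x, 4 ≤ x → s'.creg x = s.creg x) (fun i s' =>
      (∀ n, s'.cmem A n = if n = 0 then 1 else s.cmem A n) ∧ (∀ a, a ≠ A → s'.cmem a = s.cmem a) ∧
      (s'.ireg 21 = l ∧ s'.ireg 22 = (1 + i) * l ∧ s'.ireg 23 = i) ∧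
      (∀ x, x ≤ 20 → s'.ireg x = s.ireg x) ∧ ∀ x, 4 ≤ x → s'.creg x = s.creg x) ?_ ?_ ?_).seq
    fun s2 h2 => (Exec.block (Q := fun s' =>
      (∀ n, s'.cmem A n = if n = 0 then 1 else s.cmem A n) ∧ (∀ a, a ≠ A → s'.cmem a = s.cmem a) ∧
      (s'.ireg 21 = l ∧ s'.ireg 22 = (1 + m) * l ∧ s'.ireg 23 = 0) ∧
      (∀ x, x ≤ 20 → s'.ireg x = s.ireg x) ∧ ∀ x, 4 ≤ x → s'.creg x = s.creg x) ?_).seq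
    fun s3 h3' => Exec.whileLt (T := m * 8 + 17) m (fun i s' =>
      (∀ r x, x < l → s'.cmem A (r * l + x) =
        if loadDone m i r x then loadEntry s m (s.ireg 12) (s.ireg 13) r x
        else s.cmem A (r * l + x)) ∧
      (∀ a, a ≠ A → s'.cmem a = s.cmem a) ∧
      (s'.ireg 21 = (1 + i) * l ∧ s'.ireg 22 = (1 + m + i) * l ∧ s'.ireg 23 = i ∧
        s'.ireg 12 = s.ireg 12 + i * m ∧ s'.ireg 13 = s.ireg 13 + i) ∧
      (∀ x, x ≤ 20 → x ≠ 12 → x ≠ 13 → s'.ireg x = s.ireg x) ∧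
      ∀ x, 4 ≤ x → s'.creg x = s.creg x) ?_ ?_ ?_).mono ?_ fun _ => id
  · refine ⟨?_, ?_, ⟨?_, ?_, ?_⟩, ?_, ?_⟩ <;>
      simp only [List.foldl, Instr.run, Function.update_apply, if_true]
    · intro n
      simp [h3]
    · intro a ha
      simp [ha]
    · simp [h20, h3]
    · simp [h20, h3]
    · intro x hx
      simp [show x ≠ 21 by omega, show x ≠ 22 by omega, show x ≠ 23 by omega]
    · intro x hx
      simp [show x ≠ 1 by omega]
  · obtain ⟨k1, k2, ⟨k3, k4, k5⟩, k6, k7⟩ := h1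
    exact ⟨k1, k2, ⟨k3, by omega, k5⟩, k6, k7⟩
  · rintro i s' hi ⟨k1, k2, ⟨k3, k4, k5⟩, k6, k7⟩
    have e0 := k6 0 (by decide)
    have e4 := k6 4 (by decide)
    have e20 := k6 20 (by decide)
    refine ⟨by omega, Exec.block ?_⟩
    refine ⟨k1, k2, ⟨?_, ?_, ?_⟩, ?_, k7⟩ <;>
      simp only [List.foldl, Instr.run, Function.update_apply, if_true]
    · simp [k3]
    · simp [k4, e20, h20]; ring
    · simp [k5, e4, h4]
    · intro x hx
      simp [show x ≠ 22 by omega, show x ≠ 23 by omega, k6 x hx]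
  · rintro s' ⟨k1, k2, ⟨k3, k4, k5⟩, k6, k7⟩
    have e0 := k6 0 (by decide)
    exact ⟨by omega, k1, k2, ⟨k3, k4⟩, k6, k7⟩
  · obtain ⟨k1, k2, ⟨k3, k4⟩, k6, k7⟩ := h2
    refine ⟨k1, k2, ⟨?_, ?_, ?_⟩, ?_, k7⟩ <;>
      simp only [List.foldl, Instr.run, Function.update_apply, if_true]
    · simp [k3]
    · simp [k4]
    · intro x hx
      simp [show x ≠ 23 by omega, k6 x hx]
  · obtain ⟨k1, k2, ⟨k3, k4, k5⟩, k6, k7⟩ := h3'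
    refine ⟨?_, k2, ⟨by omega, by simpa using k4, k5, ?_, ?_⟩, fun x hx _ _ => k6 x hx, k7⟩
    · intro r x hx
      have c1 : r * l + x = 0 ↔ r = 0 ∧ x = 0 := by
        simpa using cell_inj (r := r) (r' := 0) hx (by omega : 0 < l)
      have c2 : loadDone m 0 r x ↔ r = 0 ∧ x = 0 := by unfold loadDone; omega
      simp only [k1, c1, c2, loadEntry]
      split_ifs <;> simp_all
    · simpa using k6 12 (by decide)
    · simpa using k6 13 (by decide)
  · rintro i s4 hi ⟨g1, g2, ⟨g3, g4, g5, g6, g7⟩, g8, g9⟩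
    have e0 := g8 0 (by decide) (by decide) (by decide)
    have e3 := g8 3 (by decide) (by decide) (by decide)
    have e4 := g8 4 (by decide) (by decide) (by decide)
    have e5 := g8 5 (by decide) (by decide) (by decide)
    have e20 := g8 20 (by decide) (by decide) (by decide)
    refine ⟨by omega, ?_⟩
    have hbase : (1 + i) * l + l ≤ (1 + m + i) * l := by
      have : (1 + i + 1) * l ≤ (1 + m + i) * l := Nat.mul_le_mul_right _ (by omega)
      rw [add_mul (1 + i)] at this
      omega
    -- Halfway through a pass: the two displacements and the entry in the additional column are in
    -- place, and the matrix row is still to be copied.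
    refine ((Exec.block (Q := fun s' =>
      (∀ r x, x < l → s'.cmem A (r * l + x) =
        if loadDone m i r x ∨ (r = 1 + i ∧ x = 0) ∨ (r = 1 + m + i ∧ (x = 0 ∨ x = 2 * m + 1))
        then loadEntry s m (s.ireg 12) (s.ireg 13) r x
        else s.cmem A (r * l + x)) ∧
      (∀ a, a ≠ A → s'.cmem a = s.cmem a) ∧
      (s'.ireg 21 = (1 + i) * l ∧ s'.ireg 22 = (1 + m + i) * l ∧ s'.ireg 23 = i ∧
        s'.ireg 12 = s.ireg 12 + i * m ∧ s'.ireg 13 = s.ireg 13 + (i + 1) ∧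
        s'.ireg 24 = 0 ∧ s'.ireg 25 = (1 + i) * l + 1 ∧
        s'.ireg 26 = (1 + m + i) * l + (1 + m)) ∧
      (∀ x, x ≤ 20 → x ≠ 12 → x ≠ 13 → s'.ireg x = s.ireg x) ∧
      ∀ x, 4 ≤ x → s'.creg x = s.creg x) ?_).seq fun s5 h5' =>
      ((exec_copyProg (A := A) (by omega) s5 ?_ ?_ ?_).mono (T' := m * 8 + 1) ?_
        fun _ => id).seq fun s6 h6 => Exec.block ?_).mono ?_ fun _ => id
    · have a2 : s4.cmem 2 = s.cmem 2 := g2 2 (by omega)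
      have a3 : s4.cmem 3 = s.cmem 3 := g2 3 (by omega)
      have a4 : s4.cmem 4 = s.cmem 4 := g2 4 (by omega)
      refine ⟨?_, ?_, ⟨?_, ?_, ?_, ?_, ?_, ?_, ?_, ?_⟩, ?_, ?_⟩ <;>
        simp only [List.foldl, Instr.run, Function.update_apply, if_true]
      · intro r x hx
        have n2 : (2 : ℕ) ≠ A := by omega
        have n4 : (4 : ℕ) ≠ A := by omega
        have d1 : r * l + x = (1 + i) * l ↔ r = 1 + i ∧ x = 0 := by
          simpa using cell_inj (r := r) (r' := 1 + i) hx (by omega : 0 < l)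
        have d2 : r * l + x = (1 + m + i) * l ↔ r = 1 + m + i ∧ x = 0 := by
          simpa using cell_inj (r := r) (r' := 1 + m + i) hx (by omega : 0 < l)
        have d3 : r * l + x = (1 + m + i) * l + (2 * m + 1) ↔ r = 1 + m + i ∧ x = 2 * m + 1 :=
          cell_inj hx hl
        simp only [n2, n4, Nat.reduceEqDiff, if_false,
          g3, g4, g6, g7, e5, h5, d1, d2, d3, a2, a3, a4, g1 r x hx, g9 4 le_rfl, loadEntry]
        by_cases c3 : r = 1 + m + i ∧ x = 2 * m + 1
        · obtain ⟨rfl, rfl⟩ := c3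
          rw [if_pos ⟨rfl, rfl⟩, if_pos (by omega), if_neg (by omega), if_neg (by omega),
            if_neg (by omega), if_pos rfl]
          congr 3
          rw [show 1 + m + i - 1 - m = i by omega]
        · rw [if_neg c3]
          by_cases c2 : r = 1 + m + i ∧ x = 0
          · obtain ⟨rfl, rfl⟩ := c2
            rw [if_pos ⟨rfl, rfl⟩, if_pos (by omega), if_neg (by omega), if_neg (by omega),
              if_pos rfl]
            congr 1; omega
          · rw [if_neg c2]
            by_cases c1 : r = 1 + i ∧ x = 0
            · obtain ⟨rfl, rfl⟩ := c1
              rw [if_pos ⟨rfl, rfl⟩, if_pos (by omega), if_neg (by omega), if_pos (by omega),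
                if_pos rfl]
              congr 1; omega
            · rw [if_neg c1]
              have c : (loadDone m i r x ∨ (r = 1 + i ∧ x = 0) ∨
                (r = 1 + m + i ∧ (x = 0 ∨ x = 2 * m + 1))) ↔ loadDone m i r x := by
                constructor
                · rintro (h | h | h)
                  · exact h
                  · exact absurd h c1
                  · omega
                · exact Or.inl
              simp only [c]
      · intro a ha
        simp [ha, g2]
      · simp [g3]
      · simp [g4]
      · simp [g5]
      · simp [g6]
      · simp [g7, e4, h4, add_assoc]
      · simp [g3, e4, h4]
      · simp [g4, e4, h4, e0, h0, add_assoc]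
      · intro x hx h1 h2
        have b1 : x ≠ 24 := by omega
        have b2 : x ≠ 25 := by omega
        have b3 : x ≠ 26 := by omega
        simp [h2, b1, b2, b3, g8 x hx h1 h2]
      · intro x hx
        simp [show x ≠ 1 by omega, g9 x hx]
    · rw [h5'.2.2.2.1 4 (by decide) (by decide) (by decide), h4]
    · exact h5'.2.2.1.2.2.2.2.2.1
    · rw [h5'.2.2.2.1 0 (by decide) (by decide) (by decide), h0, h5'.2.2.1.2.2.2.2.2.2.1,
        h5'.2.2.1.2.2.2.2.2.2.2]
      omega
    · rw [h5'.2.2.2.1 0 (by decide) (by decide) (by decide), h0]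
    · obtain ⟨k1, k2, ⟨k3, k4, k5, k6, k7, k8, k9, k10⟩, k11, k12⟩ := h5'
      obtain ⟨l1, l2, l3, l4, l5⟩ := h6
      have b0 : s5.ireg 0 = m := by rw [k11 0 (by decide) (by decide) (by decide), h0]
      have hr4 : s6.ireg 4 = 1 := by
        rw [l4 4 (by decide) (by decide) (by decide) (by decide),
          k11 4 (by decide) (by decide) (by decide), h4]
      have hr20 : s6.ireg 20 = l := by
        rw [l4 20 (by decide) (by decide) (by decide) (by decide),
          k11 20 (by decide) (by decide) (by decide), h20]
      have hr21 : s6.ireg 21 = (1 + i) * l := by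
        rw [l4 21 (by decide) (by decide) (by decide) (by decide), k3]
      have hr22 : s6.ireg 22 = (1 + m + i) * l := by
        rw [l4 22 (by decide) (by decide) (by decide) (by decide), k4]
      have hr23 : s6.ireg 23 = i := by
        rw [l4 23 (by decide) (by decide) (by decide) (by decide), k5]
      have hr13 : s6.ireg 13 = s.ireg 13 + (i + 1) := by
        rw [l4 13 (by decide) (by decide) (by decide) (by decide), k7]
      refine ⟨?_, ?_, ⟨?_, ?_, ?_, ?_, ?_⟩, ?_, ?_⟩ <;>
        simp only [List.foldl, Instr.run, Function.update_apply, if_true]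
      · intro r x hx
        have d1 : ((1 + i) * l + 1 ≤ r * l + x ∧ r * l + x < (1 + i) * l + 1 + m) ↔
            r = 1 + i ∧ 1 ≤ x ∧ x < 1 + m := by
          rw [add_assoc ((1 + i) * l)]; exact interval_cell hx (by omega)
        have d2 : ((1 + m + i) * l + (1 + m) ≤ r * l + x ∧
            r * l + x < (1 + m + i) * l + (1 + m) + m) ↔
            r = 1 + m + i ∧ 1 + m ≤ x ∧ x < 1 + m + m := by
          rw [add_assoc ((1 + m + i) * l)]; exact interval_cell hx (by omega)
        have a2 : s5.cmem 2 = s.cmem 2 := k2 2 (by omega)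
        rw [l1, b0, k9, k10, k6, a2]
        simp only [d1, d2, k1 r x hx]
        by_cases c1 : r = 1 + i ∧ 1 ≤ x ∧ x < 1 + m
        · obtain ⟨rfl, c1, c1'⟩ := c1
          have hd : loadDone m (i + 1) (1 + i) x := by unfold loadDone; omega
          rw [if_pos ⟨rfl, c1, c1'⟩, if_pos hd, loadEntry, if_neg (by omega), if_pos (by omega),
            if_neg (by omega)]
          congr 1
          rw [show 1 + i - 1 = i by omega]
          omega
        · rw [if_neg c1]
          by_cases c2 : r = 1 + m + i ∧ 1 + m ≤ x ∧ x < 1 + m + m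
          · obtain ⟨rfl, c2, c2'⟩ := c2
            have hd : loadDone m (i + 1) (1 + m + i) x := by unfold loadDone; omega
            rw [if_pos ⟨rfl, c2, c2'⟩, if_pos hd, loadEntry, if_neg (by omega), if_neg (by omega),
              if_neg (by omega), if_neg (by omega)]
            congr 1
            rw [show 1 + m + i - 1 - m = i by omega]
            omega
          · rw [if_neg c2]
            have c : (loadDone m i r x ∨ (r = 1 + i ∧ x = 0) ∨
              (r = 1 + m + i ∧ (x = 0 ∨ x = 2 * m + 1))) ↔ loadDone m (i + 1) r x := by
              unfold loadDone; omega
            simp only [c]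
      · intro a ha
        rw [l2 a ha, k2 a ha]
      · simp [hr21, hr20]; ring
      · simp [hr22, hr20]; ring
      · simp [hr23, hr4]
      · simp [l3, k6, b0]; ring
      · simp [hr13]
      · intro x hx h1 h2
        have b1 : x ≠ 21 := by omega
        have b2 : x ≠ 22 := by omega
        have b3 : x ≠ 23 := by omega
        simp [b1, b2, b3, l4 x h1 (by omega) (by omega) (by omega), k11 x hx h1 h2]
      · intro x hx
        rw [l5 x hx, k12 x hx]
    · simp only [List.length]; omega
  · rintro s' ⟨g1, g2, ⟨g3, g4, g5, g6, g7⟩, g8, g9⟩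
    have e0 := g8 0 (by decide) (by decide) (by decide)
    exact ⟨by omega, g6, g7, fun x hx => g8 x (by omega), g9, g2, g1⟩
  · simp only [List.length]
    exact le_of_eq (by ring)

/-! ### Codes of letters and words -/

theorem Letter.sum_range_code {E : Type*} [AddCommMonoid E] (F : ℕ → E) :
    ∑ n ∈ Finset.range (2 * m + 1), F n = ∑ a : Letter m, F a.code := by
  rw [Letter.sum_eq, show 2 * m + 1 = 1 + (m + m) by ring, Finset.sum_range_add,
    Finset.sum_range_add, Finset.sum_range_one, Finset.sum_range, Finset.sum_range]
  simp [Letter.code, add_assoc]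

theorem sum_range_mul_eq {E : Type*} [AddCommMonoid E] (F : ℕ → E) (n k : ℕ) :
    ∑ x ∈ Finset.range (n * k), F x =
      ∑ i ∈ Finset.range n, ∑ j ∈ Finset.range k, F (i * k + j) := by
  induction n with
  | zero => simp
  | succ n ih => rw [Nat.succ_mul, Finset.sum_range_add, ih, Finset.sum_range_succ]

theorem Letter.sum_range_code_pair {E : Type*} [AddCommMonoid E] (F : ℕ → E) :
    ∑ x ∈ Finset.range ((2 * m + 1) * (2 * m + 1)), F x =
      ∑ b : Letter m, ∑ c : Letter m, F (c.code * (2 * m + 1) + b.code) := by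
  rw [sum_range_mul_eq, Letter.sum_range_code, Finset.sum_comm]
  exact Letter.sum_range_code fun n => ∑ c : Letter m, F (c.code * (2 * m + 1) + n)

/-- The position of a word in a table of words. -/
def listCode : List (Letter m) → ℕ
  | [] => 0
  | a :: w => a.code + (2 * m + 1) * listCode w

theorem listCode_ofFn {n : ℕ} (w : Fin n → Letter m) : listCode (List.ofFn w) = wordCode w := by
  induction n with
  | zero => simp [listCode, wordCode]
  | succ n ih =>
    rw [List.ofFn_succ, listCode, ih, wordCode, wordCode, Fin.sum_univ_succ, Finset.mul_sum]
    simp only [Fin.val_zero, pow_zero, mul_one, Fin.val_succ, pow_succ]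
    congr 1
    exact Finset.sum_congr rfl fun k _ => by ring

theorem listCode_append (w w' : List (Letter m)) :
    listCode (w ++ w') = listCode w + (2 * m + 1) ^ w.length * listCode w' := by
  induction w with
  | nil => simp [listCode]
  | cons a w ih =>
    rw [List.cons_append, listCode, listCode, ih, List.length_cons, pow_succ]
    ring

theorem listCode_lt (w : List (Letter m)) : listCode w < (2 * m + 1) ^ w.length := by
  induction w with
  | nil => simp [listCode]
  | cons a w ih =>
    rw [listCode, List.length_cons, pow_succ]
    have h := a.code_lt
    have : (2 * m + 1) * (listCode w + 1) ≤ (2 * m + 1) * (2 * m + 1) ^ w.length :=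
      Nat.mul_le_mul_left _ ih
    rw [mul_comm ((2 * m + 1) ^ w.length)]
    linarith

/-- Expansion in base `2m + 1`: splitting off the least significant digit corresponds to `Fin.cons`.
-/
theorem sum_range_wordCode {E : Type*} [AddCommMonoid E] (d : ℕ) (F : ℕ → E) :
    ∑ n ∈ Finset.range ((2 * m + 1) ^ d), F n = ∑ w : Fin d → Letter m, F (wordCode w) := by
  induction d generalizing F with
  | zero => simp [wordCode]
  | succ d ih =>
    rw [pow_succ, sum_range_mul_eq,
      ih (F := fun i => ∑ j ∈ Finset.range (2 * m + 1), F (i * (2 * m + 1) + j)),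
      ← (Fin.consEquiv fun _ : Fin (d + 1) => Letter m).sum_comp fun w => F (wordCode w),
      Fintype.sum_prod_type_right]
    refine Finset.sum_congr rfl fun w _ => ?_
    rw [Letter.sum_range_code (F := fun j => F (wordCode w * (2 * m + 1) + j))]
    refine Finset.sum_congr rfl fun a _ => ?_
    rw [← listCode_ofFn, ← listCode_ofFn]
    simp only [Fin.consEquiv, Equiv.coe_fn_mk, List.ofFn_succ, listCode, Fin.cons_zero,
      Fin.cons_succ]
    congr 1
    ring

theorem Letter.code_pair_lt (b c : Letter m) :
    c.code * (2 * m + 1) + b.code < (2 * m + 1) * (2 * m + 1) := by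
  have h := b.code_lt
  have : (c.code + 1) * (2 * m + 1) ≤ (2 * m + 1) * (2 * m + 1) :=
    Nat.mul_le_mul_right _ c.code_lt
  linarith

/-- The last letter of a word may be substituted first. -/
theorem substitute_concat {E : Type*} [AddCommGroup E] [Module ℂ E]
    (S : Letter m → Letter m → Letter m → ℂ) (w : List (Letter m)) (a : Letter m)
    (X : List (Letter m) → E) :
    substitute S (w ++ [a]) X =
      ∑ b, ∑ c, S a b c • substitute S w fun u => X (u ++ [b, c]) := by
  induction w generalizing X with
  | nil => rfl
  | cons a' w ih =>
    simp only [List.cons_append, substitute, ih, Finset.smul_sum]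
    simp_rw [fun b c => Finset.sum_comm (s := Finset.univ) (t := Finset.univ)
      (f := fun (b' : Letter m) (c' : Letter m) =>
        S a' b c • S a b' c' • substitute S w fun u => X (b :: c :: (u ++ [b', c'])))]
    have : ∀ f : Letter m → Letter m → Letter m → Letter m → E,
        ∑ b, ∑ c, ∑ c', ∑ b', f b c b' c' = ∑ b', ∑ c', ∑ b, ∑ c, f b c b' c' := by
      intro f
      calc _ = ∑ b, ∑ c', ∑ c, ∑ b', f b c b' c' :=
            Finset.sum_congr rfl fun b _ => Finset.sum_comm
        _ = ∑ c', ∑ b, ∑ c, ∑ b', f b c b' c' := Finset.sum_comm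
        _ = ∑ c', ∑ b, ∑ b', ∑ c, f b c b' c' :=
            Finset.sum_congr rfl fun c' _ => Finset.sum_congr rfl fun b _ => Finset.sum_comm
        _ = ∑ c', ∑ b', ∑ b, ∑ c, f b c b' c' :=
            Finset.sum_congr rfl fun c' _ => Finset.sum_comm
        _ = _ := Finset.sum_comm
    rw [this]
    refine Finset.sum_congr rfl fun b' _ => Finset.sum_congr rfl fun c' _ =>
      Finset.sum_congr rfl fun b _ => Finset.sum_congr rfl fun c _ => ?_
    rw [smul_comm]

/-! ### Loaded gates -/

theorem Letter.code_one : (Letter.one : Letter m).code = 0 := rfl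

theorem Letter.code_pos (i : Fin m) : (Letter.pos i).code = 1 + i := rfl

theorem Letter.code_mom (i : Fin m) : (Letter.mom i).code = 1 + m + i := rfl

/-- Among the columns of the letters, the cells skipped by the load are exactly the pairs in the
catch-all clause of `affine`. -/
theorem loadEntry_affine [NeZero m] (s : State) (g : DispOrth m) (p q : ℕ)
    (hR : ∀ i j : Fin m, s.cmem 2 (p + i * m + j) = g.entry i j)
    (hu : ∀ i : Fin m, s.cmem 3 (q + i) = g.u i) (hv : ∀ i : Fin m, s.cmem 4 (q + i) = g.v i)
    (a c : Letter m) :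
    (if loadDone m m a.code c.code then loadEntry s m p q a.code c.code else 0) =
      affine g a c := by
  have hm := Nat.pos_of_ne_zero (NeZero.ne m)
  cases a with
  | one =>
    cases c with
    | one =>
      rw [Letter.code_one]
      simp [loadDone, loadEntry, affine]
    | pos j =>
      rw [Letter.code_one, Letter.code_pos]
      rw [if_neg (by unfold loadDone; omega)]
      rfl
    | mom j =>
      rw [Letter.code_one, Letter.code_mom]
      rw [if_neg (by unfold loadDone; omega)]
      rfl
  | pos i =>
    have hi := i.2
    cases c with
    | one =>
      rw [Letter.code_pos, Letter.code_one]
      rw [if_pos (by unfold loadDone; omega)]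
      simp only [loadEntry, affine]
      rw [if_neg (by omega), if_pos (by omega), if_pos trivial, ← hu]
      congr 1; omega
    | pos j =>
      rw [Letter.code_pos, Letter.code_pos]
      have hj := j.2
      rw [if_pos (by unfold loadDone; omega)]
      simp only [loadEntry, affine]
      rw [if_neg (by omega), if_pos (by omega), if_neg (by omega), ← hR,
        show 1 + (i : ℕ) - 1 = i by omega]
      congr 1; omega
    | mom j =>
      rw [Letter.code_pos, Letter.code_mom]
      rw [if_neg (by unfold loadDone; omega)]
      rfl
  | mom i =>
    have hi := i.2
    cases c with
    | one =>
      rw [Letter.code_mom, Letter.code_one]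
      rw [if_pos (by unfold loadDone; omega)]
      simp only [loadEntry, affine]
      rw [if_neg (by omega), if_neg (by omega), if_pos trivial, ← hv]
      congr 1; omega
    | pos j =>
      rw [Letter.code_mom, Letter.code_pos]
      have hj := j.2
      rw [if_neg (by unfold loadDone; omega)]
      rfl
    | mom j =>
      rw [Letter.code_mom, Letter.code_mom]
      have hj := j.2
      rw [if_pos (by unfold loadDone; omega)]
      simp only [loadEntry, affine]
      rw [if_neg (by omega), if_neg (by omega), if_neg (by omega), if_neg (by omega), ← hR,
        show 1 + m + (i : ℕ) - 1 - m = i by omega]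
      congr 1; omega

/-- The additional column will meet the appended row of coefficients of `q̂_1²`; with `6γ` in the
complex register `4` this yields the quadratic term of `heisenberg`. -/
theorem loadEntry_last [NeZero m] (s : State) (g : DispOrth m) (p q : ℕ)
    (hR : ∀ i j : Fin m, s.cmem 2 (p + i * m + j) = g.entry i j) (a : Letter m) :
    (if loadDone m m a.code (2 * m + 1) then loadEntry s m p q a.code (2 * m + 1) else 0) =
      affine g a (.mom 0) * s.creg 4 := by
  have hm := Nat.pos_of_ne_zero (NeZero.ne m)
  cases a with
  | one =>
    rw [Letter.code_one]
    rw [if_neg (by unfold loadDone; omega)]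
    simp [affine]
  | pos i =>
    rw [Letter.code_pos]
    have hi := i.2
    rw [if_neg (by unfold loadDone; omega)]
    simp [affine]
  | mom i =>
    rw [Letter.code_mom]
    have hi := i.2
    rw [if_pos (by unfold loadDone; omega)]
    simp only [loadEntry, affine]
    rw [if_neg (by omega), if_neg (by omega), if_neg (by omega), if_pos trivial, ← hR,
      show 1 + m + (i : ℕ) - 1 - m = i by omega]
    simp

/-! ### The main program -/

/-- The contents of the registers and arrays that the main program does not change. -/
structure Env (m t d : ℕ) (s0 s : State) : Prop where
  modes : s.ireg 0 = m
  layers : s.ireg 1 = t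
  degree : s.ireg 2 = d
  zero : s.ireg 3 = 0
  one : s.ireg 4 = 1
  letters : s.ireg 5 = 2 * m + 1
  pairs : s.ireg 6 = (2 * m + 1) * (2 * m + 1)
  width : s.ireg 7 = 2 * m + 1 + 1
  triples : s.ireg 15 = (2 * m + 1) * (2 * m + 1) * (2 * m + 1)
  six : s.creg 6 = 6
  input : ∀ a, 1 ≤ a → a ≤ 5 → s.cmem a = s0.cmem a

theorem Env.of_eq {t d : ℕ} {s0 s s' : State} (h : Env m t d s0 s)
    (hi : ∀ x, x < 8 ∨ x = 15 → s'.ireg x = s.ireg x) (hc : s'.creg 6 = s.creg 6)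
    (hm : ∀ a, 1 ≤ a → a ≤ 5 → s'.cmem a = s.cmem a) : Env m t d s0 s' where
  modes := (hi _ (by decide)).trans h.modes
  layers := (hi _ (by decide)).trans h.layers
  degree := (hi _ (by decide)).trans h.degree
  zero := (hi _ (by decide)).trans h.zero
  one := (hi _ (by decide)).trans h.one
  letters := (hi _ (by decide)).trans h.letters
  pairs := (hi _ (by decide)).trans h.pairs
  width := (hi _ (by decide)).trans h.width
  triples := (hi _ (by decide)).trans h.triples
  six := hc.trans h.six
  input a h1 h2 := (hm a h1 h2).trans (h.input a h1 h2)

/-- The array `6` holds the coefficients `S` from the position `base` on. -/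
def TableAt (s : State) (base : ℕ) (S : Letter m → Letter m → Letter m → ℂ) : Prop :=
  ∀ a b c, s.cmem 6 (base + a.code * ((2 * m + 1) * (2 * m + 1)) +
    (c.code * (2 * m + 1) + b.code)) = S a b c

/-- The input arrays hold the data of gates numbered by all natural numbers. -/
structure GateData (t : ℕ) (g : ℕ → DispOrth m) (γ : ℕ → ℝ) (s0 : State) : Prop where
  matrices : ∀ k, k ≤ t → ∀ i j : Fin m, s0.cmem 2 ((k * m + i) * m + j) = (g k).entry i j
  dispPos : ∀ k, k ≤ t → ∀ i : Fin m, s0.cmem 3 (k * m + i) = (g k).u i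
  dispMom : ∀ k, k ≤ t → ∀ i : Fin m, s0.cmem 4 (k * m + i) = (g k).v i
  cubicities : ∀ k, k < t → s0.cmem 5 k = γ k

/-- The state after `i` layers of the circuit have been processed. -/
structure LayerInv [NeZero m] (t d : ℕ) (g : ℕ → DispOrth m) (γ : ℕ → ℝ) (s0 : State) (i : ℕ)
    (s : State) : Prop where
  env : Env m t d s0 s
  counter : s.ireg 11 = i
  matrix : s.ireg 12 = (i + 1) * (m * m)
  disp : s.ireg 13 = (i + 1) * m
  moments : s.cmem 0 = s0.cmem 0
  table : TableAt s (s.ireg 8) (heisenberg i (fun k : Fin (i + 1) => g k) fun k : Fin i => γ k)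
  blank : ∀ r x, x < 2 * m + 1 + 1 → ¬ loadDone m m r x → s.cmem 7 (r * (2 * m + 1 + 1) + x) = 0

/-! ### Sizes of the tables and the first gate -/

/-- Computes the sizes of the tables. -/
def sizesProg : Program :=
  .seq (mulProg 5 5) (.seq (block (.iadd 6 21 3) [])
    (.seq (mulProg 6 5) (block (.iadd 15 21 3) [])))

theorem exec_sizesProg (s : State) (h3 : s.ireg 3 = 0) (h4 : s.ireg 4 = 1) :
    Exec sizesProg s (6 * s.ireg 5 + 8) fun s' =>
      (∀ x, x < 20 → x ≠ 6 → x ≠ 15 → s'.ireg x = s.ireg x) ∧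
      s'.ireg 6 = s.ireg 5 * s.ireg 5 ∧ s'.ireg 15 = s.ireg 5 * s.ireg 5 * s.ireg 5 ∧
      (∀ x, 4 ≤ x → s'.creg x = s.creg x) ∧ s'.cmem = s.cmem := by
  refine ((exec_mulProg (by decide) (by decide) s h4).seq fun s1 h1 =>
    (Exec.block (Q := fun s' => (∀ x, x < 20 → x ≠ 6 → s'.ireg x = s.ireg x) ∧
      s'.ireg 6 = s.ireg 5 * s.ireg 5 ∧ (∀ x, 4 ≤ x → s'.creg x = s.creg x) ∧
      s'.cmem = s.cmem) ?_).seq fun s2 h2 =>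
    ((exec_mulProg (x := 6) (y := 5) (by decide) (by decide) s2 ?_).mono
      (T' := 3 * s.ireg 5 + 3) ?_ fun _ => id).seq fun s3 h3' => Exec.block ?_).mono ?_ fun _ => id
  · obtain ⟨⟨f1, f2⟩, k1, k2⟩ := h1
    refine ⟨?_, ?_, f2, k2⟩ <;> simp only [List.foldl, Instr.run, Function.update_apply]
    · intro x hx hx'
      simp [hx', f1 x hx]
    · simp [k1, f1 3, h3]
  · rw [h2.1 4 (by decide) (by decide), h4]
  · rw [h2.1 5 (by decide) (by decide)]
  · obtain ⟨k1, k2, k3, k4⟩ := h2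
    obtain ⟨⟨f1, f2⟩, l1, l2⟩ := h3'
    refine ⟨?_, ?_, ?_, fun x hx => (f2 x hx).trans (k3 x hx), l2.trans k4⟩ <;>
      simp only [List.foldl, Instr.run, Function.update_apply]
    · intro x hx h6 h15
      simp [h15, f1 x hx, k1 x hx h6]
    · simp [f1 6, k2]
    · simp [f1 3, l1, k1 3, h3, k2, k1 5]
  · simp only [List.length]; omega

/-- The number of steps of `loadProg`. -/
def loadTime (m : ℕ) : ℕ := m * (m * 8 + 18) + m * 3 + 8

/-- Loads the first gate as the first table of coefficients. -/
def firstProg : Program :=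
  .seq (block (.iadd 20 6 3) []) (.seq (loadProg 6) (block (.iconst 8 0) [.iconst 11 0]))

/-- A pair `(b, 1)` has the same number as the letter `b`, so rows of length `B²` place the affine
coefficients at `c = .one`. The additional column falls on the pair with `c = q̂_1`, `b = 1`, where
it has to vanish: the complex register `4` is still zero. -/
theorem exec_firstProg [NeZero m] {t d : ℕ} {g : ℕ → DispOrth m} {γ : ℕ → ℝ} {s0 : State}
    (hg : GateData t g γ s0) (s : State) (he : Env m t d s0 s) (h12 : s.ireg 12 = 0)
    (h13 : s.ireg 13 = 0) (hc : s.creg 4 = 0) (h0 : s.cmem 0 = s0.cmem 0)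
    (h6 : ∀ a n, 6 ≤ a → s.cmem a n = 0) :
    Exec firstProg s (loadTime m + 3) (LayerInv t d g γ s0 0) := by
  have hm := Nat.pos_of_ne_zero (NeZero.ne m)
  have hB : 2 * m + 1 < (2 * m + 1) * (2 * m + 1) := by nlinarith
  refine ((Exec.block (Q := fun s' => s'.cmem = s.cmem ∧ s'.creg = s.creg ∧
      s'.ireg 20 = (2 * m + 1) * (2 * m + 1) ∧ ∀ x, x < 20 → s'.ireg x = s.ireg x) ?_).seq
    fun s1 h1 => (exec_loadProg (A := 6) (by decide) hm s1 ?_ ?_ ?_ ?_ h1.2.2.1 hB).seq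
      fun s2 h2 => Exec.block ?_).mono ?_ fun _ => id
  · refine ⟨rfl, rfl, ?_, ?_⟩ <;> simp only [List.foldl, Instr.run, Function.update_apply]
    · simp [he.pairs, he.zero]
    · intro x hx
      rw [if_neg (by omega)]
  · rw [h1.2.2.2 0 (by decide), he.modes]
  · rw [h1.2.2.2 3 (by decide), he.zero]
  · rw [h1.2.2.2 4 (by decide), he.one]
  · rw [h1.2.2.2 5 (by decide), he.letters]
  · obtain ⟨k1, k2, k3, k4⟩ := h1
    have p12 : s1.ireg 12 = 0 := by rw [k4 12 (by decide), h12]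
    have p13 : s1.ireg 13 = 0 := by rw [k4 13 (by decide), h13]
    have hcell := h2.cell
    rw [p12, p13] at hcell
    have i2 := he.input 2 (by decide) (by decide)
    have i3 := he.input 3 (by decide) (by decide)
    have i4 := he.input 4 (by decide) (by decide)
    have hR : ∀ i j : Fin m, s1.cmem 2 (0 + i * m + j) = (g 0).entry i j := fun i j => by
      rw [k1, i2, ← hg.matrices 0 (Nat.zero_le _) i j]
      simp
    have hu : ∀ i : Fin m, s1.cmem 3 (0 + i) = (g 0).u i := fun i => by
      rw [k1, i3, ← hg.dispPos 0 (Nat.zero_le _) i]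
      simp
    have hv : ∀ i : Fin m, s1.cmem 4 (0 + i) = (g 0).v i := fun i => by
      rw [k1, i4, ← hg.dispMom 0 (Nat.zero_le _) i]
      simp
    refine ⟨he.of_eq ?_ ?_ ?_, ?_, ?_, ?_, ?_, ?_, ?_⟩ <;>
      simp only [List.foldl, Instr.run, Function.update_apply]
    · intro x hx
      rw [if_neg (by omega), if_neg (by omega), h2.ireg x (by omega) (by omega) (by omega),
        k4 x (by omega)]
    · rw [h2.creg 6 (by decide), k2]
    · intro a h1 h5
      rw [h2.other a (by omega), k1]
    · simp
    · simp [h2.matrix, p12]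
    · simp [h2.disp, p13]
    · rw [h2.other 0 (by decide), k1, h0]
    · intro a b c
      simp only [Nat.reduceEqDiff, if_true, if_false, zero_add]
      rw [hcell _ _ (Letter.code_pair_lt b c), k1, h6 6 _ le_rfl]
      simp only [heisenberg]
      by_cases hcone : c = .one
      · subst hcone
        have e := loadEntry_affine s1 (g 0) 0 0 hR hu hv a b
        rw [Letter.code_one, zero_mul, zero_add, e]
        rfl
      · rw [if_neg hcone]
        have hcpos : 1 ≤ c.code := by
          rcases Nat.eq_zero_or_pos c.code with h | h
          · exact absurd (Letter.code_injective (h.trans Letter.code_one.symm)) hcone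
          · exact h
        have hge : 2 * m + 1 ≤ c.code * (2 * m + 1) + b.code := by nlinarith
        by_cases hx : c.code * (2 * m + 1) + b.code = 2 * m + 1
        · have e := loadEntry_last s1 (g 0) 0 0 hR a
          rw [hx, e, k2, hc, mul_zero]
        · rw [if_neg]
          unfold loadDone
          omega
    · intro r x _ _
      rw [h2.other 7 (by decide), k1, h6 7 _ (by decide)]
  · simp only [List.length, loadTime]; omega

/-! ### One layer of the circuit -/

/-- Processes one layer: a cubic phase gate and the displaced orthogonal gate that follows it. The
table of coefficients is extended by a row of coefficients of the square of `q̂_1`, and multiplied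
by the matrix of the gate. -/
def layerProg : Program :=
  .seq (block (.iadd 20 5 3) [.iadd 21 8 6, .iconst 22 1, .iadd 23 21 3, .iadd 24 23 5,
      .iconst 25 1, .iconst 26 0, .iadd 27 8 15])
    (.seq (gemmProg 6 6) (.seq (block (.cload 4 5 11) [.cmul 4 4 6, .iadd 20 7 3])
      (.seq (loadProg 7) (.seq (block (.iadd 20 5 3) [.iconst 21 0, .iadd 22 7 3, .iadd 23 8 3,
          .iadd 24 8 6, .iconst 25 1, .iadd 26 6 3, .iadd 27 8 15, .iadd 27 27 6, .iadd 8 27 3,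
          .iadd 11 11 4])
        (gemmProg 7 6)))))

/-- A bound on the number of steps of `layerProg`, in terms of the number `B` of letters. -/
def layerTime (m B : ℕ) : ℕ :=
  8 + ((B * (B * (1 * 7 + 8) + 6) + 2) + (3 + (loadTime m + (11 +
    (B * (B * B * ((B + 1) * 7 + 8) + 6) + 2)))))

-- In each scalar product of length `B + 1`, the first `B` summands give the linear part of the
-- recursion for `heisenberg`; the last one pairs the additional column of the gate with the
-- appended row and gives the quadratic part. The new table starts at `base + B³ + B²`, beyond
-- everything that is read.
set_option maxHeartbeats 1000000 in
theorem exec_layerProg [NeZero m] {t d : ℕ} {g : ℕ → DispOrth m} {γ : ℕ → ℝ} {s0 : State}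
    (hg : GateData t g γ s0) {i : ℕ} (hi : i < t) (s : State) (h : LayerInv t d g γ s0 i s) :
    Exec layerProg s (layerTime m (2 * m + 1)) (LayerInv t d g γ s0 (i + 1)) := by
  have hm := Nat.pos_of_ne_zero (NeZero.ne m)
  obtain ⟨he, hcount, hmat, hdisp, hmom, htab, hblank⟩ := h
  have hB3 : 3 ≤ 2 * m + 1 := by omega
  generalize hB : 2 * m + 1 = B at *
  generalize hbase : s.ireg 8 = base at *
  have hp : s.ireg 6 = B * B := by rw [he.pairs, hB]
  have ht : s.ireg 15 = B * B * B := by rw [he.triples, hB]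
  have hl : s.ireg 5 = B := by rw [he.letters, hB]
  have hw : s.ireg 7 = B + 1 := by rw [he.width, hB]
  have n1 : B ≤ B * B := Nat.le_mul_self B
  have n2 : 3 * (B * B) ≤ B * B * B := by
    rw [mul_comm 3]; exact Nat.mul_le_mul_left _ hB3
  refine (Exec.block (Q := fun s' =>
      GemmArgs s' B B 1 (base + B * B) (base + B * B) 1 0 (base + B * B * B) ∧ Frame s s' ∧
      s'.cmem = s.cmem) ?_).seq fun s1 h1 =>
    (exec_gemmProg 6 6 B B 1 _ _ 1 0 _ s1 h1.1 Nat.one_pos ?_ ?_).seq fun s2 h2 =>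
    (Exec.block (Q := fun s' => s'.cmem = s2.cmem ∧ (∀ x, x < 20 → s'.ireg x = s2.ireg x) ∧
      s'.ireg 20 = B + 1 ∧ s'.creg 4 = γ i * 6 ∧ s'.creg 6 = 6) ?_).seq fun s3 h3 =>
    (exec_loadProg (A := 7) (by decide) hm s3 ?_ ?_ ?_ ?_ h3.2.2.1 ?_).seq fun s4 h4 =>
    (Exec.block (Q := fun s' =>
      GemmArgs s' B (B * B) (B + 1) 0 base 1 (B * B) (base + B * B * B + B * B) ∧
      s'.cmem = s4.cmem ∧ (∀ x, x < 20 → x ≠ 8 → x ≠ 11 → s'.ireg x = s4.ireg x) ∧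
      s'.ireg 8 = base + B * B * B + B * B ∧ s'.ireg 11 = i + 1 ∧ s'.creg = s4.creg) ?_).seq
    fun s5 h5 => (exec_gemmProg 7 6 B (B * B) (B + 1) _ _ 1 _ _ s5 h5.1 Nat.one_pos ?_ ?_).mono
      le_rfl fun s6 h6 => ?_
  · have e0 := he.zero
    refine ⟨⟨?_, ?_, ?_, ?_, ?_, ?_, ?_, ?_, ?_, ?_⟩, ⟨?_, ?_⟩, ?_⟩ <;>
      simp only [List.foldl, Instr.run, Function.update_apply]
    · simp [he.zero]
    · simp [he.one]
    · simp [hl, e0]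
    · simp [hbase, hp]
    · simp
    · simp [hbase, hp, e0]
    · simp [hbase, hp, e0, hl]
    · simp
    · simp
    · simp [hbase, ht]
    · intro x hx
      simp only [show x ≠ 20 by omega, show x ≠ 21 by omega, show x ≠ 22 by omega,
        show x ≠ 23 by omega, show x ≠ 24 by omega, show x ≠ 25 by omega, show x ≠ 26 by omega,
        show x ≠ 27 by omega, if_false]
    · intro x hx
      trivial
  · intro _
    omega
  · intro y c hy hc
    omega
  · have f := h2.frame
    have e11 : s2.ireg 11 = i := by rw [f.ireg 11 (by decide), h1.2.1.ireg 11 (by decide), hcount]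
    have e5 : s2.cmem 5 = s0.cmem 5 := by
      rw [h2.other 5 (by decide), h1.2.2, he.input 5 (by decide) (by decide)]
    have e6 : s2.creg 6 = 6 := by
      rw [f.creg 6 (by decide), h1.2.1.creg 6 (by decide), he.six]
    have e7 : s2.ireg 7 = B + 1 := by rw [f.ireg 7 (by decide), h1.2.1.ireg 7 (by decide), hw]
    have e3 : s2.ireg 3 = 0 := by rw [f.ireg 3 (by decide), h1.2.1.ireg 3 (by decide), he.zero]
    refine ⟨rfl, ?_, ?_, ?_, ?_⟩ <;> simp only [List.foldl, Instr.run, Function.update_apply]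
    · intro x hx
      rw [if_neg (by omega)]
    · simp [e7, e3]
    · simp [e11, e5, e6, hg.cubicities i hi]
    · simp [e6]
  · rw [h3.2.1 0 (by decide), h2.frame.ireg 0 (by decide), h1.2.1.ireg 0 (by decide), he.modes]
  · rw [h3.2.1 3 (by decide), h2.frame.ireg 3 (by decide), h1.2.1.ireg 3 (by decide), he.zero]
  · rw [h3.2.1 4 (by decide), h2.frame.ireg 4 (by decide), h1.2.1.ireg 4 (by decide), he.one]
  · rw [h3.2.1 5 (by decide), h2.frame.ireg 5 (by decide), h1.2.1.ireg 5 (by decide), hl, hB]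
  · omega
  · have e : ∀ x, x < 20 → x ≠ 12 → x ≠ 13 → s4.ireg x = s.ireg x := fun x hx h12 h13 => by
      rw [h4.ireg x hx h12 h13, h3.2.1 x hx, h2.frame.ireg x hx, h1.2.1.ireg x hx]
    have e3 : s4.ireg 3 = 0 := (e 3 (by decide) (by decide) (by decide)).trans he.zero
    have e4 : s4.ireg 4 = 1 := (e 4 (by decide) (by decide) (by decide)).trans he.one
    have e5 : s4.ireg 5 = B := (e 5 (by decide) (by decide) (by decide)).trans hl
    have e6 : s4.ireg 6 = B * B := (e 6 (by decide) (by decide) (by decide)).trans hp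
    have e7 : s4.ireg 7 = B + 1 := (e 7 (by decide) (by decide) (by decide)).trans hw
    have e8 : s4.ireg 8 = base := (e 8 (by decide) (by decide) (by decide)).trans hbase
    have e15 : s4.ireg 15 = B * B * B := (e 15 (by decide) (by decide) (by decide)).trans ht
    have e11 : s4.ireg 11 = i := (e 11 (by decide) (by decide) (by decide)).trans hcount
    refine ⟨⟨?_, ?_, ?_, ?_, ?_, ?_, ?_, ?_, ?_, ?_⟩, rfl, ?_, ?_, ?_, rfl⟩ <;>
      simp only [List.foldl, Instr.run, Function.update_apply]
    · simp [e3]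
    · simp [e4]
    · simp [e5, e3]
    · simp
    · simp [e7, e3]
    · simp [e8, e3]
    · simp [e8, e6]
    · simp
    · simp [e6, e3]
    · simp [e8, e15, e6]
    · intro x hx h8 h11
      simp only [show x ≠ 20 by omega, show x ≠ 21 by omega, show x ≠ 22 by omega,
        show x ≠ 23 by omega, show x ≠ 24 by omega, show x ≠ 25 by omega, show x ≠ 26 by omega,
        show x ≠ 27 by omega, h8, h11, if_false]
    · simp [e8, e15, e6, e3]
    · simp [e11, e4]
  · intro h
    simp at h
  · intro y c hy hc
    have : c * (B * B) ≤ B * (B * B) := Nat.mul_le_mul_right _ (by omega)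
    have e : B * (B * B) = B * B * B := (mul_assoc B B B).symm
    omega
  · obtain ⟨-, m5, r5, b5, c5, q5⟩ := h5
    obtain ⟨m3, r3, -, g3, x3⟩ := h3
    obtain ⟨-, f1, m1⟩ := h1
    have hcell := h4.cell
    have e : ∀ x, x < 20 → s3.ireg x = s.ireg x := fun x hx => by
      rw [r3 x hx, h2.frame.ireg x hx, f1.ireg x hx]
    have p12 : s3.ireg 12 = (i + 1) * (m * m) := by rw [e 12 (by decide), hmat]
    have p13 : s3.ireg 13 = (i + 1) * m := by rw [e 13 (by decide), hdisp]
    have a : ∀ a, a ≠ 6 → s3.cmem a = s.cmem a := fun a ha => by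
      rw [m3, h2.other a ha, m1]
    have hR : ∀ j k : Fin m, s3.cmem 2 (s3.ireg 12 + j * m + k) = (g (i + 1)).entry j k :=
      fun j k => by
        rw [a 2 (by decide), he.input 2 (by decide) (by decide), ← hg.matrices (i + 1) hi j k, p12]
        congr 1; ring
    have hu : ∀ j : Fin m, s3.cmem 3 (s3.ireg 13 + j) = (g (i + 1)).u j := fun j => by
      rw [a 3 (by decide), he.input 3 (by decide) (by decide), ← hg.dispPos (i + 1) hi j, p13]
    have hv : ∀ j : Fin m, s3.cmem 4 (s3.ireg 13 + j) = (g (i + 1)).v j := fun j => by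
      rw [a 4 (by decide), he.input 4 (by decide) (by decide), ← hg.dispMom (i + 1) hi j, p13]
    have hblank' : ∀ r x, x < B + 1 → s4.cmem 7 (r * (B + 1) + x) =
        if loadDone m m r x then loadEntry s3 m (s3.ireg 12) (s3.ireg 13) r x else 0 := by
      intro r x hx
      rw [hcell r x hx]
      split_ifs with hd
      · rfl
      · rw [a 7 (by decide), hblank r x hx hd]
    refine ⟨he.of_eq ?_ ?_ ?_, ?_, ?_, ?_, ?_, ?_, ?_⟩
    · intro x hx
      rw [h6.frame.ireg x (by omega), r5 x (by omega) (by omega) (by omega),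
        h4.ireg x (by omega) (by omega) (by omega), e x (by omega)]
    · rw [h6.frame.creg 6 (by decide), q5, h4.creg 6 (by decide), x3, he.six]
    · intro n hn1 hn5
      rw [h6.other n (by omega), m5, h4.other n (by omega), a n (by omega)]
    · rw [h6.frame.ireg 11 (by decide), c5]
    · rw [h6.frame.ireg 12 (by decide), r5 12 (by decide) (by decide) (by decide), h4.matrix, p12]
      ring
    · rw [h6.frame.ireg 13 (by decide), r5 13 (by decide) (by decide) (by decide), h4.disp, p13]
      ring
    · rw [h6.other 0 (by decide), m5, h4.other 0 (by decide), a 0 (by decide), hmom]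
    · rw [h6.frame.ireg 8 (by decide), b5]
      intro l b c
      have hbB : b.code < B := hB ▸ b.code_lt
      have hcB : c.code < B := hB ▸ c.code_lt
      have hlB : l.code < B := hB ▸ l.code_lt
      have hpair : c.code * B + b.code < B * B := hB ▸ Letter.code_pair_lt b c
      have htab' : ∀ l' b' c' : Letter m,
          s5.cmem 6 (base + l'.code * (B * B) + (c'.code * B + b'.code)) =
          heisenberg i (fun k : Fin (i + 1) => g k) (fun k : Fin i => γ k) l' b' c' := by
        intro l' b' c'
        have hl' : l'.code + 1 ≤ B := hB ▸ l'.code_lt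
        have hpair' : c'.code * B + b'.code < B * B := hB ▸ Letter.code_pair_lt b' c'
        have : (l'.code + 1) * (B * B) ≤ B * (B * B) := Nat.mul_le_mul_right _ hl'
        rw [add_mul, one_mul, ← mul_assoc B B B] at this
        rw [m5, h4.other 6 (by decide), m3, h2.below _ (by omega), m1, ← htab l' b' c', hB]
      -- Inner length 1 and inner stride 0 make this the outer product of the linear coefficients of
      -- `q̂_1` with themselves. They start at `base + B²` since `.pos 0` has code 1, and are the
      -- first `B` entries of that row since `.one` has code 0.
      have hsq : s5.cmem 6 (base + B * B * B + (c.code * B + b.code)) =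
          heisenberg i (fun k : Fin (i + 1) => g k) (fun k : Fin i => γ k) (.pos 0) b .one *
          heisenberg i (fun k : Fin (i + 1) => g k) (fun k : Fin i => γ k) (.pos 0) c .one := by
        rw [m5, h4.other 6 (by decide), m3, ← add_assoc, h2.product _ _ hcB hbB, dot,
          Finset.sum_range_one, m1, ← htab (.pos 0) b .one, ← htab (.pos 0) c .one, hB,
          Letter.code_pos, Letter.code_one, mul_comm]
        simp
      rw [hB, h6.product _ _ hlB hpair, dot, Finset.sum_range_succ]
      simp only [zero_add, mul_one]
      simp only [heisenberg]
      congr 1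
      · rw [← hB, Letter.sum_range_code (m := m), hB]
        refine Finset.sum_congr rfl fun l' _ => ?_
        have hl' : l'.code < B + 1 := Nat.lt_succ_of_lt (hB ▸ l'.code_lt)
        have ev := loadEntry_affine s3 (g (i + 1)) _ _ hR hu hv l l'
        rw [m5, hblank' _ _ hl', ev, ← m5]
        rw [show base + (c.code * B + b.code) + l'.code * (B * B) =
          base + l'.code * (B * B) + (c.code * B + b.code) by ring, htab' l' b c]
        rfl
      · have ev := loadEntry_last s3 (g (i + 1)) (s3.ireg 12) (s3.ireg 13) hR l
        rw [hB] at ev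
        rw [m5, hblank' _ _ (Nat.lt_succ_self B), ev, ← m5, g3]
        rw [show base + (c.code * B + b.code) + B * (B * B) =
          base + B * B * B + (c.code * B + b.code) by ring, hsq, mul_comm (γ i : ℂ)]
        rfl
    · intro r x hx hd
      rw [hB] at hx ⊢
      rw [h6.other 7 (by decide), m5, hblank' r x hx, if_neg hd]

/-! ### The table of moments: its size and the substitution of letters -/

/-- Computes the size of the table of moments. -/
def powerProg : Program :=
  .seq (block (.iconst 10 1) [.iadd 14 2 2, .iconst 11 0])
    (.whileLt 11 14 (.seq (mulProg 10 5) (block (.iadd 10 21 3) [.iadd 11 11 4])))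

theorem exec_powerProg (s : State) (h3 : s.ireg 3 = 0) (h4 : s.ireg 4 = 1) :
    Exec powerProg s (2 * s.ireg 2 * (3 * s.ireg 5 + 6) + 4) fun s' =>
      (∀ x, x < 20 → x ≠ 10 → x ≠ 11 → x ≠ 14 → s'.ireg x = s.ireg x) ∧
      s'.ireg 10 = s.ireg 5 ^ (2 * s.ireg 2) ∧ (∀ x, 4 ≤ x → s'.creg x = s.creg x) ∧
      s'.cmem = s.cmem := by
  generalize hd : s.ireg 2 = d
  generalize hB : s.ireg 5 = B
  refine ((Exec.block (Q := fun s' =>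
      (∀ x, x < 20 → x ≠ 10 → x ≠ 11 → x ≠ 14 → s'.ireg x = s.ireg x) ∧
      (s'.ireg 10 = 1 ∧ s'.ireg 11 = 0 ∧ s'.ireg 14 = 2 * d) ∧
      (∀ x, 4 ≤ x → s'.creg x = s.creg x) ∧ s'.cmem = s.cmem) ?_).seq fun s1 h1 =>
    Exec.whileLt (T := 3 * B + 5) (2 * d) (fun i s' =>
      (∀ x, x < 20 → x ≠ 10 → x ≠ 11 → x ≠ 14 → s'.ireg x = s.ireg x) ∧
      (s'.ireg 10 = B ^ i ∧ s'.ireg 11 = i ∧ s'.ireg 14 = 2 * d) ∧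
      (∀ x, 4 ≤ x → s'.creg x = s.creg x) ∧ s'.cmem = s.cmem) ?_ ?_ ?_).mono ?_ fun _ => id
  · refine ⟨?_, ⟨?_, ?_, ?_⟩, ?_, rfl⟩ <;>
      simp only [List.foldl, Instr.run, Function.update_apply]
    · intro x hx h10 h11 h14
      simp [h10, h11, h14]
    · simp
    · simp
    · simp [hd, two_mul]
    · intro x hx
      trivial
  · simpa using h1
  · rintro i s2 hi ⟨k1, ⟨k2, k3, k4⟩, k5, k6⟩
    refine ⟨by omega, ?_⟩
    have e5 : s2.ireg 5 = B := (k1 5 (by decide) (by decide) (by decide) (by decide)).trans hB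
    have e4 : s2.ireg 4 = 1 := (k1 4 (by decide) (by decide) (by decide) (by decide)).trans h4
    have e3 : s2.ireg 3 = 0 := (k1 3 (by decide) (by decide) (by decide) (by decide)).trans h3
    refine ((exec_mulProg (x := 10) (y := 5) (by decide) (by decide) s2 e4).seq fun s3 h3 =>
      Exec.block ?_).mono ?_ fun _ => id
    · obtain ⟨⟨f1, f2⟩, l1, l2⟩ := h3
      refine ⟨?_, ⟨?_, ?_, ?_⟩, fun x hx => (f2 x hx).trans (k5 x hx), l2.trans k6⟩ <;>
        simp only [List.foldl, Instr.run, Function.update_apply]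
      · intro x hx h10 h11 h14
        simp [h10, h11, f1 x hx, k1 x hx h10 h11 h14]
      · simp [l1, f1 3, e3, k2, e5, pow_succ]
      · simp [f1 11, f1 4, e4, k3]
      · simp [f1 14, k4]
    · rw [e5]; simp only [List.length]; omega
  · rintro s2 ⟨k1, ⟨k2, k3, k4⟩, k5, k6⟩
    exact ⟨by omega, k1, k2, k5, k6⟩
  · simp only [List.length]
    exact le_of_eq (by ring)

/-- The state after the substitution of the first `k` letters in the table of moments. -/
structure ContractInv (t d : ℕ) (S : Letter m → Letter m → Letter m → ℂ)
    (M : List (Letter m) → ℂ) (s0 : State) (k : ℕ) (s : State) : Prop where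
  env : Env m t d s0 s
  counter : s.ireg 11 = k
  table : TableAt s (s.ireg 8) S
  size : s.ireg 10 = s.ireg 9 + (2 * m + 1) ^ (2 * d - k)
  content : ∀ w w' : List (Letter m), w.length = k → w'.length = 2 * (d - k) →
    s.cmem 0 (s.ireg 9 + listCode (w' ++ w)) = substitute S w fun u => M (u ++ w')

/-- Substitutes one letter in the table of moments. -/
def contractProg : Program :=
  .seq (block (.iadd 20 5 3) [.iadd 21 8 3, .iadd 22 6 3, .iadd 23 9 3, .iadd 24 10 3, .iadd 25 6 3,
      .iconst 26 1, .iadd 27 10 3, .iadd 11 11 4])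
    (.seq (gemmProg 6 0) (block (.iadd 9 10 3) [.iadd 10 27 3]))

/-- A bound on the number of steps of `contractProg`. -/
def contractTime (B d : ℕ) : ℕ :=
  9 + ((B * (B ^ (2 * d - 2) * (B * B * 7 + 8) + 6) + 2) + 2)

/-- The pair to be contracted occupies the two least significant digits, hence a contiguous block of
`B²` entries; the letter replacing it is the row index of the product and so becomes the most
significant digit. The digits rotate: every pass has the same form, and after `d` passes the letters
are in their original order. Correctness is `substitute_concat`. -/
theorem exec_contractProg {t d : ℕ} {S : Letter m → Letter m → Letter m → ℂ}
    {M : List (Letter m) → ℂ} {s0 : State} {k : ℕ} (hk : k < d) (s : State)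
    (h : ContractInv t d S M s0 k s) :
    Exec contractProg s (contractTime (2 * m + 1) d) (ContractInv t d S M s0 (k + 1)) := by
  obtain ⟨he, hcount, htab, hsize, hcont⟩ := h
  generalize hB : 2 * m + 1 = B at *
  generalize hbase : s.ireg 8 = base at *
  generalize hxb : s.ireg 9 = xb at *
  -- The words of the current table have `2d - k` letters: two are consumed, and the other `n` index
  -- the columns of the product.
  obtain ⟨n, hn⟩ : ∃ n, 2 * d - k = n + 2 := ⟨2 * d - k - 2, by omega⟩
  have hB0 : 0 < B := by omega
  have hp : s.ireg 6 = B * B := by rw [he.pairs, hB]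
  have hl : s.ireg 5 = B := by rw [he.letters, hB]
  have hsize' : s.ireg 10 = xb + B ^ n * (B * B) := by rw [hsize, hn]; ring
  refine ((Exec.block (Q := fun s' =>
      GemmArgs s' B (B ^ n) (B * B) base xb (B * B) 1 (xb + B ^ n * (B * B)) ∧
      (∀ x, x < 20 → x ≠ 11 → s'.ireg x = s.ireg x) ∧ s'.ireg 11 = k + 1 ∧
      s'.cmem = s.cmem ∧ s'.creg = s.creg) ?_).seq fun s1 h1 =>
    (exec_gemmProg 6 0 B (B ^ n) (B * B) _ _ _ 1 _ s1 h1.1 (Nat.mul_pos hB0 hB0) ?_ ?_).seq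
      fun s2 h2 => Exec.block ?_).mono ?_ fun _ => id
  · have e3 := he.zero
    refine ⟨⟨?_, ?_, ?_, ?_, ?_, ?_, ?_, ?_, ?_, ?_⟩, ?_, ?_, rfl, rfl⟩ <;>
      simp only [List.foldl, Instr.run, Function.update_apply]
    · simp [e3]
    · simp [he.one]
    · simp [hl, e3]
    · simp [hbase, e3]
    · simp [hp, e3]
    · simp [hxb, e3]
    · simp [hsize', e3]
    · simp [hp, e3]
    · simp
    · simp [hsize', e3]
    · intro x hx h11
      simp only [show x ≠ 20 by omega, show x ≠ 21 by omega, show x ≠ 22 by omega,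
        show x ≠ 23 by omega, show x ≠ 24 by omega, show x ≠ 25 by omega, show x ≠ 26 by omega,
        show x ≠ 27 by omega, h11, if_false]
    · simp [hcount, he.one]
  · intro h
    simp at h
  · intro y c hy hc
    have : (y + 1) * (B * B) ≤ B ^ n * (B * B) := Nat.mul_le_mul_right _ hy
    rw [add_mul] at this
    omega
  · obtain ⟨-, k1, k2, k3, k4⟩ := h1
    have e : ∀ x, x < 20 → x ≠ 11 → s2.ireg x = s.ireg x := fun x hx h11 => by
      rw [h2.frame.ireg x hx, k1 x hx h11]
    have hm6 : s2.cmem 6 = s.cmem 6 := by rw [h2.other 6 (by decide), k3]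
    have e3 : s2.ireg 3 = 0 := (e 3 (by decide) (by decide)).trans he.zero
    have e10 : s2.ireg 10 = xb + B ^ n * (B * B) := (e 10 (by decide) (by decide)).trans hsize'
    have f9 : (List.foldl Instr.run ((Instr.iadd 9 10 3).run s2) [.iadd 10 27 3]).ireg 9 =
        xb + B ^ n * (B * B) := by
      simp [Instr.run, e10, e3]
    have f8 : (List.foldl Instr.run ((Instr.iadd 9 10 3).run s2) [.iadd 10 27 3]).ireg 8 =
        base := by
      simp [Instr.run, e 8, hbase]
    refine ⟨he.of_eq ?_ ?_ ?_, ?_, ?_, ?_, ?_⟩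
    · intro x hx
      simp [Instr.run, show x ≠ 9 by omega, show x ≠ 10 by omega,
        e x (by omega) (by omega)]
    · simp [Instr.run, h2.frame.creg 6, k4]
    · intro a h1 h5
      simp [Instr.run, h2.other a (by omega), k3]
    · simp [Instr.run, h2.frame.ireg 11, k2]
    · rw [f8]
      intro a b c
      simp only [List.foldl, Instr.run]
      rw [hm6, htab]
    · rw [f9]
      simp only [List.foldl, Instr.run, Function.update_apply]
      simp only [if_true, Nat.reduceEqDiff, if_false]
      rw [h2.out, e3, hB, show 2 * d - (k + 1) = n + 1 by omega]
      ring
    · rw [f9]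
      simp only [List.foldl, Instr.run]
      intro w w' hw hw'
      obtain ⟨v, a, rfl⟩ : ∃ v a, w = v ++ [a] :=
        ⟨_, _, (List.dropLast_append_getLast (l := w) (by rintro rfl; simp at hw)).symm⟩
      have hv : v.length = k := by simpa using hw
      have hlen : (w' ++ v).length = n := by rw [List.length_append]; omega
      have haB : a.code < B := hB ▸ a.code_lt
      have hy : listCode (w' ++ v) < B ^ n := by
        have := listCode_lt (w' ++ v)
        rwa [hlen, hB] at this
      have hcode : listCode (w' ++ (v ++ [a])) = a.code * B ^ n + listCode (w' ++ v) := by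
        rw [← List.append_assoc, listCode_append, hlen, hB]
        simp only [listCode, mul_zero, add_zero]
        ring
      rw [hcode, ← add_assoc, h2.product _ _ haB hy, dot, substitute_concat, ← hB,
        Letter.sum_range_code_pair (m := m)
          (F := fun c => s1.cmem 6 (base + a.code * ((2 * m + 1) * (2 * m + 1)) + c) *
            s1.cmem 0 (xb + listCode (w' ++ v) * ((2 * m + 1) * (2 * m + 1)) + c * 1))]
      refine Finset.sum_congr rfl fun b _ => Finset.sum_congr rfl fun c _ => ?_
      have hc := hcont v (b :: c :: w') hv (by simp only [List.length_cons]; omega)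
      rw [k3, htab, smul_eq_mul]
      congr 1
      have hcode' : listCode (b :: c :: w' ++ v) =
          listCode (w' ++ v) * ((2 * m + 1) * (2 * m + 1)) +
            (c.code * (2 * m + 1) + b.code) * 1 := by
        simp only [List.cons_append, listCode]
        ring
      rw [hcode'] at hc
      rw [add_assoc, hc]
      simp only [List.append_assoc, List.cons_append, List.nil_append]
  · simp only [contractTime, List.length]
    have : B ^ n ≤ B ^ (2 * d - 2) := Nat.pow_le_pow_right hB0 (by omega)
    have : B ^ n * (B * B * 7 + 8) ≤ B ^ (2 * d - 2) * (B * B * 7 + 8) :=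
      Nat.mul_le_mul_right _ this
    have : B * (B ^ n * (B * B * 7 + 8) + 6) ≤ B * (B ^ (2 * d - 2) * (B * B * 7 + 8) + 6) :=
      Nat.mul_le_mul_left _ (by omega)
    omega

/-! ### Pairing with the coefficients of the polynomial -/

/-- The state before the last summation: the table of moments has been transformed into the table
`V` of the moments of the output. -/
structure FinalInv (d : ℕ) (V : List (Letter m) → ℂ) (s0 s : State) : Prop where
  zero : s.ireg 3 = 0
  one : s.ireg 4 = 1
  input : s.cmem 1 = s0.cmem 1
  size : s.ireg 10 = s.ireg 9 + (2 * m + 1) ^ d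
  content : ∀ w : List (Letter m), w.length = d → s.cmem 0 (s.ireg 9 + listCode w) = V w

/-- Sums the products of the coefficients of the polynomial and the moments of the output. -/
def finalProg : Program :=
  .seq (block (.iconst 20 1) [.iconst 21 0, .isub 22 10 9, .iadd 23 9 3, .iadd 24 9 4, .iconst 25 1,
      .iconst 26 1, .iadd 27 10 3])
    (.seq (gemmProg 1 0) (block (.cload 0 0 10) []))

/-- The sum is a `1 × 1` matrix product of inner length `(2m + 1)^d`. Its single entry is appended
just after the table, at the position in register `10`. -/
theorem exec_finalProg {d : ℕ} {V : List (Letter m) → ℂ} {s0 : State} (s : State)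
    (h : FinalInv d V s0 s) :
    Exec finalProg s (7 * (2 * m + 1) ^ d + 25) fun s' =>
      s'.creg 0 = ∑ w : Fin d → Letter m, s0.cmem 1 (wordCode w) * V (List.ofFn w) := by
  obtain ⟨h3, h4, hin, hsize, hcont⟩ := h
  generalize hxb : s.ireg 9 = xb at *
  refine ((Exec.block (Q := fun s' =>
      GemmArgs s' 1 1 ((2 * m + 1) ^ d) 0 xb 1 1 (xb + (2 * m + 1) ^ d) ∧
      s'.ireg 10 = xb + (2 * m + 1) ^ d ∧ s'.cmem = s.cmem) ?_).seq fun s1 h1 =>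
    (exec_gemmProg 1 0 1 1 ((2 * m + 1) ^ d) _ _ 1 1 _ s1 h1.1 Nat.one_pos ?_ ?_).seq
      fun s2 h2 => Exec.block ?_).mono ?_ fun _ => id
  · refine ⟨⟨?_, ?_, ?_, ?_, ?_, ?_, ?_, ?_, ?_, ?_⟩, ?_, rfl⟩ <;>
      simp only [List.foldl, Instr.run, Function.update_apply]
    · simp [h3]
    · simp [h4]
    · simp
    · simp
    · simp [hsize, hxb]
    · simp [hxb, h3]
    · simp [hxb, h4]
    · simp
    · simp
    · simp [hsize, h3]
    · simp [hsize]
  · intro h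
    simp at h
  · intro y c hy hc
    omega
  · simp only [List.foldl, Instr.run, Function.update_apply, if_true]
    have e : s2.ireg 10 = xb + (2 * m + 1) ^ d + 0 * 1 + 0 := by
      rw [h2.frame.ireg 10 (by decide), h1.2.1]; ring
    rw [e, h2.product 0 0 Nat.one_pos Nat.one_pos, dot, h1.2.2, hin,
      sum_range_wordCode d (F := fun c => s0.cmem 1 (0 + 0 * (2 * m + 1) ^ d + c) *
        s.cmem 0 (xb + 0 * 1 + c * 1))]
    refine Finset.sum_congr rfl fun w _ => ?_
    rw [← hcont (List.ofFn w) (by simp), listCode_ofFn]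
    simp
  · simp only [List.length]; omega

/-! ### Assembly of the main program -/

/-- The part of the main program for polynomials of positive degree. -/
def evolveProg : Program :=
  .seq sizesProg (.seq firstProg (.seq (.whileLt 11 1 layerProg) (.seq powerProg
    (.seq (block (.iconst 9 0) [.iconst 11 0]) (.whileLt 11 2 contractProg)))))

/-- A bound on the number of steps of `evolveProg`. -/
def evolveTime (m t d : ℕ) : ℕ :=
  6 * (2 * m + 1) + 8 + (loadTime m + 3 + (t * (layerTime m (2 * m + 1) + 1) + 1 +
    (2 * d * (3 * (2 * m + 1) + 6) + 4 + (2 + (d * (contractTime (2 * m + 1) d + 1) + 1)))))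

/-- The main program. -/
def mainProg : Program :=
  .seq (block (.iconst 4 1) [.iadd 5 0 0, .iadd 5 5 4, .iadd 7 5 4, .cconst 6 6])
    (.seq (.ifLt 3 2 evolveProg (block (.iconst 9 0) [.iconst 10 1])) finalProg)

/-- The state in which `evolveProg` is started. -/
structure StartInv (m t d : ℕ) (s0 s : State) : Prop where
  modes : s.ireg 0 = m
  layers : s.ireg 1 = t
  degree : s.ireg 2 = d
  zero : s.ireg 3 = 0
  one : s.ireg 4 = 1
  letters : s.ireg 5 = 2 * m + 1
  width : s.ireg 7 = 2 * m + 1 + 1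
  matrix : s.ireg 12 = 0
  disp : s.ireg 13 = 0
  factor : s.creg 4 = 0
  six : s.creg 6 = 6
  input : s.cmem = s0.cmem
  blank : ∀ a n, 6 ≤ a → s.cmem a n = 0

theorem exec_evolveProg [NeZero m] {t d : ℕ} {g : ℕ → DispOrth m} {γ : ℕ → ℝ} {s0 : State}
    (hg : GateData t g γ s0) {M : List (Letter m) → ℂ}
    (hM : ∀ l : List (Letter m), l.length = 2 * d → s0.cmem 0 (listCode l) = M l) (s : State)
    (h : StartInv m t d s0 s) :
    Exec evolveProg s (evolveTime m t d) (FinalInv d (fun w => substitute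
      (heisenberg t (fun k : Fin (t + 1) => g k) fun k : Fin t => γ k) w M) s0) := by
  refine ((exec_sizesProg s h.zero h.one).mono (T' := 6 * (2 * m + 1) + 8)
    (by rw [h.letters]) fun _ => id).seq fun s1 h1 =>
    (exec_firstProg hg s1 (d := d) ?_ ?_ ?_ ?_ ?_ ?_).seq fun s2 h2 =>
    (Exec.whileLt t (LayerInv t d g γ s0) h2
      (fun i s3 hi h3 => ⟨by rw [h3.counter, h3.env.layers]; exact hi,
        exec_layerProg hg hi s3 h3⟩)
      (Q := LayerInv t d g γ s0 t) fun s3 h3 =>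
        ⟨by rw [h3.counter, h3.env.layers]; exact lt_irrefl _, h3⟩).seq fun s3 h3 =>
    ((exec_powerProg s3 h3.env.zero h3.env.one).mono
      (T' := 2 * d * (3 * (2 * m + 1) + 6) + 4)
      (by rw [h3.env.degree, h3.env.letters]) fun _ => id).seq fun s4 h4 =>
    (Exec.block (Q := ContractInv t d (heisenberg t (fun k : Fin (t + 1) => g k)
      fun k : Fin t => γ k) M s0 0) ?_).seq fun s5 h5 =>
    Exec.whileLt d (ContractInv t d (heisenberg t (fun k : Fin (t + 1) => g k)
      fun k : Fin t => γ k) M s0) h5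
      (fun k s6 hk h6 => ⟨by rw [h6.counter, h6.env.degree]; exact hk,
        exec_contractProg hk s6 h6⟩) fun s6 h6 => ⟨?_, ?_⟩
  · obtain ⟨k1, k2, k3, k4, k5⟩ := h1
    have e : ∀ x, x < 20 → x ≠ 6 → x ≠ 15 → s1.ireg x = s.ireg x := k1
    exact ⟨by rw [e _ (by decide) (by decide) (by decide), h.modes],
      by rw [e _ (by decide) (by decide) (by decide), h.layers],
      by rw [e _ (by decide) (by decide) (by decide), h.degree],
      by rw [e _ (by decide) (by decide) (by decide), h.zero],
      by rw [e _ (by decide) (by decide) (by decide), h.one],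
      by rw [e _ (by decide) (by decide) (by decide), h.letters],
      by rw [k2, h.letters],
      by rw [e _ (by decide) (by decide) (by decide), h.width],
      by rw [k3, h.letters], by rw [k4 6 (by decide), h.six],
      fun a _ _ => by rw [k5, h.input]⟩
  · rw [h1.1 12 (by decide) (by decide) (by decide), h.matrix]
  · rw [h1.1 13 (by decide) (by decide) (by decide), h.disp]
  · rw [h1.2.2.2.1 4 le_rfl, h.factor]
  · rw [h1.2.2.2.2, h.input]
  · intro a n ha
    rw [h1.2.2.2.2, h.blank a n ha]
  · obtain ⟨k1, k2, k3, k4⟩ := h4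
    refine ⟨h3.env.of_eq ?_ ?_ ?_, ?_, ?_, ?_, ?_⟩ <;>
      simp only [List.foldl, Instr.run, Function.update_apply]
    · intro x hx
      rw [if_neg (by omega), if_neg (by omega),
        k1 x (by omega) (by omega) (by omega) (by omega)]
    · exact k3 6 (by decide)
    · intro a _ _
      rw [k4]
    · simp
    · intro a b c
      simp only [Nat.reduceEqDiff, if_false]
      rw [k4, k1 8 (by decide) (by decide) (by decide) (by decide)]
      exact h3.table a b c
    · simp [k2, h3.env.degree, h3.env.letters]
    -- Before the first contraction `w` is empty, and the claim is that the array still holds the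
    -- moments of the input.
    · intro w w' hw hw'
      obtain rfl := List.length_eq_zero_iff.1 hw
      simp only [Nat.reduceEqDiff, if_false, if_true, zero_add, List.append_nil, substitute,
        List.nil_append]
      rw [k4, h3.moments]
      exact hM w' hw'
  · rw [h6.counter, h6.env.degree]
    exact lt_irrefl _
  · refine ⟨h6.env.zero, h6.env.one, h6.env.input 1 le_rfl (by decide), ?_, ?_⟩
    · rw [h6.size, show 2 * d - d = d by omega]
    · intro w hw
      have := h6.content w [] hw (by simp)
      simpa using this

/-- Degree zero needs a separate branch: for `t = 0` and `d = 0` only constantly many steps are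
allowed, while merely loading the gate takes on the order of `m²` steps. -/
theorem exec_mainProg [NeZero m] {t d : ℕ} {g : Fin (t + 1) → DispOrth m} {γ : Fin t → ℝ}
    {M : (Fin (2 * d) → Letter m) → ℂ} {h : (Fin d → Letter m) → ℂ} {s : State}
    (hs : IsInput g γ M h s) :
    Exec mainProg s (5 + ((if 0 < d then evolveTime m t d else 2) + 1 + (7 * (2 * m + 1) ^ d + 25)))
      fun s' => s'.creg 0 = outputValue g γ M h := by
  -- Extending the gates and cubicities to all natural numbers lets the invariants speak of the
  -- first `i` layers without casts; the default values are never used.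
  set g' : ℕ → DispOrth m := fun k => if hk : k < t + 1 then g ⟨k, hk⟩ else g 0
  set γ' : ℕ → ℝ := fun k => if hk : k < t then γ ⟨k, hk⟩ else 0 with hγ'
  have hg'k : ∀ k (hk : k < t + 1), g' k = g ⟨k, hk⟩ := fun k hk => dif_pos hk
  have eg : (fun k : Fin (t + 1) => g' k) = g := funext fun k => hg'k k k.2
  have eγ : (fun k : Fin t => γ' k) = γ := by
    ext1 k
    simp [hγ']
  have hg : GateData t g' γ' s := by
    refine ⟨?_, ?_, ?_, ?_⟩
    · intro k hk i j
      rw [hg'k k (Nat.lt_succ_of_le hk)]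
      exact hs.matrices ⟨k, Nat.lt_succ_of_le hk⟩ i j
    · intro k hk i
      rw [hg'k k (Nat.lt_succ_of_le hk)]
      exact hs.dispPos ⟨k, Nat.lt_succ_of_le hk⟩ i
    · intro k hk i
      rw [hg'k k (Nat.lt_succ_of_le hk)]
      exact hs.dispMom ⟨k, Nat.lt_succ_of_le hk⟩ i
    · intro k hk
      have := hs.cubicities ⟨k, hk⟩
      simpa [hγ', hk] using this
  have hM : ∀ l : List (Letter m), l.length = 2 * d → s.cmem 0 (listCode l) = momentTable M l := by
    intro l hl
    rw [momentTable, dif_pos hl, ← hs.moments, ← listCode_ofFn, ofFn_get_cast l hl]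
  refine (Exec.block (Q := StartInv m t d s) ?_).seq fun s1 h1 =>
    (Exec.ifLt (Q := FinalInv d (fun w => substitute (heisenberg t g γ) w (momentTable M)) s)
      (fun hlt => ?_) fun hlt => ?_).seq fun s2 h2 => (exec_finalProg s2 h2).mono le_rfl
        fun s3 h3 => ?_
  · have z := hs.ireg_zero
    refine ⟨?_, ?_, ?_, ?_, ?_, ?_, ?_, ?_, ?_, ?_, ?_, rfl, fun a n ha => hs.cmem_zero a n ha⟩ <;>
      simp only [List.foldl, Instr.run, Function.update_apply]
    · simp [hs.modes]
    · simp [hs.layers]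
    · simp [hs.degree]
    · simp [z 3]
    · simp
    · simp [hs.modes, two_mul]
    · simp [hs.modes, two_mul]
    · simp [z 12]
    · simp [z 13]
    · simp [hs.creg_zero]
    · simp
  · rw [h1.zero, h1.degree] at hlt
    rw [if_pos hlt]
    have := exec_evolveProg hg hM s1 h1
    rwa [eg, eγ] at this
  · rw [h1.zero, h1.degree] at hlt
    -- The only moment is that of the empty word, which the circuit does not change, so the input
    -- table already is the output table.
    obtain rfl : d = 0 := by omega
    rw [if_neg (lt_irrefl _)]
    refine Exec.block ⟨?_, ?_, ?_, ?_, ?_⟩ <;>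
      simp only [List.foldl, Instr.run, Function.update_apply]
    · simp [h1.zero]
    · simp [h1.one]
    · rw [h1.input]
    · simp
    · intro w hw
      obtain rfl := List.length_eq_zero_iff.1 hw
      have := hM [] rfl
      simpa [h1.input, substitute, listCode] using this
  · rw [h3, outputValue]
    exact Finset.sum_congr rfl fun w _ => by rw [hs.coeffs]

/-! ### The number of steps -/

/-- Here and in the next two bounds the constant is the sum of the coefficients, all powers being
estimated by the largest one: `8 + 18 + 3 + 8 = 37`. -/
theorem loadTime_le {m B : ℕ} (hB : m ≤ B) (h1 : 1 ≤ B) : loadTime m ≤ 37 * B ^ 2 := by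
  unfold loadTime
  nlinarith [Nat.mul_le_mul hB hB]

theorem layerTime_le {m B : ℕ} (hB : m ≤ B) (h1 : 1 ≤ B) : layerTime m B ≤ 112 * B ^ 4 := by
  have hl := loadTime_le hB h1
  have e1 : B ≤ B ^ 4 := Nat.le_self_pow (by decide) B
  have e2 : B ^ 2 ≤ B ^ 4 := Nat.pow_le_pow_right h1 (by decide)
  have e3 : B ^ 3 ≤ B ^ 4 := Nat.pow_le_pow_right h1 (by decide)
  unfold layerTime
  ring_nf
  ring_nf at hl
  omega

/-- The dominant power is `B^(2d + 1)`, and `2d + 1 ≤ 3d` since `d` is positive. -/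
theorem contractTime_le {B d : ℕ} (hd : 0 < d) (h1 : 1 ≤ B) :
    contractTime B d ≤ 34 * B ^ (3 * d) := by
  obtain ⟨n, rfl⟩ : ∃ n, d = n + 1 := ⟨d - 1, by omega⟩
  unfold contractTime
  rw [show 2 * (n + 1) - 2 = 2 * n by omega]
  have e0 : 1 ≤ B ^ (3 * (n + 1)) := Nat.one_le_pow _ _ h1
  have e1 : B ^ 1 ≤ B ^ (3 * (n + 1)) := Nat.pow_le_pow_right h1 (by omega)
  have e2 : B ^ (2 * n + 1) ≤ B ^ (3 * (n + 1)) := Nat.pow_le_pow_right h1 (by omega)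
  have e3 : B ^ (2 * n + 3) ≤ B ^ (3 * (n + 1)) := Nat.pow_le_pow_right h1 (by omega)
  calc 9 + (B * (B ^ (2 * n) * (B * B * 7 + 8) + 6) + 2 + 2)
      = 13 + 6 * B ^ 1 + 8 * B ^ (2 * n + 1) + 7 * B ^ (2 * n + 3) := by ring
    _ ≤ 34 * B ^ (3 * (n + 1)) := by omega

theorem evolveTime_le {m t d : ℕ} (hm : 0 < m) (hd : 0 < d) :
    evolveTime m t d ≤ (100 * d + 100) * (2 * m + 1) ^ (3 * d) + 9073 * (t ^ 2 * m ^ 6) := by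
  have h1 : 1 ≤ 2 * m + 1 := by omega
  have hl := loadTime_le (B := 2 * m + 1) (by omega : m ≤ 2 * m + 1) h1
  have hlay := layerTime_le (B := 2 * m + 1) (by omega : m ≤ 2 * m + 1) h1
  have hc := contractTime_le hd h1
  have e0 : 1 ≤ (2 * m + 1) ^ (3 * d) := Nat.one_le_pow _ _ h1
  have e1 : 2 * m + 1 ≤ (2 * m + 1) ^ (3 * d) := Nat.le_self_pow (by omega) _
  have e2 : (2 * m + 1) ^ 2 ≤ (2 * m + 1) ^ (3 * d) := Nat.pow_le_pow_right h1 (by omega)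
  have e4 : (2 * m + 1) ^ 4 ≤ 81 * m ^ 4 := by
    calc (2 * m + 1) ^ 4 ≤ (3 * m) ^ 4 := Nat.pow_le_pow_left (by omega) 4
      _ = 81 * m ^ 4 := by ring
  have e5 : 1 ≤ m ^ 4 := Nat.one_le_pow _ _ hm
  -- The layers cost `O(t m⁴)`, which is estimated by `t² m⁶`; the constant is `9073 = 112 · 81 +
  -- 1`.
  have hlay' : t * (layerTime m (2 * m + 1) + 1) ≤ 9073 * (t ^ 2 * m ^ 6) := by
    calc t * (layerTime m (2 * m + 1) + 1) ≤ t * (9073 * m ^ 4) :=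
          Nat.mul_le_mul_left _ (by omega)
      _ = 9073 * (t * m ^ 4) := by ring
      _ ≤ 9073 * (t ^ 2 * m ^ 6) := by
        refine Nat.mul_le_mul_left _ (Nat.mul_le_mul (Nat.le_self_pow (by decide) t) ?_)
        exact Nat.pow_le_pow_right hm (by decide)
  have hc' : d * (contractTime (2 * m + 1) d + 1) ≤ d * (35 * (2 * m + 1) ^ (3 * d)) :=
    Nat.mul_le_mul_left _ (by omega)
  have hp : 2 * d * (3 * (2 * m + 1) + 6) ≤ 2 * d * (9 * (2 * m + 1) ^ (3 * d)) :=
    Nat.mul_le_mul_left _ (by omega)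
  unfold evolveTime
  generalize (2 * m + 1) ^ (3 * d) = X at *
  nlinarith [Nat.zero_le (d * X)]

end CV

end

/-! ### The theorem -/

/-- One program computes, for all `m ≥ 1`, `t`, `d`, all circuits of displaced orthogonal and cubic
phase gates, all states with moments up to order `2d` and all polynomials of degree at most `d` in
the quadratures, the expectation value at the output of the circuit, in `O(m^{3d} + t² m⁶)` steps
for each fixed `d`. -/
theorem theorem1 :
    ∃ P : CV.Program, ∀ d : ℕ, ∃ C : ℕ, ∀ (m : ℕ) [NeZero m] (t : ℕ)
      (g : Fin (t + 1) → CV.DispOrth m) (γ : Fin t → ℝ)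
      (ρ : CV.Hilb m →L[ℂ] CV.Hilb m) (M : (Fin (2 * d) → CV.Letter m) → ℂ)
      (h : (Fin d → CV.Letter m) → ℂ),
      CV.IsState ρ →
      (∀ w : Fin (2 * d) → CV.Letter m,
        CV.HasExpectation ρ (CV.wordGraph (List.ofFn w)) (M w)) →
      ∃ v : ℂ,
        CV.HasExpectation
          (CV.circuit t g γ ∘L ρ ∘L ContinuousLinearMap.adjoint (CV.circuit t g γ))
          (CV.polyGraph h) v ∧
        CV.HasExpectation ρ (CV.conjGraph (CV.circuit t g γ) (CV.polyGraph h)) v ∧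
        ∀ s : CV.State, CV.IsInput g γ M h s →
          ∃ (n : ℕ) (s' : CV.State), CV.Runs P s n s' ∧
            n ≤ C * (m ^ (3 * d) + t ^ 2 * m ^ 6) ∧ s'.creg 0 = v := by
  refine ⟨CV.mainProg, fun d => ⟨(100 * d + 140) * 27 ^ d + 9073,
    fun m _ t g γ ρ M h _ hM => ⟨CV.outputValue g γ M h, CV.hasExpectation_output g γ h hM,
      CV.hasExpectation_conjGraph g γ h hM, fun s hs => ?_⟩⟩⟩
  obtain ⟨n, s', h1, h2, h3⟩ := CV.exec_mainProg hs
  refine ⟨n, s', h1, h2.trans ?_, h3⟩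
  have hm := Nat.pos_of_ne_zero (NeZero.ne m)
  -- Since `m ≥ 1`, `2m + 1 ≤ 3m`; this costs a factor `27^d`, allowed because the constant may
  -- depend on `d`.
  have hX : (2 * m + 1) ^ (3 * d) ≤ 27 ^ d * m ^ (3 * d) := by
    calc (2 * m + 1) ^ (3 * d) ≤ (3 * m) ^ (3 * d) := Nat.pow_le_pow_left (by omega) _
      _ = 27 ^ d * m ^ (3 * d) := by rw [mul_pow, pow_mul 3]; norm_num
  have hd : (2 * m + 1) ^ d ≤ (2 * m + 1) ^ (3 * d) :=
    Nat.pow_le_pow_right (by omega) (by omega)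
  have h0 : 1 ≤ (2 * m + 1) ^ (3 * d) := Nat.one_le_pow _ _ (by omega)
  -- Raising `100` to `140` absorbs the steps outside `evolveProg`: `5 + 1 + 25` and the multiple
  -- `7` of the power, together with the `2` of the other branch when `d = 0`.
  have key : 5 + ((if 0 < d then CV.evolveTime m t d else 2) + 1 + (7 * (2 * m + 1) ^ d + 25)) ≤
      (100 * d + 140) * (2 * m + 1) ^ (3 * d) + 9073 * (t ^ 2 * m ^ 6) := by
    have hs : (100 * d + 140) * (2 * m + 1) ^ (3 * d) =
      (100 * d + 100) * (2 * m + 1) ^ (3 * d) + 40 * (2 * m + 1) ^ (3 * d) := by ring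
    split_ifs with hpos
    · have := CV.evolveTime_le (t := t) hm hpos
      omega
    · rw [hs]
      omega
  calc _ ≤ _ := key
    _ ≤ (100 * d + 140) * (27 ^ d * m ^ (3 * d)) + 9073 * (t ^ 2 * m ^ 6) :=
        Nat.add_le_add_right (Nat.mul_le_mul_left _ hX) _
    _ ≤ _ := by
        have e1 := Nat.zero_le ((100 * d + 140) * 27 ^ d * (t ^ 2 * m ^ 6))
        have e2 := Nat.zero_le (9073 * m ^ (3 * d))
        nlinarith
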